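/- Fix integers $n\ge 2$, $a,b\ge 0$. Let $T(g)$ be a polynomial natural tensor of contravariant rank $a$ and covariant rank $b$ depending on a Riemannian metric $g$ in dimension $n$: there is a fixed finite real linear combination of partial contractions (of covariant against contravariant indices, with the free indices in any order) of tensor products of copies of $g$, $g^{-1}$ and the covariant derivatives $\nabla^rR$, $r\ge 0$, of the (covariant rank $4$) curvature tensor $R$ of $g$, whose evaluation is $T(g)$ for every smooth Riemannian metric $g$ on every smooth $n$-manifold. Suppose that $T$ has homogeneity $h\in\mathbb R$, i.e. $T(e^{2\omega}g)=e^{h\omega}T(g)$ for all constants $\omega\in\mathbb R$. For smooth functions $\omega$ put $$\Delta T(g,\omega)=e^{-h\omega}T(e^{2\omega}g)-T(g),\qquad \underline{\delta}T(g,\omega)=\frac{d}{dt}\Big|_{t=0}e^{-ht\omega}T(e^{2t\omega}g).$$ For an integer $m\ge 0$, say that a tensor $U(g,\omega)$ depending on a metric $g$ and a smooth function $\omega$ involves at most $m$ derivatives of $\omega$ if there is a fixed finite real linear combination of partial contractions of tensor products of copies of $g$, $g^{-1}$, the $\nabla^rR$ with $r\ge 0$, and the covariant derivatives $\nabla^l\omega$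 with $1\le l\le m$ (with respect to the Levi-Civita connection of $g$), whose evaluation is $U(g,\omega)$ for all $g$ and $\omega$ on all smooth $n$-manifolds. Proposition. Let $m\ge 0$. If $\underline{\delta}T$ involves at most $m$ derivatives of $\omega$, then so does $\Delta T$. -/

import Mathlib

open scoped Manifold ContDiff BigOperators

/- So that the manifold structure found on `ℝⁿ` is syntactically `chartedSpaceSelf`. -/
attribute [-instance] TopCat.of.chartedSpace TopCat.of.hasGroupoid

noncomputable section

namespace NatTensor

/-- The model space `ℝⁿ`. -/
abbrev Coord (n : ℕ) : Type := EuclideanSpace ℝ (Fin n)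

/-! ### Riemannian tensor calculus in local coordinates

In this part `G : Coord n → Matrix (Fin n) (Fin n) ℝ` is the matrix `(g_{ij})` of a metric in
a coordinate system, as a function of the coordinates. -/

section Coordinates

variable {n : ℕ}

/-- The partial derivative `∂ᵢ f (y)`. -/
def pd (i : Fin n) (f : Coord n → ℝ) (y : Coord n) : ℝ :=
  fderiv ℝ f y (EuclideanSpace.single i 1)

/-- The Christoffel symbol `Γᵏ_{ij} = ½ gᵏˡ (∂ᵢ g_{jl} + ∂ⱼ g_{il} - ∂ₗ g_{ij})`. -/
def christoffel (G : Coord n → Matrix (Fin n) (Fin n) ℝ) (k i j : Fin n) (y : Coord n) : ℝ :=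
  (1 / 2 : ℝ) * ∑ l, (G y)⁻¹ k l *
    (pd i (fun z => G z j l) y + pd j (fun z => G z i l) y - pd l (fun z => G z i j) y)

/-- The components, in a coordinate system, of a covariant tensor field of rank `s`. -/
abbrev CovField (n s : ℕ) : Type := Coord n → (Fin s → Fin n) → ℝ

/-- The covariant derivative of a covariant tensor field of rank `s`; the new index comes first:
`∇_{i} τ_{j₁…j_s} = ∂ᵢ τ_{j₁…j_s} - ∑_p ∑_q Γ^q_{i j_p} τ_{j₁…q…j_s}`, with `q` in place `p`. -/
def covDeriv (G : Coord n → Matrix (Fin n) (Fin n) ℝ) {s : ℕ} (τ : CovField n s) :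
    CovField n (s + 1) := fun y J =>
  pd (J 0) (fun z => τ z (Fin.tail J)) y -
    ∑ p : Fin s, ∑ q : Fin n,
      christoffel G q (J 0) (Fin.tail J p) y * τ y (Function.update (Fin.tail J) p q)

/-- The curvature tensor with all indices down, `R_{ijkl} = g(R(∂ᵢ, ∂ⱼ)∂ₖ, ∂ₗ)`, where
`R(∂ᵢ, ∂ⱼ)∂ₖ = (∂ᵢ Γᵐ_{jk} - ∂ⱼ Γᵐ_{ik} + Γᵖ_{jk} Γᵐ_{ip} - Γᵖ_{ik} Γᵐ_{jp}) ∂ₘ`. -/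
def riemann (G : Coord n → Matrix (Fin n) (Fin n) ℝ) : CovField n 4 := fun y J =>
  ∑ m, G y m (J 3) *
    (pd (J 0) (christoffel G m (J 1) (J 2)) y - pd (J 1) (christoffel G m (J 0) (J 2)) y +
      ∑ p, (christoffel G p (J 1) (J 2) y * christoffel G m (J 0) p y -
        christoffel G p (J 0) (J 2) y * christoffel G m (J 1) p y))

/-- The iterated covariant derivative `∇ʳ R` of the curvature tensor. -/
def nablaRiemann (G : Coord n → Matrix (Fin n) (Fin n) ℝ) : (r : ℕ) → CovField n (4 + r)
  | 0 => riemann G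
  | r + 1 => covDeriv G (nablaRiemann G r)

/-- The iterated covariant derivative `∇ˡ ω` of a function. -/
def nablaFun (G : Coord n → Matrix (Fin n) (Fin n) ℝ) (w : Coord n → ℝ) :
    (l : ℕ) → CovField n l
  | 0 => fun y _ => w y
  | l + 1 => covDeriv G (nablaFun G w l)

end Coordinates

/-! ### Partial contractions -/

/-- A partial contraction, of contravariant rank `a` and covariant rank `b`, of a tensor product
`∇^{r₁}R ⊗ ⋯ ⊗ ∇^{r_M}R ⊗ ∇^{l₁}ω ⊗ ⋯ ⊗ ∇^{l_N}ω ⊗ g ⊗ ⋯ ⊗ g ⊗ g⁻¹ ⊗ ⋯ ⊗ g⁻¹`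
(with `l_j ≥ 1`). The labels of the indices are `Fin a` for the free upper indices, `Fin b` for
the free lower indices, and `Fin numContr` for the contractions. Each upper (lower) index of the
product has one label, each free label is used once, and each contraction label is used once
above and once below. -/
structure PartialContraction (a b : ℕ) where
  /-- the number `M` of factors `∇ʳR` -/
  numR : ℕ
  /-- the numbers `r₁, …, r_M` of derivatives in these factors -/
  ordR : Fin numR → ℕ
  /-- the number `N` of factors `∇ˡω` -/
  numOm : ℕ
  /-- the numbers `l₁, …, l_N` of derivatives in these factors -/
  ordOm : Fin numOm → ℕ
  /-- `ω` itself does not occur undifferentiated -/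
  ordOm_pos : ∀ j, 1 ≤ ordOm j
  /-- the number of factors `g` -/
  numG : ℕ
  /-- the number of factors `g⁻¹` -/
  numGInv : ℕ
  /-- the number of contractions of an upper index against a lower index -/
  numContr : ℕ
  /-- the labelling of the lower indices -/
  lower : ((Σ i : Fin numR, Fin (4 + ordR i)) ⊕ (Σ j : Fin numOm, Fin (ordOm j)) ⊕
    (Fin numG × Fin 2)) ≃ (Fin b ⊕ Fin numContr)
  /-- the labelling of the upper indices -/
  upper : (Fin numGInv × Fin 2) ≃ (Fin a ⊕ Fin numContr)

/-- The component with upper indices `A` and lower indices `B`, at the point with coordinates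
`y`, of a partial contraction, for the metric `G` and the function `w` (both in coordinates). -/
def PartialContraction.eval {n a b : ℕ} (c : PartialContraction a b)
    (G : Coord n → Matrix (Fin n) (Fin n) ℝ) (w : Coord n → ℝ) (y : Coord n)
    (A : Fin a → Fin n) (B : Fin b → Fin n) : ℝ :=
  ∑ d : Fin c.numContr → Fin n,
    (∏ i, nablaRiemann G (c.ordR i) y
      (fun s => Sum.elim B d (c.lower (Sum.inl ⟨i, s⟩)))) *
    (∏ j, nablaFun G w (c.ordOm j) y
      (fun s => Sum.elim B d (c.lower (Sum.inr (Sum.inl ⟨j, s⟩))))) *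
    (∏ p, G y (Sum.elim B d (c.lower (Sum.inr (Sum.inr (p, 0)))))
      (Sum.elim B d (c.lower (Sum.inr (Sum.inr (p, 1)))))) *
    (∏ q, (G y)⁻¹ (Sum.elim A d (c.upper (q, 0))) (Sum.elim A d (c.upper (q, 1))))

/-- The evaluation of a finite real linear combination of partial contractions. -/
def evalComb {n a b : ℕ} (u : PartialContraction a b →₀ ℝ)
    (G : Coord n → Matrix (Fin n) (Fin n) ℝ) (w : Coord n → ℝ) (y : Coord n)
    (A : Fin a → Fin n) (B : Fin b → Fin n) : ℝ :=
  u.sum fun c r => r * c.eval G w y A B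

/-! ### Riemannian manifolds -/

section Manifolds

variable (n : ℕ) (M : Type) [TopologicalSpace M] [ChartedSpace (Coord n) M]
  [IsManifold (𝓡 n) ∞ M]

/-- A smooth Riemannian metric on `M`. -/
abbrev Metric : Type :=
  Bundle.ContMDiffRiemannianMetric (𝓡 n) ∞ (Coord n) (fun x : M => TangentSpace (𝓡 n) x)

variable {n M}

/-- The conformally related metric `e^{2ω} g`. -/
def conformal (om : C^∞⟮𝓡 n, M; ℝ⟯) (g : Metric n M) : Metric n M where
  inner x := Real.exp (2 * om x) • g.inner x
  symm x v w := by
    simp [g.symm x v w]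
  pos x v hv := by
    have := g.pos x v hv
    change 0 < Real.exp (2 * om x) * g.inner x v v
    positivity
  isVonNBounded x := by
    have hc : Real.exp (om x) ≠ 0 := (Real.exp_pos _).ne'
    refine ((g.isVonNBounded x).image
      ((Real.exp (om x))⁻¹ • ContinuousLinearMap.id ℝ (TangentSpace (𝓡 n) x))).subset ?_
    intro v hv
    refine ⟨Real.exp (om x) • v, ?_, by simp [smul_smul, hc]⟩
    have h2 : Real.exp (2 * om x) = Real.exp (om x) * Real.exp (om x) := by
      rw [← Real.exp_add, two_mul]
    simpa [h2, mul_assoc] using hv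
  contMDiff := by
    have h : ContMDiff (𝓡 n) 𝓘(ℝ, ℝ) ∞ (fun x => Real.exp (2 * om x)) := by
      have h1 : ContDiff ℝ ∞ (fun t : ℝ => Real.exp (2 * t)) := by fun_prop
      exact h1.contMDiff.comp om.contMDiff
    exact h.smul_section g.contMDiff

/-- The matrix `g_{ij} = g(∂ᵢ, ∂ⱼ)` of a metric in the chart `φ`, as a function of the
coordinates. -/
def metricMatrix (g : Metric n M) (φ : OpenPartialHomeomorph M (Coord n)) (y : Coord n) :
    Matrix (Fin n) (Fin n) ℝ := fun i j =>
  g.inner (φ.symm y)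
    (mfderiv 𝓘(ℝ, Coord n) (𝓡 n) φ.symm y (EuclideanSpace.single i (1 : ℝ) : Coord n))
    (mfderiv 𝓘(ℝ, Coord n) (𝓡 n) φ.symm y (EuclideanSpace.single j (1 : ℝ) : Coord n))

end Manifolds

/-! ### Tensors depending on a metric, and on a metric and a function

A tensor field on a manifold is given by its components in all charts: for a chart `φ` of the
smooth structure and a point of its domain with coordinates `y`, by the numbers
`T^{A₁…A_a}_{B₁…B_b}`. Values at charts `φ` outside the smooth structure and at `y` outside
`φ.target` carry no meaning and are never used. -/

/-- An assignment of a tensor field with `a` upper and `b` lower indices, given by its components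
in charts, to every smooth Riemannian metric on every `n`-manifold. -/
def MetricTensor (n a b : ℕ) : Type 1 :=
  ∀ (M : Type) [TopologicalSpace M] [T2Space M] [SecondCountableTopology M]
    [ChartedSpace (Coord n) M] [IsManifold (𝓡 n) ∞ M],
    Metric n M → OpenPartialHomeomorph M (Coord n) → Coord n →
      (Fin a → Fin n) → (Fin b → Fin n) → ℝ

/-- An assignment of a tensor field with `a` upper and `b` lower indices, given by its components
in charts, to every pair of a smooth Riemannian metric and a smooth function on every
`n`-manifold. -/
def MetricFunTensor (n a b : ℕ) : Type 1 :=
  ∀ (M : Type) [TopologicalSpace M] [T2Space M] [SecondCountableTopology M]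
    [ChartedSpace (Coord n) M] [IsManifold (𝓡 n) ∞ M],
    Metric n M → C^∞⟮𝓡 n, M; ℝ⟯ → OpenPartialHomeomorph M (Coord n) → Coord n →
      (Fin a → Fin n) → (Fin b → Fin n) → ℝ

/-- `T` is a polynomial natural tensor: a fixed finite linear combination of partial contractions
of `g`, `g⁻¹` and the `∇ʳR` (without factors `∇ˡω`) evaluates to `T(g)` for all metrics `g`. -/
def MetricTensor.IsPolynomialNatural {n a b : ℕ} (T : MetricTensor n a b) : Prop :=
  ∃ u : PartialContraction a b →₀ ℝ, (∀ c ∈ u.support, c.numOm = 0) ∧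
    ∀ (M : Type) [TopologicalSpace M] [T2Space M] [SecondCountableTopology M]
      [ChartedSpace (Coord n) M] [IsManifold (𝓡 n) ∞ M] (g : Metric n M),
      ∀ φ ∈ IsManifold.maximalAtlas (𝓡 n) ∞ M, ∀ y ∈ φ.target,
        ∀ (A : Fin a → Fin n) (B : Fin b → Fin n),
          T M g φ y A B = evalComb u (metricMatrix g φ) 0 y A B

/-- `T` has homogeneity `h`: `T(e^{2ω} g) = e^{hω} T(g)` for constants `ω`. -/
def MetricTensor.HasHomogeneity {n a b : ℕ} (T : MetricTensor n a b) (h : ℝ) : Prop :=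
  ∀ (M : Type) [TopologicalSpace M] [T2Space M] [SecondCountableTopology M]
    [ChartedSpace (Coord n) M] [IsManifold (𝓡 n) ∞ M] (g : Metric n M) (om : ℝ),
    ∀ φ ∈ IsManifold.maximalAtlas (𝓡 n) ∞ M, ∀ y ∈ φ.target,
      ∀ (A : Fin a → Fin n) (B : Fin b → Fin n),
        T M (conformal (ContMDiffMap.const om) g) φ y A B = Real.exp (h * om) * T M g φ y A B

/-- `U(g, ω)` involves at most `m` derivatives of `ω`: a fixed finite linear combination of
partial contractions of `g`, `g⁻¹`, the `∇ʳR` and the `∇ˡω` with `1 ≤ l ≤ m` evaluates to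
`U(g, ω)` for all `g` and `ω`. -/
def MetricFunTensor.InvolvesAtMost {n a b : ℕ} (m : ℕ) (U : MetricFunTensor n a b) : Prop :=
  ∃ u : PartialContraction a b →₀ ℝ, (∀ c ∈ u.support, ∀ j, c.ordOm j ≤ m) ∧
    ∀ (M : Type) [TopologicalSpace M] [T2Space M] [SecondCountableTopology M]
      [ChartedSpace (Coord n) M] [IsManifold (𝓡 n) ∞ M] (g : Metric n M) (om : C^∞⟮𝓡 n, M; ℝ⟯),
      ∀ φ ∈ IsManifold.maximalAtlas (𝓡 n) ∞ M, ∀ y ∈ φ.target,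
        ∀ (A : Fin a → Fin n) (B : Fin b → Fin n),
          U M g om φ y A B = evalComb u (metricMatrix g φ) (fun z => om (φ.symm z)) y A B

/-- The full conformal variation `e^{-hω} T(e^{2ω} g) - T(g)`. -/
def MetricTensor.fullVariation {n a b : ℕ} (T : MetricTensor n a b) (h : ℝ) :
    MetricFunTensor n a b :=
  fun M _ _ _ _ _ g om φ y A B =>
    Real.exp (-h * om (φ.symm y)) * T M (conformal om g) φ y A B - T M g φ y A B

/-- The scaling-corrected infinitesimal conformal variation
`d/dt (e^{-htω} T(e^{2tω} g))` at `t = 0`. -/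
def MetricTensor.infVariation {n a b : ℕ} (T : MetricTensor n a b) (h : ℝ) :
    MetricFunTensor n a b :=
  fun M _ _ _ _ _ g om φ y A B =>
    deriv (fun t : ℝ => Real.exp (-h * t * om (φ.symm y)) * T M (conformal (t • om) g) φ y A B) 0

end NatTensor

end

/-! # Conformal variations of natural tensors

The full conformal variation of a homogeneous polynomial natural tensor involves at most as many
derivatives of the conformal factor as the infinitesimal one.

By the conformal change of `∇ʳR`, the rescaled value `e^{-hω} T(e^{2ω} g)` is a linear combination
of partial contractions in `g`, `g⁻¹`, `∇ʳR` and `∇ˡω` with `l ≤ L` for some `L`. If `L > m`, replace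
`ω`, near a given point, by `ω + ψ` with `ψ` vanishing to order `L` there and chosen so that the
symmetrization of `∇ᴸ(ω + ψ)` vanishes at the point. This does not change the value, since the
infinitesimal variation at every `e^{2(ω + tψ)} g` in the direction `ψ` vanishes at the point; and
by the Ricci identity `∇ᴸ(ω + ψ)` is then given by the derivatives of `ω` of order less than `L`.
-/

noncomputable section

namespace NatTensor

/-! ### Partial derivatives of smooth functions -/

section Calculus

variable {n : ℕ} {Ω : Set (Coord n)} {f g : Coord n → ℝ} {y : Coord n}

/-! Write F(ω) for e^{-hω} T(e^{2ω} g), the value called `MetricTensor.rescaled` below. Conformal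
rescalings compose, so the derivative of t ↦ F(ω + tψ) at a point is e^{-h(ω + tψ)} times the
infinitesimal variation of T at the metric e^{2(ω + tψ)} g in the direction ψ. If ψ vanishes to
order m + 1 at the point, this is zero for every t. Hence F(ω) at a point depends only on the
derivatives of ω of order at most m there (`MetricTensor.rescaled_add`).

It remains to turn this pointwise dependence into a universal formula. Some formula of finite order
L exists: the derivatives of the curvature of e^{2ω} g are e^{2ω} times natural expressions without
undifferentiated ω (`nablaRiemann_confMatrix`, `IsNatural.confNablaRiemann`). To cancel the
remaining exponentials against e^{-hω}, T is first written with contractions of weight h only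
(`MetricTensor.IsPolynomialNatural.exists_weight_eq`).

The order is then lowered from k + 1 to k as long as k ≥ m
(`MetricFunTensor.InvolvesAtMost.rescaled_of_succ`). At a given point the symmetric part of ∇^{k+1}ω
is cancelled by adding a ψ that vanishes to order k + 1, which does not change F. What is left of
∇^{k+1}ω is, by the Ricci identity, a fixed natural expression in derivatives of order at most k
(`IsNatural.nablaFun_sub_symmetrization`). Substituting it gives a formula in which ψ no longer
occurs, with the same coefficients at all points and for all metrics.

Naturality is handled in two forms. `IsNatural` is generated by tensor operations, so that closure
under ∇ is a structural induction. `monoSpan` is the span of the partial contractions, in which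
factors can be substituted. The passage from the first to the second is
`IsNatural.exists_mem_monoSpan`. -/

theorem differentiableAt_of_contDiffOn (hΩ : IsOpen Ω) (hf : ContDiffOn ℝ ∞ f Ω) (hy : y ∈ Ω) :
    DifferentiableAt ℝ f y :=
  (hf.contDiffAt (hΩ.mem_nhds hy)).differentiableAt (by simp)

theorem pd_congr (i : Fin n) (h : f =ᶠ[nhds y] g) : pd i f y = pd i g y := by
  unfold pd; rw [h.fderiv_eq]

theorem pd_congr_of_eqOn (hΩ : IsOpen Ω) (i : Fin n) (h : ∀ z ∈ Ω, f z = g z) (hy : y ∈ Ω) :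
    pd i f y = pd i g y :=
  pd_congr i (Filter.eventuallyEq_of_mem (hΩ.mem_nhds hy) h)

theorem contDiffOn_pd (hΩ : IsOpen Ω) (hf : ContDiffOn ℝ ∞ f Ω) (i : Fin n) :
    ContDiffOn ℝ ∞ (pd i f) Ω :=
  (hf.fderiv_of_isOpen hΩ (by simp)).clm_apply contDiffOn_const

theorem pd_const (i : Fin n) (c : ℝ) : pd i (fun _ => c) y = 0 := by
  simp [pd]

theorem pd_add (i : Fin n) (hf : DifferentiableAt ℝ f y) (hg : DifferentiableAt ℝ g y) :
    pd i (fun z => f z + g z) y = pd i f y + pd i g y := by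
  unfold pd; rw [fderiv_fun_add hf hg]; rfl

theorem pd_sub (i : Fin n) (hf : DifferentiableAt ℝ f y) (hg : DifferentiableAt ℝ g y) :
    pd i (fun z => f z - g z) y = pd i f y - pd i g y := by
  unfold pd; rw [fderiv_fun_sub hf hg]; rfl

theorem pd_mul (i : Fin n) (hf : DifferentiableAt ℝ f y) (hg : DifferentiableAt ℝ g y) :
    pd i (fun z => f z * g z) y = pd i f y * g y + f y * pd i g y := by
  unfold pd; rw [fderiv_fun_mul hf hg]; simp; ring

theorem pd_const_mul (i : Fin n) (c : ℝ) (hf : DifferentiableAt ℝ f y) :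
    pd i (fun z => c * f z) y = c * pd i f y := by
  rw [pd_mul i (differentiableAt_const c) hf, pd_const]; ring

theorem pd_sum {ι : Type*} (i : Fin n) (s : Finset ι) {F : ι → Coord n → ℝ}
    (hF : ∀ k ∈ s, DifferentiableAt ℝ (F k) y) :
    pd i (fun z => ∑ k ∈ s, F k z) y = ∑ k ∈ s, pd i (F k) y := by
  unfold pd; rw [fderiv_fun_sum hF]; simp

theorem pd_exp (i : Fin n) (c : ℝ) (hf : DifferentiableAt ℝ f y) :
    pd i (fun z => Real.exp (c * f z)) y = Real.exp (c * f y) * (c * pd i f y) := by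
  unfold pd; rw [fderiv_exp (hf.const_mul c), fderiv_const_mul hf]; simp

theorem pd_comm (hΩ : IsOpen Ω) (hf : ContDiffOn ℝ ∞ f Ω) (hy : y ∈ Ω) (i j : Fin n) :
    pd i (pd j f) y = pd j (pd i f) y := by
  have h1 : ContDiffAt ℝ ∞ f y := hf.contDiffAt (hΩ.mem_nhds hy)
  have h2 : DifferentiableAt ℝ (fderiv ℝ f) y :=
    ((hf.fderiv_of_isOpen hΩ (m := ∞) (by simp)).contDiffAt (hΩ.mem_nhds hy)).differentiableAt
      (by simp)
  have key : ∀ a b : Fin n, pd a (pd b f) y =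
      fderiv ℝ (fderiv ℝ f) y (EuclideanSpace.single a 1) (EuclideanSpace.single b 1) := by
    intro a b
    unfold pd
    rw [fderiv_clm_apply h2 (differentiableAt_const _)]
    simp
  rw [key, key]
  exact (h1.isSymmSndFDerivAt (by simp; exact WithTop.coe_le_coe.2 (le_top : (2 : ℕ∞) ≤ ⊤))).eq _ _

end Calculus

/-! ### Smooth nondegenerate symmetric matrix functions -/

/-- A smooth nondegenerate symmetric matrix function, on an open set of `ℝⁿ`. -/
structure IsLocalMetric {n : ℕ} (Ω : Set (Coord n)) (G : Coord n → Matrix (Fin n) (Fin n) ℝ) :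
    Prop where
  isOpen : IsOpen Ω
  smooth : ∀ i j, ContDiffOn ℝ ∞ (fun z => G z i j) Ω
  symm : ∀ z ∈ Ω, ∀ i j, G z i j = G z j i
  det_ne : ∀ z ∈ Ω, (G z).det ≠ 0

section LocalMetric

variable {n : ℕ} {Ω : Set (Coord n)} {G : Coord n → Matrix (Fin n) (Fin n) ℝ} {y : Coord n}

theorem contDiffOn_det {ι : Type*} [Fintype ι] [DecidableEq ι] {H : Coord n → Matrix ι ι ℝ}
    (h : ∀ i j, ContDiffOn ℝ ∞ (fun z => H z i j) Ω) : ContDiffOn ℝ ∞ (fun z => (H z).det) Ω := by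
  simp only [Matrix.det_apply']
  exact ContDiffOn.sum fun σ _ => contDiffOn_const.mul (contDiffOn_prod fun i _ => h _ _)

namespace IsLocalMetric

theorem inv_smooth (hG : IsLocalMetric Ω G) (i j : Fin n) :
    ContDiffOn ℝ ∞ (fun z => (G z)⁻¹ i j) Ω := by
  have h : ∀ z, (G z)⁻¹ i j = (G z).det⁻¹ * (G z).adjugate i j := by
    intro z; rw [Matrix.inv_def]; simp
  simp only [h, Matrix.adjugate_apply]
  refine ((contDiffOn_det hG.smooth).inv hG.det_ne).mul (contDiffOn_det fun k l => ?_)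
  -- An entry of the adjugate is the determinant of `G` with row `j` replaced by a constant basis
  -- vector.
  by_cases hk : k = j
  · subst hk; simp only [Matrix.updateRow_self]; exact contDiffOn_const
  · simp only [Matrix.updateRow_ne hk]; exact hG.smooth k l

theorem inv_mul (hG : IsLocalMetric Ω G) (hy : y ∈ Ω) (i j : Fin n) :
    ∑ k, (G y)⁻¹ i k * G y k j = if i = j then 1 else 0 := by
  have := congrFun (congrFun (Matrix.nonsing_inv_mul (G y) (hG.det_ne y hy).isUnit) i) j
  rw [Matrix.mul_apply, Matrix.one_apply] at this
  exact this

theorem mul_inv (hG : IsLocalMetric Ω G) (hy : y ∈ Ω) (i j : Fin n) :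
    ∑ k, G y i k * (G y)⁻¹ k j = if i = j then 1 else 0 := by
  have := congrFun (congrFun (Matrix.mul_nonsing_inv (G y) (hG.det_ne y hy).isUnit) i) j
  rw [Matrix.mul_apply, Matrix.one_apply] at this
  exact this

theorem lower_raise (hG : IsLocalMetric Ω G) (hy : y ∈ Ω) (a : Fin n → ℝ) (m : Fin n) :
    ∑ l, G y m l * ∑ k, (G y)⁻¹ l k * a k = a m := by
  simp only [Finset.mul_sum]
  rw [Finset.sum_comm]
  simp only [← mul_assoc, ← Finset.sum_mul, hG.mul_inv hy]
  simp

theorem raise_lower (hG : IsLocalMetric Ω G) (hy : y ∈ Ω) (a : Fin n → ℝ) (m : Fin n) :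
    ∑ l, (G y)⁻¹ m l * ∑ k, G y l k * a k = a m := by
  simp only [Finset.mul_sum]
  rw [Finset.sum_comm]
  simp only [← mul_assoc, ← Finset.sum_mul, hG.inv_mul hy]
  simp

theorem christoffel_smooth (hG : IsLocalMetric Ω G) (k i j : Fin n) :
    ContDiffOn ℝ ∞ (christoffel G k i j) Ω := by
  unfold christoffel
  exact contDiffOn_const.mul (ContDiffOn.sum fun l _ => (hG.inv_smooth k l).mul
    (((contDiffOn_pd hG.isOpen (hG.smooth _ _) _).add
      (contDiffOn_pd hG.isOpen (hG.smooth _ _) _)).sub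
      (contDiffOn_pd hG.isOpen (hG.smooth _ _) _)))

theorem pd_symm (hG : IsLocalMetric Ω G) (hy : y ∈ Ω) (k i j : Fin n) :
    pd k (fun z => G z i j) y = pd k (fun z => G z j i) y :=
  pd_congr_of_eqOn hG.isOpen k (fun z hz => hG.symm z hz i j) hy

theorem christoffel_symm (hG : IsLocalMetric Ω G) (hy : y ∈ Ω) (k i j : Fin n) :
    christoffel G k i j y = christoffel G k j i y := by
  unfold christoffel
  congr 1
  refine Finset.sum_congr rfl fun l _ => ?_
  rw [hG.pd_symm hy l i j]; ring

theorem lower_christoffel (hG : IsLocalMetric Ω G) (hy : y ∈ Ω) (m i j : Fin n) :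
    ∑ k, G y m k * christoffel G k i j y = (1 / 2 : ℝ) *
      (pd i (fun z => G z j m) y + pd j (fun z => G z i m) y - pd m (fun z => G z i j) y) := by
  unfold christoffel
  rw [← hG.lower_raise hy (fun l => (1 / 2 : ℝ) *
    (pd i (fun z => G z j l) y + pd j (fun z => G z i l) y - pd l (fun z => G z i j) y)) m]
  refine Finset.sum_congr rfl fun k _ => ?_
  rw [Finset.mul_sum]
  congr 1
  refine Finset.sum_congr rfl fun l _ => ?_
  ring

/-- The Levi-Civita connection is compatible with the metric. -/
theorem pd_metric (hG : IsLocalMetric Ω G) (hy : y ∈ Ω) (k i j : Fin n) :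
    pd k (fun z => G z i j) y =
      ∑ q, christoffel G q k i y * G y q j + ∑ q, christoffel G q k j y * G y i q := by
  have h1 := hG.lower_christoffel hy j k i
  have h2 := hG.lower_christoffel hy i k j
  have e1 : ∑ q, christoffel G q k i y * G y q j = ∑ q, G y j q * christoffel G q k i y :=
    Finset.sum_congr rfl fun q _ => by rw [hG.symm y hy q j]; ring
  have e2 : ∑ q, christoffel G q k j y * G y i q = ∑ q, G y i q * christoffel G q k j y :=
    Finset.sum_congr rfl fun q _ => by ring
  rw [e1, e2, h1, h2, hG.pd_symm hy k j i, hG.pd_symm hy i k j, hG.pd_symm hy j k i]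
  ring

/-- Differentiating G⁻¹G = 1 gives ∂G⁻¹ = -G⁻¹(∂G)G⁻¹, and `pd_metric` expresses ∂G by Christoffel
symbols. In invariant terms, ∇g⁻¹ = 0. -/
theorem pd_metric_inv (hG : IsLocalMetric Ω G) (hy : y ∈ Ω) (k i j : Fin n) :
    pd k (fun z => (G z)⁻¹ i j) y =
      -∑ q, christoffel G i k q y * (G y)⁻¹ q j - ∑ q, christoffel G j k q y * (G y)⁻¹ i q := by
  have dG : ∀ a b, DifferentiableAt ℝ (fun z => G z a b) y := fun a b =>
    differentiableAt_of_contDiffOn hG.isOpen (hG.smooth a b) hy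
  have dI : ∀ a b, DifferentiableAt ℝ (fun z => (G z)⁻¹ a b) y := fun a b =>
    differentiableAt_of_contDiffOn hG.isOpen (hG.inv_smooth a b) hy
  have h0 : ∀ b, ∑ a, pd k (fun z => (G z)⁻¹ i a) y * G y a b =
      -∑ a, (G y)⁻¹ i a * pd k (fun z => G z a b) y := by
    intro b
    have h1 : pd k (fun z => ∑ a, (G z)⁻¹ i a * G z a b) y = 0 := by
      rw [pd_congr_of_eqOn hG.isOpen k (fun z hz => hG.inv_mul hz i b) hy, pd_const]
    rw [pd_sum (F := fun a z => (G z)⁻¹ i a * G z a b) k _ fun a _ => (dI i a).mul (dG a b)] at h1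
    simp only [pd_mul k (dI _ _) (dG _ _), Finset.sum_add_distrib] at h1
    linarith
  have h3 : pd k (fun z => (G z)⁻¹ i j) y =
      ∑ b, (∑ a, pd k (fun z => (G z)⁻¹ i a) y * G y a b) * (G y)⁻¹ b j := by
    simp only [Finset.sum_mul]
    rw [Finset.sum_comm]
    simp only [mul_assoc, ← Finset.mul_sum, hG.mul_inv hy]
    simp
  rw [h3]
  simp only [h0, hG.pd_metric hy]
  have e1 : ∀ b, ∑ a, (G y)⁻¹ i a * (∑ q, christoffel G q k a y * G y q b +
      ∑ q, christoffel G q k b y * G y a q) =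
      ∑ a, (G y)⁻¹ i a * (∑ q, christoffel G q k a y * G y q b) + christoffel G i k b y := by
    intro b
    simp only [mul_add, Finset.sum_add_distrib]
    congr 1
    rw [← hG.raise_lower hy (fun q => christoffel G q k b y) i]
    refine Finset.sum_congr rfl fun a _ => ?_
    congr 1
    exact Finset.sum_congr rfl fun q _ => by ring
  simp only [e1, neg_mul, add_mul, Finset.sum_add_distrib, Finset.sum_neg_distrib, neg_add]
  rw [add_comm]
  rw [sub_eq_add_neg]
  congr 2
  simp only [Finset.sum_mul, Finset.mul_sum]
  rw [Finset.sum_comm]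
  have e2 : ∀ a, ∑ b, ∑ q, (G y)⁻¹ i a * (christoffel G q k a y * G y q b) * (G y)⁻¹ b j =
      christoffel G j k a y * (G y)⁻¹ i a := by
    intro a
    rw [Finset.sum_comm]
    have : ∀ q, ∑ b, (G y)⁻¹ i a * (christoffel G q k a y * G y q b) * (G y)⁻¹ b j =
        (G y)⁻¹ i a * christoffel G q k a y * ∑ b, G y q b * (G y)⁻¹ b j := by
      intro q; rw [Finset.mul_sum]; exact Finset.sum_congr rfl fun b _ => by ring
    simp only [this, hG.mul_inv hy]
    simp [mul_comm]
  simp only [e2]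

end IsLocalMetric

end LocalMetric

/-! ### Covariant derivatives of tensor fields with arbitrary finite index types -/

section CovariantDerivative

variable {n : ℕ} {Ω : Set (Coord n)} {G : Coord n → Matrix (Fin n) (Fin n) ℝ} {y : Coord n}

/-- The multi-index with value `j` in the new place `none` and the old values `J` elsewhere. -/
def optCons {α β : Type*} (j : α) (J : β → α) : Option β → α := fun o => o.elim j J

@[simp] theorem optCons_none {α β : Type*} (j : α) (J : β → α) : optCons j J none = j := rfl

@[simp] theorem optCons_some {α β : Type*} (j : α) (J : β → α) (p : β) :
    optCons j J (some p) = J p := rfl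

@[simp] theorem optCons_comp_some {α β : Type*} (j : α) (J : β → α) : optCons j J ∘ some = J := rfl

theorem optCons_eta {α β : Type*} (J : Option β → α) : optCons (J none) (J ∘ some) = J := by
  funext o; cases o <;> rfl

@[simp] theorem update_optCons_none {α β : Type*} [DecidableEq β] (j q : α) (J : β → α) :
    Function.update (optCons j J) none q = optCons q J := by
  funext o; cases o <;> simp [Function.update]

@[simp] theorem update_optCons_some {α β : Type*} [DecidableEq β] (j q : α) (J : β → α) (p : β) :
    Function.update (optCons j J) (some p) q = optCons j (Function.update J p q) := by
  funext o; cases o <;> simp [Function.update]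

/-- The covariant derivative of a covariant tensor field with index type `β`; the new index is
`none`. -/
def covD {β : Type} [Fintype β] [DecidableEq β] (G : Coord n → Matrix (Fin n) (Fin n) ℝ)
    (τ : Coord n → (β → Fin n) → ℝ) (y : Coord n) (J : Option β → Fin n) : ℝ :=
  pd (J none) (fun z => τ z (J ∘ some)) y -
    ∑ p : β, ∑ q : Fin n,
      christoffel G q (J none) (J (some p)) y * τ y (Function.update (J ∘ some) p q)

theorem covD_optCons {β : Type} [Fintype β] [DecidableEq β] (τ : Coord n → (β → Fin n) → ℝ)
    (i : Fin n) (J : β → Fin n) : covD G τ y (optCons i J) =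
      pd i (fun z => τ z J) y -
        ∑ p : β, ∑ q : Fin n, christoffel G q i (J p) y * τ y (Function.update J p q) := rfl

/-- This holds definitionally and carries all that is proved for `covD` over to `nablaRiemann` and
`nablaFun`. -/
theorem covDeriv_eq_covD {s : ℕ} (τ : CovField n s) (J : Fin (s + 1) → Fin n) :
    covDeriv G τ y J = covD G τ y (optCons (J 0) (Fin.tail J)) := rfl

/-- Smoothness of the components of a tensor field. -/
def SmoothTensor {β : Type} (Ω : Set (Coord n)) (τ : Coord n → (β → Fin n) → ℝ) : Prop :=
  ∀ J, ContDiffOn ℝ ∞ (fun z => τ z J) Ω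

theorem SmoothTensor.differentiableAt {β : Type} {τ : Coord n → (β → Fin n) → ℝ}
    (h : SmoothTensor Ω τ) (hΩ : IsOpen Ω) (hy : y ∈ Ω) (J : β → Fin n) :
    DifferentiableAt ℝ (fun z => τ z J) y :=
  differentiableAt_of_contDiffOn hΩ (h J) hy

theorem SmoothTensor.covD {β : Type} [Fintype β] [DecidableEq β] {τ : Coord n → (β → Fin n) → ℝ}
    (h : SmoothTensor Ω τ) (hG : IsLocalMetric Ω G) : SmoothTensor Ω (covD G τ) := fun _ =>
  (contDiffOn_pd hG.isOpen (h _) _).sub (ContDiffOn.sum fun _ _ => ContDiffOn.sum fun _ _ =>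
    (hG.christoffel_smooth _ _ _).mul (h _))

theorem covD_congr {β : Type} [Fintype β] [DecidableEq β] {σ τ : Coord n → (β → Fin n) → ℝ}
    (hΩ : IsOpen Ω) (hy : y ∈ Ω) (h : ∀ z ∈ Ω, ∀ J, σ z J = τ z J) (J : Option β → Fin n) :
    covD G σ y J = covD G τ y J := by
  unfold covD
  rw [pd_congr_of_eqOn hΩ _ (fun z hz => h z hz _) hy]
  simp only [h y hy]

theorem covD_add {β : Type} [Fintype β] [DecidableEq β] {σ τ : Coord n → (β → Fin n) → ℝ}
    (hΩ : IsOpen Ω) (hy : y ∈ Ω) (hσ : SmoothTensor Ω σ) (hτ : SmoothTensor Ω τ)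
    (J : Option β → Fin n) :
    covD G (fun z K => σ z K + τ z K) y J = covD G σ y J + covD G τ y J := by
  unfold covD
  rw [pd_add _ (hσ.differentiableAt hΩ hy _) (hτ.differentiableAt hΩ hy _)]
  simp only [mul_add, Finset.sum_add_distrib]
  ring

theorem covD_sub {β : Type} [Fintype β] [DecidableEq β] {σ τ : Coord n → (β → Fin n) → ℝ}
    (hΩ : IsOpen Ω) (hy : y ∈ Ω) (hσ : SmoothTensor Ω σ) (hτ : SmoothTensor Ω τ)
    (J : Option β → Fin n) :
    covD G (fun z K => σ z K - τ z K) y J = covD G σ y J - covD G τ y J := by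
  unfold covD
  rw [pd_sub _ (hσ.differentiableAt hΩ hy _) (hτ.differentiableAt hΩ hy _)]
  simp only [mul_sub, Finset.sum_sub_distrib]
  ring

theorem covD_const_mul {β : Type} [Fintype β] [DecidableEq β] {σ : Coord n → (β → Fin n) → ℝ}
    (hΩ : IsOpen Ω) (hy : y ∈ Ω) (c : ℝ) (hσ : SmoothTensor Ω σ) (J : Option β → Fin n) :
    covD G (fun z K => c * σ z K) y J = c * covD G σ y J := by
  unfold covD
  rw [pd_const_mul _ _ (hσ.differentiableAt hΩ hy _), mul_sub, Finset.mul_sum]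
  congr 1
  refine Finset.sum_congr rfl fun p _ => ?_
  rw [Finset.mul_sum]
  exact Finset.sum_congr rfl fun q _ => by ring

theorem covD_reindex {β γ : Type} [Fintype β] [DecidableEq β] [Fintype γ] [DecidableEq γ]
    (e : β ≃ γ) (τ : Coord n → (β → Fin n) → ℝ) (J : Option γ → Fin n) :
    covD G (fun z K => τ z (K ∘ e)) y J = covD G τ y (J ∘ Option.map e) := by
  unfold covD
  congr 1
  rw [← Equiv.sum_comp e]
  refine Finset.sum_congr rfl fun p _ => Finset.sum_congr rfl fun q _ => ?_
  have h : Function.update (J ∘ some) (e p) q ∘ e =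
      Function.update ((J ∘ Option.map e) ∘ some) p q := by
    funext x
    by_cases hx : x = p
    · subst hx; simp
    · simp [Function.update_of_ne hx, Function.update_of_ne (fun h => hx (e.injective h))]
  beta_reduce
  rw [h]; rfl

/-- The Leibniz rule: each Christoffel term acts on one slot of β ⊕ γ, hence on exactly one of the
factors. -/
theorem covD_prod {β γ : Type} [Fintype β] [DecidableEq β] [Fintype γ] [DecidableEq γ]
    {σ : Coord n → (β → Fin n) → ℝ} {τ : Coord n → (γ → Fin n) → ℝ}
    (hΩ : IsOpen Ω) (hy : y ∈ Ω) (hσ : SmoothTensor Ω σ) (hτ : SmoothTensor Ω τ)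
    (i : Fin n) (J : β → Fin n) (K : γ → Fin n) :
    covD G (fun z (L : β ⊕ γ → Fin n) => σ z (L ∘ Sum.inl) * τ z (L ∘ Sum.inr)) y
        (optCons i (Sum.elim J K)) =
      covD G σ y (optCons i J) * τ y K + σ y J * covD G τ y (optCons i K) := by
  simp only [covD_optCons, Fintype.sum_sum_type, Sum.elim_inl, Sum.elim_inr, Sum.elim_comp_inl,
    Sum.elim_comp_inr]
  rw [pd_mul _ (hσ.differentiableAt hΩ hy _) (hτ.differentiableAt hΩ hy _)]
  simp only [← Sum.elim_update_left, ← Sum.elim_update_right, Sum.elim_comp_inl,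
    Sum.elim_comp_inr]
  have e1 : ∀ p q, christoffel G q i (J p) y * (σ y (Function.update J p q) * τ y K) =
    (christoffel G q i (J p) y * σ y (Function.update J p q)) * τ y K := fun _ _ => by ring
  have e2 : ∀ p q, christoffel G q i (K p) y * (σ y J * τ y (Function.update K p q)) =
    σ y J * (christoffel G q i (K p) y * τ y (Function.update K p q)) := fun _ _ => by ring
  simp only [e1, e2, ← Finset.mul_sum, ← Finset.sum_mul]
  ring

theorem covD_metric (hG : IsLocalMetric Ω G) (hy : y ∈ Ω) (J : Option (Fin 2) → Fin n) :
    covD G (fun z (K : Fin 2 → Fin n) => G z (K 0) (K 1)) y J = 0 := by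
  unfold covD
  simp only [Function.comp_apply, Fin.sum_univ_two, Fin.isValue, Function.update_self]
  rw [hG.pd_metric hy]
  simp

/-- The contraction of two indices by the inverse metric. -/
def trace {β : Type} (G : Coord n → Matrix (Fin n) (Fin n) ℝ)
    (τ : Coord n → (β ⊕ Fin 2 → Fin n) → ℝ) (y : Coord n) (J : β → Fin n) : ℝ :=
  ∑ a, ∑ b, (G y)⁻¹ a b * τ y (Sum.elim J ![a, b])

theorem SmoothTensor.trace {β : Type} {τ : Coord n → (β ⊕ Fin 2 → Fin n) → ℝ}
    (h : SmoothTensor Ω τ) (hG : IsLocalMetric Ω G) : SmoothTensor Ω (trace G τ) := fun _ =>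
  ContDiffOn.sum fun _ _ => ContDiffOn.sum fun _ _ => (hG.inv_smooth _ _).mul (h _)

/-- Contraction commutes with ∇ because ∇g⁻¹ = 0. -/
theorem covD_trace {β : Type} [Fintype β] [DecidableEq β] (hG : IsLocalMetric Ω G) (hy : y ∈ Ω)
    {τ : Coord n → (β ⊕ Fin 2 → Fin n) → ℝ} (hτ : SmoothTensor Ω τ) (i : Fin n) (J : β → Fin n) :
    covD G (trace G τ) y (optCons i J) =
      ∑ a, ∑ b, (G y)⁻¹ a b * covD G τ y (optCons i (Sum.elim J ![a, b])) := by
  have hΩ := hG.isOpen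
  have dI : ∀ a b, DifferentiableAt ℝ (fun z => (G z)⁻¹ a b) y := fun a b =>
    differentiableAt_of_contDiffOn hΩ (hG.inv_smooth a b) hy
  simp only [covD_optCons, Fintype.sum_sum_type, Sum.elim_inl, Sum.elim_inr, Fin.sum_univ_two]
  simp only [← Sum.elim_update_left, ← Sum.elim_update_right]
  have u0 : ∀ a b q : Fin n, Function.update ![a, b] 0 q = ![q, b] := by
    intro a b q; funext x; fin_cases x <;> simp
  have u1 : ∀ a b q : Fin n, Function.update ![a, b] 1 q = ![a, q] := by
    intro a b q; funext x; fin_cases x <;> simp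
  simp only [u0, u1, Matrix.cons_val_zero, Matrix.cons_val_one]
  have hp : pd i (fun z => trace G τ z J) y = ∑ a, ∑ b,
      (pd i (fun z => (G z)⁻¹ a b) y * τ y (Sum.elim J ![a, b]) +
        (G y)⁻¹ a b * pd i (fun z => τ z (Sum.elim J ![a, b])) y) := by
    unfold trace
    rw [pd_sum (F := fun a z => ∑ b, (G z)⁻¹ a b * τ z (Sum.elim J ![a, b])) _ _ fun a _ =>
      DifferentiableAt.fun_sum fun b _ => (dI a b).mul (hτ.differentiableAt hΩ hy _)]
    refine Finset.sum_congr rfl fun a _ => ?_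
    rw [pd_sum (F := fun b z => (G z)⁻¹ a b * τ z (Sum.elim J ![a, b])) _ _ fun b _ =>
      (dI a b).mul (hτ.differentiableAt hΩ hy _)]
    exact Finset.sum_congr rfl fun b _ => pd_mul i (dI a b) (hτ.differentiableAt hΩ hy _)
  rw [hp]
  have hs : ∑ p, ∑ q, christoffel G q i (J p) y * trace G τ y (Function.update J p q) =
      ∑ a, ∑ b, (G y)⁻¹ a b * ∑ p, ∑ q, christoffel G q i (J p) y *
        τ y (Sum.elim (Function.update J p q) ![a, b]) := by
    simp only [trace, Finset.mul_sum]
    rw [Finset.sum_congr rfl fun p _ => Finset.sum_comm, Finset.sum_comm]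
    refine Finset.sum_congr rfl fun a _ => ?_
    rw [Finset.sum_congr rfl fun p _ => Finset.sum_comm, Finset.sum_comm]
    exact Finset.sum_congr rfl fun b _ => Finset.sum_congr rfl fun p _ =>
      Finset.sum_congr rfl fun q _ => by ring
  rw [hs]
  -- The derivative of g⁻¹ supplies exactly the Christoffel terms of the two contracted slots.
  have hc : ∑ a, ∑ b, pd i (fun z => (G z)⁻¹ a b) y * τ y (Sum.elim J ![a, b]) =
      -∑ a, ∑ b, (G y)⁻¹ a b * (∑ q, christoffel G q i a y * τ y (Sum.elim J ![q, b]) +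
        ∑ q, christoffel G q i b y * τ y (Sum.elim J ![a, q])) := by
    simp only [hG.pd_metric_inv hy, sub_mul, neg_mul, mul_add, Finset.sum_add_distrib,
      Finset.sum_sub_distrib, Finset.sum_neg_distrib, Finset.sum_mul, Finset.mul_sum]
    rw [sub_eq_add_neg, neg_add]
    congr 2
    · rw [Finset.sum_congr rfl fun p _ => Finset.sum_comm, Finset.sum_comm]
      exact Finset.sum_congr rfl fun a _ => by
        rw [Finset.sum_comm]
        exact Finset.sum_congr rfl fun b _ => Finset.sum_congr rfl fun q _ => by ring
    · refine Finset.sum_congr rfl fun a _ => ?_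
      rw [Finset.sum_comm]
      exact Finset.sum_congr rfl fun b _ => Finset.sum_congr rfl fun q _ => by ring
  simp only [Finset.sum_add_distrib]
  rw [hc]
  simp only [mul_add, mul_sub, Finset.sum_add_distrib, Finset.sum_sub_distrib]
  ring

/-! ### Curvature and the commutator of covariant derivatives -/

/-- The curvature tensor with the last index raised. -/
theorem raise_riemann (hG : IsLocalMetric Ω G) (hy : y ∈ Ω) (q i j k : Fin n) :
    ∑ l, (G y)⁻¹ q l * riemann G y ![i, j, k, l] =
      pd i (christoffel G q j k) y - pd j (christoffel G q i k) y +
      ∑ p, (christoffel G p j k y * christoffel G q i p y -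
        christoffel G p i k y * christoffel G q j p y) := by
  rw [← hG.raise_lower hy (fun q => pd i (christoffel G q j k) y - pd j (christoffel G q i k) y +
      ∑ p, (christoffel G p j k y * christoffel G q i p y -
        christoffel G p i k y * christoffel G q j p y)) q]
  refine Finset.sum_congr rfl fun l _ => ?_
  congr 1
  refine Finset.sum_congr rfl fun m _ => ?_
  rw [hG.symm y hy l m]
  rfl

/-- The Ricci identity. -/
theorem covD_covD_sub {β : Type} [Fintype β] [DecidableEq β] (hG : IsLocalMetric Ω G) (hy : y ∈ Ω)
    {τ : Coord n → (β → Fin n) → ℝ} (hτ : SmoothTensor Ω τ) (i j : Fin n) (J : β → Fin n) :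
    covD G (covD G τ) y (optCons i (optCons j J)) - covD G (covD G τ) y (optCons j (optCons i J)) =
      -∑ p, ∑ q, ∑ l, (G y)⁻¹ q l *
        (riemann G y ![i, j, J p, l] * τ y (Function.update J p q)) := by
  have hΩ := hG.isOpen
  have dΓ : ∀ q a b, DifferentiableAt ℝ (christoffel G q a b) y := fun q a b =>
    differentiableAt_of_contDiffOn hΩ (hG.christoffel_smooth q a b) hy
  have dτ := hτ.differentiableAt hΩ hy
  -- The terms in which the two Christoffel symbols act on different slots of τ; since such
  -- substitutions commute, they are symmetric in i and j.
  set X : Fin n → Fin n → ℝ := fun i j => ∑ p, ∑ q, ∑ p', ∑ q', if p' = p then 0 else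
    christoffel G q i (J p) y * (christoffel G q' j (J p') y *
      τ y (Function.update (Function.update J p q) p' q')) with hX
  have X_symm : X i j = X j i := by
    simp only [hX]
    rw [Finset.sum_congr rfl fun p _ => Finset.sum_comm, Finset.sum_comm]
    refine Finset.sum_congr rfl fun p _ => ?_
    have : ∀ p', ∑ q, ∑ q', (if p = p' then 0 else christoffel G q i (J p') y *
        (christoffel G q' j (J p) y * τ y (Function.update (Function.update J p' q) p q'))) =
        ∑ q', ∑ q, (if p' = p then 0 else christoffel G q' j (J p) y *
        (christoffel G q i (J p') y * τ y (Function.update (Function.update J p q') p' q))) := by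
      intro p'
      rw [Finset.sum_comm]
      refine Finset.sum_congr rfl fun q' _ => Finset.sum_congr rfl fun q _ => ?_
      by_cases h : p = p'
      · simp [h]
      · rw [if_neg h, if_neg (Ne.symm h), Function.update_comm h]; ring
    rw [Finset.sum_congr rfl fun p' _ => this p', Finset.sum_comm]
  -- Under antisymmetrization in i and j, the second derivatives and X drop out, the two sums of
  -- type Γ∂τ exchange roles, and the Γ^q_{ij} term drops out because the connection is torsion
  -- free. What survives is ∂Γ and ΓΓ on a single slot, which is the curvature.
  have expand : ∀ i j : Fin n, covD G (covD G τ) y (optCons i (optCons j J)) =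
      pd i (pd j (fun z => τ z J)) y -
      (∑ p, ∑ q, pd i (christoffel G q j (J p)) y * τ y (Function.update J p q)) -
      (∑ p, ∑ q, christoffel G q j (J p) y * pd i (fun z => τ z (Function.update J p q)) y) -
      (∑ q, christoffel G q i j y * covD G τ y (optCons q J)) -
      (∑ p, ∑ q, christoffel G q i (J p) y * pd j (fun z => τ z (Function.update J p q)) y) +
      (∑ p, ∑ q, (∑ r, christoffel G r i (J p) y * christoffel G q j r y) *
        τ y (Function.update J p q)) + X i j := by
    intro i j
    rw [covD_optCons]
    simp only [Fintype.sum_option, optCons_none, optCons_some, update_optCons_none,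
      update_optCons_some]
    have h1 : pd i (fun z => covD G τ z (optCons j J)) y = pd i (pd j (fun z => τ z J)) y -
        (∑ p, ∑ q, pd i (christoffel G q j (J p)) y * τ y (Function.update J p q)) -
        (∑ p, ∑ q, christoffel G q j (J p) y * pd i (fun z => τ z (Function.update J p q)) y) := by
      simp only [covD_optCons]
      have dd : ∀ p q, DifferentiableAt ℝ (fun z => christoffel G q j (J p) z *
        τ z (Function.update J p q)) y := fun p q => (dΓ _ _ _).mul (dτ _)
      rw [pd_sub i (differentiableAt_of_contDiffOn hΩ (contDiffOn_pd hΩ (hτ J) j) hy)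
        (DifferentiableAt.fun_sum fun p _ => DifferentiableAt.fun_sum fun q _ => dd p q)]
      rw [pd_sum (F := fun p z => ∑ q, christoffel G q j (J p) z *
        τ z (Function.update J p q)) i _ fun p _ => DifferentiableAt.fun_sum fun q _ => dd p q]
      have : ∀ p, pd i (fun z => ∑ q, christoffel G q j (J p) z *
          τ z (Function.update J p q)) y = ∑ q, (pd i (christoffel G q j (J p)) y *
          τ y (Function.update J p q) +
          christoffel G q j (J p) y * pd i (fun z => τ z (Function.update J p q)) y) := by
        intro p
        rw [pd_sum (F := fun q z => christoffel G q j (J p) z *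
          τ z (Function.update J p q)) i _ fun q _ => dd p q]
        exact Finset.sum_congr rfl fun q _ => pd_mul i (dΓ _ _ _) (dτ _)
      simp only [this, Finset.sum_add_distrib]
      ring
    have h2 : ∑ p, ∑ q, christoffel G q i (J p) y *
          covD G τ y (optCons j (Function.update J p q)) =
        (∑ p, ∑ q, christoffel G q i (J p) y * pd j (fun z => τ z (Function.update J p q)) y) -
        (∑ p, ∑ q, (∑ r, christoffel G r i (J p) y * christoffel G q j r y) *
          τ y (Function.update J p q)) - X i j := by
      simp only [covD_optCons, mul_sub, Finset.sum_sub_distrib]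
      rw [sub_sub]
      congr 1
      simp only [hX, ← Finset.sum_add_distrib]
      refine Finset.sum_congr rfl fun p _ => ?_
      have e1 : ∑ q, (∑ r, christoffel G r i (J p) y * christoffel G q j r y) *
          τ y (Function.update J p q) = ∑ q, christoffel G q i (J p) y *
            ∑ q', christoffel G q' j q y * τ y (Function.update J p q') := by
        simp only [Finset.sum_mul, Finset.mul_sum]
        rw [Finset.sum_comm]
        exact Finset.sum_congr rfl fun q _ => Finset.sum_congr rfl fun q' _ => by ring
      rw [Finset.sum_add_distrib, e1, ← Finset.sum_add_distrib]
      refine Finset.sum_congr rfl fun q _ => ?_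
      rw [Finset.mul_sum]
      -- For p' = p the second symbol acts on the index q just inserted; this is the ΓΓ term on a
      -- single slot. The other p' make up X.
      rw [← Finset.add_sum_erase _ _ (Finset.mem_univ p)]
      congr 1
      · simp
      · rw [← Finset.add_sum_erase _ _ (Finset.mem_univ p)]
        simp only [if_true, Finset.sum_const_zero, zero_add]
        refine Finset.sum_congr rfl fun p' hp' => ?_
        have hne : p' ≠ p := (Finset.mem_erase.1 hp').1
        rw [Finset.mul_sum]
        exact Finset.sum_congr rfl fun q' _ => by
          rw [if_neg hne, Function.update_of_ne hne]
    rw [h1, h2]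
    ring
  rw [expand i j, expand j i, X_symm, pd_comm hΩ (hτ J) hy i j]
  have hr : ∀ p q, ∑ l, (G y)⁻¹ q l * (riemann G y ![i, j, J p, l] * τ y (Function.update J p q)) =
      (pd i (christoffel G q j (J p)) y - pd j (christoffel G q i (J p)) y +
      ((∑ r, christoffel G r j (J p) y * christoffel G q i r y) -
        ∑ r, christoffel G r i (J p) y * christoffel G q j r y)) *
        τ y (Function.update J p q) := by
    intro p q
    rw [← Finset.sum_sub_distrib, ← raise_riemann hG hy, Finset.sum_mul]
    exact Finset.sum_congr rfl fun l _ => by ring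
  simp only [hr, add_mul, sub_mul, Finset.sum_add_distrib, Finset.sum_sub_distrib,
    hG.christoffel_symm hy _ i j]
  ring

end CovariantDerivative

/-! ### Conformal change of the metric -/

section Conformal

variable {n : ℕ} {Ω : Set (Coord n)} {G : Coord n → Matrix (Fin n) (Fin n) ℝ}
  {w : Coord n → ℝ} {y : Coord n}

theorem smoothTensor_covDeriv {s : ℕ} (hG : IsLocalMetric Ω G) {τ : CovField n s}
    (h : SmoothTensor Ω τ) : SmoothTensor Ω (covDeriv G τ) :=
  fun J => (h.covD hG) (optCons (J 0) (Fin.tail J))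

theorem smoothTensor_riemann (hG : IsLocalMetric Ω G) : SmoothTensor Ω (riemann G) := fun _ =>
  ContDiffOn.sum fun _ _ => (hG.smooth _ _).mul
    (((contDiffOn_pd hG.isOpen (hG.christoffel_smooth _ _ _) _).sub
      (contDiffOn_pd hG.isOpen (hG.christoffel_smooth _ _ _) _)).add
      (ContDiffOn.sum fun _ _ =>
        ((hG.christoffel_smooth _ _ _).mul (hG.christoffel_smooth _ _ _)).sub
        ((hG.christoffel_smooth _ _ _).mul (hG.christoffel_smooth _ _ _))))

theorem smoothTensor_nablaRiemann (hG : IsLocalMetric Ω G) (r : ℕ) :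
    SmoothTensor Ω (nablaRiemann G r) := by
  induction r with
  | zero => exact smoothTensor_riemann hG
  | succ r ih => exact smoothTensor_covDeriv hG ih

theorem smoothTensor_nablaFun (hG : IsLocalMetric Ω G) (hw : ContDiffOn ℝ ∞ w Ω) (l : ℕ) :
    SmoothTensor Ω (nablaFun G w l) := by
  induction l with
  | zero => exact fun _ => hw
  | succ l ih => exact smoothTensor_covDeriv hG ih

/-- The matrix function `e^{2w} G`. -/
def confMatrix (w : Coord n → ℝ) (G : Coord n → Matrix (Fin n) (Fin n) ℝ) :
    Coord n → Matrix (Fin n) (Fin n) ℝ := fun z => Real.exp (2 * w z) • G z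

theorem confMatrix_apply (z : Coord n) (i j : Fin n) :
    confMatrix w G z i j = Real.exp (2 * w z) * G z i j := rfl

theorem contDiffOn_exp_two (hw : ContDiffOn ℝ ∞ w Ω) :
    ContDiffOn ℝ ∞ (fun z => Real.exp (2 * w z)) Ω :=
  (contDiffOn_const.mul hw).exp

theorem IsLocalMetric.confMatrix (hG : IsLocalMetric Ω G) (hw : ContDiffOn ℝ ∞ w Ω) :
    IsLocalMetric Ω (confMatrix w G) where
  isOpen := hG.isOpen
  smooth i j := (contDiffOn_exp_two hw).mul (hG.smooth i j)
  symm z hz i j := by rw [confMatrix_apply, confMatrix_apply, hG.symm z hz]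
  det_ne z hz := by
    unfold NatTensor.confMatrix
    rw [Matrix.det_smul]
    exact mul_ne_zero (pow_ne_zero _ (Real.exp_ne_zero _)) (hG.det_ne z hz)

theorem confMatrix_inv (hG : IsLocalMetric Ω G) (hy : y ∈ Ω) :
    (confMatrix w G y)⁻¹ = Real.exp (-2 * w y) • (G y)⁻¹ := by
  refine Matrix.inv_eq_left_inv ?_
  unfold confMatrix
  rw [Matrix.smul_mul, Matrix.mul_smul, Matrix.nonsing_inv_mul _ (hG.det_ne y hy).isUnit, smul_smul,
    ← Real.exp_add]
  simp

/-- The difference of the Levi-Civita connections of `e^{2w} G` and `G`, with all indices down. -/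
def connDiff (G : Coord n → Matrix (Fin n) (Fin n) ℝ) (w : Coord n → ℝ) : CovField n 3 :=
  fun y J => G y (J 2) (J 0) * pd (J 1) w y + G y (J 2) (J 1) * pd (J 0) w y -
    G y (J 0) (J 1) * pd (J 2) w y

theorem smoothTensor_connDiff (hG : IsLocalMetric Ω G) (hw : ContDiffOn ℝ ∞ w Ω) :
    SmoothTensor Ω (connDiff G w) := fun _ =>
  (((hG.smooth _ _).mul (contDiffOn_pd hG.isOpen hw _)).add
    ((hG.smooth _ _).mul (contDiffOn_pd hG.isOpen hw _))).sub
    ((hG.smooth _ _).mul (contDiffOn_pd hG.isOpen hw _))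

/-- The derivative of e^{2w}G carries a factor e^{2w} that cancels against the inverse metric, so
only first derivatives of w remain. The difference is kept as a raised covariant tensor because
`IsNatural` admits lower indices only. -/
theorem christoffel_confMatrix (hG : IsLocalMetric Ω G) (hw : ContDiffOn ℝ ∞ w Ω) (hy : y ∈ Ω)
    (q i j : Fin n) : christoffel (confMatrix w G) q i j y =
      christoffel G q i j y + ∑ l, (G y)⁻¹ q l * connDiff G w y ![i, j, l] := by
  have dG : ∀ a b, DifferentiableAt ℝ (fun z => G z a b) y := fun a b =>
    differentiableAt_of_contDiffOn hG.isOpen (hG.smooth a b) hy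
  have dE : DifferentiableAt ℝ (fun z => Real.exp (2 * w z)) y :=
    differentiableAt_of_contDiffOn hG.isOpen (contDiffOn_exp_two hw) hy
  have dw := differentiableAt_of_contDiffOn hG.isOpen hw hy
  have hp : ∀ k a b, pd k (fun z => confMatrix w G z a b) y =
      Real.exp (2 * w y) * (2 * pd k w y * G y a b + pd k (fun z => G z a b) y) := by
    intro k a b
    simp only [confMatrix_apply]
    rw [pd_mul k dE (dG a b), pd_exp k 2 dw]; ring
  unfold christoffel
  rw [Finset.mul_sum, Finset.mul_sum, ← Finset.sum_add_distrib]
  refine Finset.sum_congr rfl fun l _ => ?_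
  rw [confMatrix_inv hG hy]
  simp only [hp, Matrix.smul_apply, smul_eq_mul, connDiff, Matrix.cons_val_zero,
    Matrix.cons_val_one, Matrix.cons_val]
  have he : Real.exp (-2 * w y) = (Real.exp (2 * w y))⁻¹ := by rw [← Real.exp_neg]; ring_nf
  rw [he, hG.symm y hy l i, hG.symm y hy l j]
  field_simp
  ring

/-- The partial derivatives agree for the two metrics, so only the difference of the connections,
inserted in each slot of τ, appears. -/
theorem covD_confMatrix {β : Type} [Fintype β] [DecidableEq β] (hG : IsLocalMetric Ω G)
    (hw : ContDiffOn ℝ ∞ w Ω) (hy : y ∈ Ω) (τ : Coord n → (β → Fin n) → ℝ) (i : Fin n)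
    (J : β → Fin n) : covD (confMatrix w G) τ y (optCons i J) = covD G τ y (optCons i J) -
      ∑ p, ∑ q, ∑ l, (G y)⁻¹ q l *
        (connDiff G w y ![i, J p, l] * τ y (Function.update J p q)) := by
  simp only [covD_optCons, christoffel_confMatrix hG hw hy, add_mul, Finset.sum_add_distrib]
  rw [sub_sub]
  simp only [Finset.sum_mul, mul_assoc]

theorem covD_exp_mul {β : Type} [Fintype β] [DecidableEq β] (hG : IsLocalMetric Ω G)
    (hw : ContDiffOn ℝ ∞ w Ω) (hy : y ∈ Ω) {τ : Coord n → (β → Fin n) → ℝ}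
    (hτ : SmoothTensor Ω τ) (i : Fin n) (J : β → Fin n) :
    covD G (fun z K => Real.exp (2 * w z) * τ z K) y (optCons i J) =
      Real.exp (2 * w y) * (covD G τ y (optCons i J) + 2 * (pd i w y * τ y J)) := by
  have dE : DifferentiableAt ℝ (fun z => Real.exp (2 * w z)) y :=
    differentiableAt_of_contDiffOn hG.isOpen (contDiffOn_exp_two hw) hy
  have dw := differentiableAt_of_contDiffOn hG.isOpen hw hy
  simp only [covD_optCons]
  rw [pd_mul i dE (hτ.differentiableAt hG.isOpen hy J), pd_exp i 2 dw]
  have : ∀ p q, christoffel G q i (J p) y * (Real.exp (2 * w y) * τ y (Function.update J p q)) =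
      Real.exp (2 * w y) * (christoffel G q i (J p) y * τ y (Function.update J p q)) :=
    fun _ _ => by ring
  simp only [this, ← Finset.mul_sum]
  ring

/-! ### Conformal change of the curvature and its derivatives -/

/-- The curvature of `e^{2w} G`, divided by `e^{2w}`. -/
def confRiemann (G : Coord n → Matrix (Fin n) (Fin n) ℝ) (w : Coord n → ℝ) : CovField n 4 :=
  fun y J => riemann G y J + covD G (connDiff G w) y (optCons (J 0) ![J 1, J 2, J 3]) -
    covD G (connDiff G w) y (optCons (J 1) ![J 0, J 2, J 3]) +
    ∑ q, ∑ l, (G y)⁻¹ q l *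
      (connDiff G w y ![J 1, J 2, l] * connDiff G w y ![J 0, q, J 3]) -
    ∑ q, ∑ l, (G y)⁻¹ q l *
      (connDiff G w y ![J 0, J 2, l] * connDiff G w y ![J 1, q, J 3])

/-- Replacing a connection Γ by Γ + U changes its curvature by the antisymmetrized covariant
derivative of U and a quadratic term in U. The prefactor e^{2w} comes from lowering the last index
with e^{2w}G. -/
theorem riemann_confMatrix (hG : IsLocalMetric Ω G) (hw : ContDiffOn ℝ ∞ w Ω) (hy : y ∈ Ω)
    (J : Fin 4 → Fin n) : riemann (confMatrix w G) y J =
      Real.exp (2 * w y) * confRiemann G w y J := by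
  obtain ⟨i, j, k, l, rfl⟩ : ∃ i j k l, J = ![i, j, k, l] :=
    ⟨J 0, J 1, J 2, J 3, by funext x; fin_cases x <;> rfl⟩
  have hS := smoothTensor_connDiff hG hw
  have hΩ := hG.isOpen
  set S : Fin n → Fin n → Fin n → Coord n → ℝ := fun i j l z => connDiff G w z ![i, j, l] with hSdef
  set U : Fin n → Fin n → Fin n → Coord n → ℝ := fun q i j z => ∑ l, (G z)⁻¹ q l * S i j l z
    with hU
  have sU : ∀ q i j, ContDiffOn ℝ ∞ (U q i j) Ω := fun q i j =>
    ContDiffOn.sum fun l _ => (hG.inv_smooth q l).mul (hS _)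
  have dU : ∀ q i j, DifferentiableAt ℝ (U q i j) y := fun q i j =>
    differentiableAt_of_contDiffOn hΩ (sU q i j) hy
  have dΓ : ∀ q a b, DifferentiableAt ℝ (christoffel G q a b) y := fun q a b =>
    differentiableAt_of_contDiffOn hΩ (hG.christoffel_smooth q a b) hy
  have dG : ∀ a b, DifferentiableAt ℝ (fun z => G z a b) y := fun a b =>
    differentiableAt_of_contDiffOn hG.isOpen (hG.smooth a b) hy
  have lowU : ∀ z ∈ Ω, ∀ i j l, ∑ m, G z m l * U m i j z = S i j l z := by
    intro z hz i j l
    rw [← hG.lower_raise hz (fun l => S i j l z) l]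
    exact Finset.sum_congr rfl fun m _ => by rw [hG.symm z hz m l]
  have hΓ : ∀ z ∈ Ω, ∀ q i j, christoffel (confMatrix w G) q i j z =
      christoffel G q i j z + U q i j z := fun z hz q i j => christoffel_confMatrix hG hw hz q i j
  have pdΓ : ∀ a q i j, pd a (christoffel (confMatrix w G) q i j) y =
      pd a (christoffel G q i j) y + pd a (U q i j) y := by
    intro a q i j
    rw [pd_congr_of_eqOn hΩ a (fun z hz => hΓ z hz q i j) hy, pd_add a (dΓ _ _ _) (dU _ _ _)]
  -- Lowering commutes with ∇: by metric compatibility, the Christoffel term on the upper index of U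
  -- becomes the one on the last slot of S.
  have key : ∀ i j, ∑ m, G y m l * (pd i (U m j k) y + ∑ p, U p j k y * christoffel G m i p y) =
      pd i (S j k l) y - ∑ q, christoffel G q i l y * S j k q y := by
    intro i j
    have h1 : pd i (S j k l) y = ∑ m, (pd i (fun z => G z m l) y * U m j k y +
        G y m l * pd i (U m j k) y) := by
      rw [← pd_congr_of_eqOn hΩ i (fun z hz => lowU z hz j k l) hy,
        pd_sum (F := fun m z => G z m l * U m j k z) i _ fun m _ => (dG m l).mul (dU m j k)]
      exact Finset.sum_congr rfl fun m _ => pd_mul i (dG m l) (dU m j k)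
    have h2 : ∑ q, christoffel G q i l y * S j k q y =
        ∑ m, (∑ q, christoffel G q i l y * G y m q) * U m j k y := by
      simp only [← lowU y hy j k, Finset.mul_sum, Finset.sum_mul]
      rw [Finset.sum_comm]
      exact Finset.sum_congr rfl fun m _ => Finset.sum_congr rfl fun q _ => by ring
    have h3 : ∑ m, G y m l * ∑ p, U p j k y * christoffel G m i p y =
        ∑ m, (∑ q, christoffel G q i m y * G y q l) * U m j k y := by
      simp only [Finset.mul_sum, Finset.sum_mul]
      rw [Finset.sum_comm]
      exact Finset.sum_congr rfl fun m _ => Finset.sum_congr rfl fun q _ => by ring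
    simp only [mul_add, Finset.sum_add_distrib]
    rw [h1, h2, h3]
    simp only [hG.pd_metric hy, add_mul, Finset.sum_add_distrib]
    ring
  have quad : ∀ i j, ∑ m, G y m l * ∑ p, U p j k y * U m i p y =
      ∑ q, ∑ l', (G y)⁻¹ q l' * (S j k l' y * S i q l y) := by
    intro i j
    have h1 : ∑ m, G y m l * ∑ p, U p j k y * U m i p y =
        ∑ p, U p j k y * ∑ m, G y m l * U m i p y := by
      simp only [Finset.mul_sum]
      rw [Finset.sum_comm]
      exact Finset.sum_congr rfl fun m _ => Finset.sum_congr rfl fun q _ => by ring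
    rw [h1]
    simp only [lowU y hy]
    simp only [hU, Finset.sum_mul, mul_assoc]
  have cross : ∀ i j, ∑ m, G y m l * ∑ p, christoffel G p j k y * U m i p y =
      ∑ p, christoffel G p j k y * S i p l y := by
    intro i j
    simp only [← lowU y hy i, Finset.mul_sum]
    rw [Finset.sum_comm]
    exact Finset.sum_congr rfl fun m _ => Finset.sum_congr rfl fun q _ => by ring
  have u0 : ∀ a b c q : Fin n, Function.update ![a, b, c] 0 q = ![q, b, c] := by
    intro a b c q; funext x; fin_cases x <;> simp
  have u1 : ∀ a b c q : Fin n, Function.update ![a, b, c] 1 q = ![a, q, c] := by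
    intro a b c q; funext x; fin_cases x <;> simp
  have u2 : ∀ a b c q : Fin n, Function.update ![a, b, c] 2 q = ![a, b, q] := by
    intro a b c q; funext x; fin_cases x <;> simp
  have hcov : ∀ i j, covD G (connDiff G w) y (optCons i ![j, k, l]) =
      pd i (S j k l) y - ∑ q, christoffel G q i j y * S q k l y -
      ∑ q, christoffel G q i k y * S j q l y - ∑ q, christoffel G q i l y * S j k q y := by
    intro i j
    simp only [covD_optCons, Fin.sum_univ_three, u0, u1, u2, Matrix.cons_val_zero,
      Matrix.cons_val_one, Matrix.cons_val]
    ring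
  have e0 : riemann (confMatrix w G) y ![i, j, k, l] = Real.exp (2 * w y) *
      ∑ m, G y m l * ((pd i (christoffel G m j k) y - pd j (christoffel G m i k) y +
        ∑ p, (christoffel G p j k y * christoffel G m i p y -
        christoffel G p i k y * christoffel G m j p y)) +
      (pd i (U m j k) y + ∑ p, U p j k y * christoffel G m i p y) -
      (pd j (U m i k) y + ∑ p, U p i k y * christoffel G m j p y) +
      (∑ p, christoffel G p j k y * U m i p y) - (∑ p, christoffel G p i k y * U m j p y) +
      (∑ p, U p j k y * U m i p y) - (∑ p, U p i k y * U m j p y)) := by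
    unfold riemann
    simp only [Matrix.cons_val_zero, Matrix.cons_val_one, Matrix.cons_val, confMatrix_apply, pdΓ,
      hΓ y hy, mul_assoc]
    rw [Finset.mul_sum]
    refine Finset.sum_congr rfl fun m _ => ?_
    congr 2
    simp only [add_mul, mul_add, Finset.sum_add_distrib, Finset.sum_sub_distrib]
    ring
  rw [e0]
  congr 1
  have e1 : ∑ m, G y m l * (pd i (christoffel G m j k) y - pd j (christoffel G m i k) y +
        ∑ p, (christoffel G p j k y * christoffel G m i p y -
        christoffel G p i k y * christoffel G m j p y)) = riemann G y ![i, j, k, l] := rfl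
  have split : ∀ a b c d e f g : Fin n → ℝ,
      ∑ m, G y m l * (a m + b m - c m + d m - e m + f m - g m) =
      ∑ m, G y m l * a m + ∑ m, G y m l * b m - ∑ m, G y m l * c m + ∑ m, G y m l * d m -
      ∑ m, G y m l * e m + ∑ m, G y m l * f m - ∑ m, G y m l * g m := by
    intro a b c d e f g
    simp only [mul_add, mul_sub, Finset.sum_add_distrib, Finset.sum_sub_distrib]
  rw [split, e1, key, key, cross, cross, quad, quad]
  unfold confRiemann
  simp only [Matrix.cons_val_zero, Matrix.cons_val_one, Matrix.cons_val]
  rw [hcov, hcov]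
  -- The Christoffel term of ∇S on the slot antisymmetrized with the derivative has no counterpart
  -- in the curvature; it cancels by symmetry of Γ.
  have e2 : ∑ q, christoffel G q i j y * S q k l y = ∑ q, christoffel G q j i y * S q k l y :=
    Finset.sum_congr rfl fun q _ => by rw [hG.christoffel_symm hy]
  rw [e2]
  ring

/-- The derivatives of the curvature of `e^{2w} G`, divided by `e^{2w}`. -/
def confNablaRiemann (G : Coord n → Matrix (Fin n) (Fin n) ℝ) (w : Coord n → ℝ) :
    (r : ℕ) → CovField n (4 + r)
  | 0 => confRiemann G w
  | r + 1 => fun y J => covDeriv (confMatrix w G) (confNablaRiemann G w r) y J +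
      2 * (pd (J 0) w y * confNablaRiemann G w r y (Fin.tail J))

theorem smoothTensor_confRiemann (hG : IsLocalMetric Ω G) (hw : ContDiffOn ℝ ∞ w Ω) :
    SmoothTensor Ω (confRiemann G w) := by
  have hS := smoothTensor_connDiff hG hw
  intro J
  exact ((((smoothTensor_riemann hG _).add (hS.covD hG _)).sub (hS.covD hG _)).add
    (ContDiffOn.sum fun _ _ => ContDiffOn.sum fun _ _ =>
      (hG.inv_smooth _ _).mul ((hS _).mul (hS _)))).sub
    (ContDiffOn.sum fun _ _ => ContDiffOn.sum fun _ _ =>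
      (hG.inv_smooth _ _).mul ((hS _).mul (hS _)))

theorem smoothTensor_confNablaRiemann (hG : IsLocalMetric Ω G) (hw : ContDiffOn ℝ ∞ w Ω) (r : ℕ) :
    SmoothTensor Ω (confNablaRiemann G w r) := by
  induction r with
  | zero => exact smoothTensor_confRiemann hG hw
  | succ r ih =>
    exact fun J => (smoothTensor_covDeriv (hG.confMatrix hw) ih J).add
      (contDiffOn_const.mul ((contDiffOn_pd hG.isOpen hw _).mul (ih _)))

/-- Differentiating e^{2w} reproduces it with a factor 2dw, which the recursion for
`confNablaRiemann` absorbs. Undifferentiated w thus enters only through one exponential, with the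
same exponent for all r. -/
theorem nablaRiemann_confMatrix (hG : IsLocalMetric Ω G) (hw : ContDiffOn ℝ ∞ w Ω) (r : ℕ) :
    ∀ y ∈ Ω, ∀ J, nablaRiemann (confMatrix w G) r y J =
      Real.exp (2 * w y) * confNablaRiemann G w r y J := by
  induction r with
  | zero => exact fun y hy J => riemann_confMatrix hG hw hy J
  | succ r ih =>
    intro y hy J
    change covD (confMatrix w G) (nablaRiemann (confMatrix w G) r) y
      (optCons (J 0) (Fin.tail J)) = _
    rw [covD_congr hG.isOpen hy ih, covD_exp_mul (hG.confMatrix hw) hw hy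
      (smoothTensor_confNablaRiemann hG hw r)]
    rfl

/-- A constant factor leaves the connection unchanged, so only the lowered index of the curvature
scales. -/
theorem nablaRiemann_confMatrix_const (hG : IsLocalMetric Ω G) (s : ℝ) (r : ℕ) :
    ∀ y ∈ Ω, ∀ J, nablaRiemann (confMatrix (fun _ => s) G) r y J =
      Real.exp (2 * s) * nablaRiemann G r y J := by
  have hw : ContDiffOn ℝ ∞ (fun _ : Coord n => s) Ω := contDiffOn_const
  have hS : ∀ z ∈ Ω, ∀ J, connDiff G (fun _ => s) z J = 0 := by
    intro z _ J; simp [connDiff, pd_const]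
  have h0 : ∀ z ∈ Ω, ∀ J, covD G (connDiff G (fun _ => s)) z J = 0 := by
    intro z hz J
    rw [covD_congr hG.isOpen hz (τ := fun _ _ => 0) hS]
    simp [covD, pd_const]
  induction r with
  | zero =>
    intro y hy J
    refine (riemann_confMatrix hG hw hy J).trans ?_
    simp only [confRiemann, hS y hy, h0 y hy]
    simp [nablaRiemann]
  | succ r ih =>
    intro y hy J
    change covD _ (nablaRiemann _ r) y (optCons (J 0) (Fin.tail J)) = _
    rw [covD_congr hG.isOpen hy ih, covD_const_mul hG.isOpen hy _ (smoothTensor_nablaRiemann hG r),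
      covD_confMatrix hG hw hy]
    simp only [hS y hy]
    simp [nablaRiemann, covDeriv_eq_covD]

end Conformal

/-! ### Bijections between index types -/

/-- The place `none` moves out of the left summand. -/
def optionSumLeft (β γ : Type) : Option β ⊕ γ ≃ Option (β ⊕ γ) where
  toFun := Sum.elim (fun o => o.elim none fun b => some (Sum.inl b)) fun c => some (Sum.inr c)
  invFun o := o.elim (Sum.inl none) (Sum.elim (fun b => Sum.inl (some b)) Sum.inr)
  left_inv := by rintro ((_ | _) | _) <;> rfl
  right_inv := by rintro (_ | (_ | _)) <;> rfl

/-- The place `none` moves out of the right summand. -/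
def optionSumRight (β γ : Type) : β ⊕ Option γ ≃ Option (β ⊕ γ) where
  toFun := Sum.elim (fun b => some (Sum.inl b)) fun o => o.elim none fun c => some (Sum.inr c)
  invFun o := o.elim (Sum.inr none) (Sum.elim Sum.inl fun c => Sum.inr (some c))
  left_inv := by rintro (_ | (_ | _)) <;> rfl
  right_inv := by rintro (_ | (_ | _)) <;> rfl

theorem optCons_comp_optionSumLeft {n : ℕ} {β γ : Type} (i : Fin n) (J : β → Fin n) (K : γ → Fin n) :
    optCons i (Sum.elim J K) ∘ optionSumLeft β γ = Sum.elim (optCons i J) K := by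
  funext x; rcases x with (_ | _) | _ <;> rfl

theorem optCons_comp_optionSumRight {n : ℕ} {β γ : Type} (i : Fin n) (J : β → Fin n) (K : γ → Fin n) :
    optCons i (Sum.elim J K) ∘ optionSumRight β γ = Sum.elim J (optCons i K) := by
  funext x; rcases x with _ | (_ | _) <;> rfl

theorem exists_optCons {α β : Type*} (K : Option β → α) : ∃ i J, K = optCons i J :=
  ⟨_, _, (optCons_eta K).symm⟩

theorem finSuccEquiv_symm_comp {n s : ℕ} (J : Fin (s + 1) → Fin n) :
    J ∘ (finSuccEquiv s).symm = optCons (J 0) (Fin.tail J) := by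
  funext o; cases o <;> rfl

theorem optCons_comp_finSuccEquiv {n s : ℕ} (i : Fin n) (J : Fin s → Fin n) :
    optCons i J ∘ finSuccEquiv s = Fin.cons i J := by
  funext x; refine Fin.cases ?_ (fun x => ?_) x <;> simp

theorem covD_covDeriv {n s : ℕ} {G : Coord n → Matrix (Fin n) (Fin n) ℝ} (τ : CovField n s)
    (y : Coord n) (i : Fin n) (K : Fin (s + 1) → Fin n) :
    covD G (covDeriv G τ) y (optCons i K) =
      covD G (covD G τ) y (optCons i (optCons (K 0) (Fin.tail K))) := by
  have h : covDeriv G τ = fun y J => covD G τ y (J ∘ (finSuccEquiv s).symm) := by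
    funext y J; rw [finSuccEquiv_symm_comp, covDeriv_eq_covD]
  rw [h, covD_reindex]
  congr 1
  rw [← finSuccEquiv_symm_comp K]
  funext o; cases o <;> rfl

/-- Moving the last two indices of the first factor of a product to the end, and interchanging the
first of them with the index `p` of the second factor. -/
def insertEquiv {β : Type} [DecidableEq β] (γ : Type) [DecidableEq γ] (p : β) : (γ ⊕ Fin 2) ⊕ β ≃ (γ ⊕ β) ⊕ Fin 2 :=
  Equiv.trans
    { toFun := Sum.elim (Sum.elim (fun c => Sum.inl (Sum.inl c)) Sum.inr) fun b =>
        Sum.inl (Sum.inr b)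
      invFun := Sum.elim (Sum.elim (fun c => Sum.inl (Sum.inl c)) Sum.inr) fun x =>
        Sum.inl (Sum.inr x)
      left_inv := by rintro ((_ | _) | _) <;> rfl
      right_inv := by rintro ((_ | _) | _) <;> rfl }
    (Equiv.swap (Sum.inl (Sum.inr p)) (Sum.inr 0))

/-! ### Covariant tensor fields which are natural in a metric and a function -/

/-- A nondegenerate symmetric matrix function and a function, both smooth on an open set. -/
structure LocalData (n : ℕ) where
  /-- the open set -/
  Ω : Set (Coord n)
  /-- the matrix function -/
  G : Coord n → Matrix (Fin n) (Fin n) ℝ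
  /-- the function -/
  w : Coord n → ℝ
  metric : IsLocalMetric Ω G
  smooth : ContDiffOn ℝ ∞ w Ω

/-- A covariant tensor field depending on local data. -/
abbrev Field (n : ℕ) (β : Type) : Type := LocalData n → Coord n → (β → Fin n) → ℝ

/-- The covariant tensor fields generated by `g`, `∇ʳR` and `∇ˡω` with `1 ≤ l ≤ L`. -/
inductive IsNatural (n L : ℕ) :
    ∀ {β : Type} [Fintype β] [DecidableEq β], Field n β → Prop
  | congr {β : Type} [Fintype β] [DecidableEq β] {σ τ : Field n β} :
      IsNatural n L σ → (∀ D, ∀ y ∈ D.Ω, ∀ J, τ D y J = σ D y J) → IsNatural n L τ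
  | reindex {β γ : Type} [Fintype β] [DecidableEq β] [Fintype γ] [DecidableEq γ] (e : β ≃ γ)
      {τ : Field n β} : IsNatural n L τ → IsNatural n L fun D y (K : γ → Fin n) => τ D y (K ∘ e)
  | zero {β : Type} [Fintype β] [DecidableEq β] : IsNatural n L fun _ _ (_ : β → Fin n) => 0
  | add {β : Type} [Fintype β] [DecidableEq β] {σ τ : Field n β} :
      IsNatural n L σ → IsNatural n L τ → IsNatural n L fun D y J => σ D y J + τ D y J
  | const_mul {β : Type} [Fintype β] [DecidableEq β] (c : ℝ) {τ : Field n β} :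
      IsNatural n L τ → IsNatural n L fun D y J => c * τ D y J
  | prod {β γ : Type} [Fintype β] [DecidableEq β] [Fintype γ] [DecidableEq γ]
      {σ : Field n β} {τ : Field n γ} : IsNatural n L σ → IsNatural n L τ →
      IsNatural n L fun D y (K : β ⊕ γ → Fin n) => σ D y (K ∘ Sum.inl) * τ D y (K ∘ Sum.inr)
  | trace {β : Type} [Fintype β] [DecidableEq β] {τ : Field n (β ⊕ Fin 2)} :
      IsNatural n L τ → IsNatural n L fun D => trace D.G (τ D)
  | metric : IsNatural n L fun D y (K : Fin 2 → Fin n) => D.G y (K 0) (K 1)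
  | nablaRiemann (r : ℕ) : IsNatural n L fun D => nablaRiemann D.G r
  | nablaFun (l : ℕ) (h1 : 1 ≤ l) (h2 : l ≤ L) : IsNatural n L fun D => nablaFun D.G D.w l

/-! ### Closure of natural fields under algebraic operations and covariant derivative -/

namespace IsNatural

variable {n L : ℕ} {β γ : Type} [Fintype β] [DecidableEq β] [Fintype γ] [DecidableEq γ]

theorem smoothTensor {τ : Field n β} (h : IsNatural n L τ) (D : LocalData n) :
    SmoothTensor D.Ω (τ D) := by
  induction h with
  | congr _ hc ih => exact fun J => (ih J).congr fun y hy => hc D y hy J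
  | reindex e _ ih => exact fun K => ih _
  | zero => exact fun _ => contDiffOn_const
  | add _ _ ih1 ih2 => exact fun J => (ih1 J).add (ih2 J)
  | const_mul c _ ih => exact fun J => contDiffOn_const.mul (ih J)
  | prod _ _ ih1 ih2 => exact fun J => (ih1 _).mul (ih2 _)
  | trace _ ih => exact ih.trace D.metric
  | metric => exact fun _ => D.metric.smooth _ _
  | nablaRiemann r => exact smoothTensor_nablaRiemann D.metric r
  | nablaFun l _ _ => exact smoothTensor_nablaFun D.metric D.smooth l

theorem mono {L' : ℕ} (hL : L ≤ L') {τ : Field n β} (h : IsNatural n L τ) : IsNatural n L' τ := by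
  induction h with
  | congr _ hc ih => exact ih.congr hc
  | reindex e _ ih => exact ih.reindex e
  | zero => exact zero
  | add _ _ ih1 ih2 => exact ih1.add ih2
  | const_mul c _ ih => exact ih.const_mul c
  | prod _ _ ih1 ih2 => exact ih1.prod ih2
  | trace _ ih => exact ih.trace
  | metric => exact metric
  | nablaRiemann r => exact nablaRiemann r
  | nablaFun l h1 h2 => exact nablaFun l h1 (h2.trans hL)

theorem sub {σ τ : Field n β} (hσ : IsNatural n L σ) (hτ : IsNatural n L τ) :
    IsNatural n L fun D y J => σ D y J - τ D y J :=
  (hσ.add (hτ.const_mul (-1))).congr fun _ _ _ _ => by ring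

theorem sum {ι : Type*} (s : Finset ι) {τ : ι → Field n β} (h : ∀ i ∈ s, IsNatural n L (τ i)) :
    IsNatural n L fun D y J => ∑ i ∈ s, τ i D y J := by
  classical
  induction s using Finset.induction_on with
  | empty => exact zero.congr fun _ _ _ _ => by simp
  | insert a s ha ih =>
    exact ((h a (by simp)).add (ih fun i hi => h i (by simp [hi]))).congr fun _ _ _ _ => by
      rw [Finset.sum_insert ha]

/-- Structural induction: products obey the Leibniz rule, traces and reindexings commute with ∇, and
∇g = 0. Only the generators ∇ˡω force the order bound up by one. -/
theorem covD {τ : Field n β} (h : IsNatural n L τ) :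
    IsNatural n (L + 1) fun D => covD D.G (τ D) := by
  have hL : L ≤ L + 1 := Nat.le_succ L
  induction h with
  | congr _ hc ih =>
    exact ih.congr fun D y hy J => covD_congr D.metric.isOpen hy (hc D) J
  | reindex e _ ih =>
    exact (ih.reindex (Equiv.optionCongr e)).congr fun D y hy J => covD_reindex e _ J
  | zero => exact zero.congr fun D y hy J => by simp [NatTensor.covD, pd_const]
  | add h1 h2 ih1 ih2 =>
    exact (ih1.add ih2).congr fun D y hy J =>
      covD_add D.metric.isOpen hy (h1.smoothTensor D) (h2.smoothTensor D) J
  | const_mul c h ih =>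
    exact (ih.const_mul c).congr fun D y hy J =>
      covD_const_mul D.metric.isOpen hy c (h.smoothTensor D) J
  | @prod β γ _ _ _ _ σ τ h1 h2 ih1 ih2 =>
    refine (((ih1.prod (h2.mono hL)).reindex (optionSumLeft β γ)).add
      (((h1.mono hL).prod ih2).reindex (optionSumRight β γ))).congr fun D y hy J => ?_
    obtain ⟨i, K, rfl⟩ := exists_optCons J
    obtain ⟨K1, K2, rfl⟩ : ∃ K1 K2, K = Sum.elim K1 K2 := ⟨_, _, (Sum.elim_comp_inl_inr K).symm⟩
    rw [covD_prod D.metric.isOpen hy (h1.smoothTensor D) (h2.smoothTensor D),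
      optCons_comp_optionSumLeft, optCons_comp_optionSumRight]
    rfl
  | @trace β _ _ τ h ih =>
    refine (ih.reindex (optionSumLeft β (Fin 2)).symm).trace.congr fun D y hy J => ?_
    obtain ⟨i, K, rfl⟩ := exists_optCons J
    rw [covD_trace D.metric hy (h.smoothTensor D)]
    unfold NatTensor.trace
    simp only [← optCons_comp_optionSumLeft, Function.comp_assoc, Equiv.self_comp_symm,
      Function.comp_id]
  | metric => exact zero.congr fun D y hy J => covD_metric D.metric hy J
  | nablaRiemann r =>
    refine ((nablaRiemann (r + 1)).reindex (finSuccEquiv (4 + r))).congr fun D y hy J => ?_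
    obtain ⟨i, K, rfl⟩ := exists_optCons J
    rw [optCons_comp_finSuccEquiv]; rfl
  | nablaFun l h1 h2 =>
    refine ((nablaFun (l + 1) (by omega) (by omega)).reindex (finSuccEquiv l)).congr
      fun D y hy J => ?_
    obtain ⟨i, K, rfl⟩ := exists_optCons J
    rw [optCons_comp_finSuccEquiv]; rfl

/-- Contraction of the last index of `A` with the index `p` of `τ`, which is replaced by the last
but one index of `A`. -/
theorem insert {A : Field n (γ ⊕ Fin 2)} (hA : IsNatural n L A) {τ : Field n β}
    (hτ : IsNatural n L τ) (p : β) : IsNatural n L fun D y (J : γ ⊕ β → Fin n) =>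
      ∑ q, ∑ l, (D.G y)⁻¹ q l * (A D y (Sum.elim (J ∘ Sum.inl) ![J (Sum.inr p), l]) *
        τ D y (Function.update (J ∘ Sum.inr) p q)) := by
  refine ((hA.prod hτ).reindex (insertEquiv γ p)).trace.congr fun D y hy J => ?_
  unfold NatTensor.trace
  refine Finset.sum_congr rfl fun q _ => Finset.sum_congr rfl fun l _ => ?_
  congr 3
  · funext x
    rcases x with c | x
    · simp [insertEquiv, Equiv.swap_apply_of_ne_of_ne]
    · fin_cases x
      · simp [insertEquiv]
      · simp [insertEquiv, Equiv.swap_apply_of_ne_of_ne]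
  · funext x
    by_cases hx : x = p
    · subst hx; simp [insertEquiv]
    · simp [insertEquiv, Equiv.swap_apply_of_ne_of_ne, hx]

end IsNatural

theorem nablaFun_one {n : ℕ} (G : Coord n → Matrix (Fin n) (Fin n) ℝ) (w : Coord n → ℝ)
    (y : Coord n) (J : Fin 1 → Fin n) : nablaFun G w 1 y J = pd (J 0) w y := by
  simp [nablaFun, covDeriv]

/-! ### Naturality of the conformal change and of the Ricci identity -/

namespace IsNatural

variable {n L : ℕ} {β γ : Type} [Fintype β] [DecidableEq β] [Fintype γ] [DecidableEq γ]

theorem connDiff (hL : 1 ≤ L) : IsNatural n L fun D => connDiff D.G D.w := by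
  have h : IsNatural n L fun D y (K : Fin 3 → Fin n) => D.G y (K 0) (K 1) * pd (K 2) D.w y := by
    refine ((metric.prod (nablaFun 1 le_rfl hL)).reindex finSumFinEquiv).congr fun D y hy K => ?_
    rw [nablaFun_one]; rfl
  refine (((h.reindex (finRotate 3).symm).add (h.reindex (Equiv.swap 0 2))).sub h).congr
    fun D y hy K => ?_
  rfl

/-- The order L + 1 comes from ∇τ alone; the correction terms contain dω and τ undifferentiated,
whence the condition 1 ≤ L. -/
theorem covD_confMatrix {τ : Field n β} (hτ : IsNatural n L τ) (hL : 1 ≤ L) :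
    IsNatural n (L + 1) fun D => NatTensor.covD (confMatrix D.w D.G) (τ D) := by
  have hA : IsNatural n L fun D y (K : Fin 1 ⊕ Fin 2 → Fin n) =>
      NatTensor.connDiff D.G D.w y ![K (Sum.inl 0), K (Sum.inr 0), K (Sum.inr 1)] := by
    refine ((connDiff hL).reindex (finSumFinEquiv (m := 1) (n := 2)).symm).congr
      fun D y hy K => ?_
    congr 1
    funext x; fin_cases x <;> rfl
  let e : Fin 1 ⊕ β ≃ Option β :=
    { toFun := Sum.elim (fun _ => none) some
      invFun := fun o => o.elim (Sum.inl 0) Sum.inr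
      left_inv := by
        rintro (x | _)
        · rw [Subsingleton.elim x 0]; rfl
        · rfl
      right_inv := by rintro (_ | _) <;> rfl }
  refine (hτ.covD.sub (sum Finset.univ fun p _ =>
    ((hA.insert hτ p).reindex e).mono (Nat.le_succ L))).congr fun D y hy J => ?_
  obtain ⟨i, K, rfl⟩ := exists_optCons J
  rw [NatTensor.covD_confMatrix D.metric D.smooth hy]
  rfl

theorem confRiemann : IsNatural n 2 fun D => confRiemann D.G D.w := by
  have hS : IsNatural n 1 fun D => NatTensor.connDiff D.G D.w := connDiff le_rfl
  have hA : IsNatural n 1 fun D y (K : Fin 1 ⊕ Fin 2 → Fin n) =>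
      NatTensor.connDiff D.G D.w y ![K (Sum.inl 0), K (Sum.inr 0), K (Sum.inr 1)] := by
    refine (hS.reindex (finSumFinEquiv (m := 1) (n := 2)).symm).congr fun D y hy K => ?_
    congr 1
    funext x; fin_cases x <;> rfl
  have h1 : IsNatural n 2 fun D y (J : Fin 4 → Fin n) =>
      NatTensor.covD D.G (NatTensor.connDiff D.G D.w) y (optCons (J 0) ![J 1, J 2, J 3]) := by
    refine (hS.covD.reindex (finSuccEquiv 3).symm).congr fun D y hy J => ?_
    rw [finSuccEquiv_symm_comp]
    congr 2
    funext x; fin_cases x <;> rfl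
  have h2 : IsNatural n 2 fun D y (J : Fin 4 → Fin n) => ∑ q, ∑ l, (D.G y)⁻¹ q l *
      (NatTensor.connDiff D.G D.w y ![J 0, J 2, l] *
        NatTensor.connDiff D.G D.w y ![J 1, q, J 3]) := by
    refine (((hA.insert hS 1).reindex (finSumFinEquiv (m := 1) (n := 3))).mono
      (by omega)).congr fun D y hy J => ?_
    refine Finset.sum_congr rfl fun q _ => Finset.sum_congr rfl fun l _ => ?_
    congr 3
    funext x; fin_cases x <;> rfl
  refine (((((nablaRiemann 0).add h1).sub (h1.reindex (Equiv.swap 0 1))).add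
    (h2.reindex (Equiv.swap 0 1))).sub h2).congr fun D y hy J => ?_
  rfl

/-- The curvature contributes ∇²ω through the derivative of the connection difference, and each
further derivative raises the order by one. -/
theorem confNablaRiemann (r : ℕ) : IsNatural n (r + 2) fun D => confNablaRiemann D.G D.w r := by
  induction r with
  | zero => exact confRiemann
  | succ r ih =>
    refine (((ih.covD_confMatrix (by omega)).reindex (finSuccEquiv (4 + r)).symm).add
      ((((nablaFun 1 le_rfl (by omega)).prod (ih.mono (Nat.le_succ _))).reindex
        ((finSumFinEquiv (m := 1) (n := 4 + r)).trans (finCongr (by omega)))).const_mul 2)).congr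
      fun D y hy J => ?_
    rw [finSuccEquiv_symm_comp, nablaFun_one]
    have : J ∘ ⇑(finSumFinEquiv.trans (finCongr (by omega : 1 + (4 + r) = 4 + (r + 1)))) ∘ Sum.inr =
        Fin.tail J := by
      funext x
      simp only [Function.comp_apply, Fin.tail]
      congr 1
      ext; simp
    rw [Function.comp_assoc, Function.comp_assoc, this]
    rfl

/-- The curvature terms are a sum over the slots of τ, so naturality of τ is required only if there
is a slot. This form covers τ = ω, which has no slot and is not an admitted generator; there the
lemma expresses the symmetry of the Hessian. -/
theorem covD_covD_sub {τ : Field n β} (hτ : β → IsNatural n L τ)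
    (hs : ∀ D : LocalData n, SmoothTensor D.Ω (τ D)) :
    IsNatural n L fun D y (J : Option (Option β) → Fin n) =>
      NatTensor.covD D.G (NatTensor.covD D.G (τ D)) y J -
        NatTensor.covD D.G (NatTensor.covD D.G (τ D)) y
          (optCons (J (some none)) (optCons (J none) fun b => J (some (some b)))) := by
  have hA : IsNatural n L fun D y (K : Fin 2 ⊕ Fin 2 → Fin n) =>
      riemann D.G y ![K (Sum.inl 0), K (Sum.inl 1), K (Sum.inr 0), K (Sum.inr 1)] := by
    refine ((nablaRiemann 0).reindex (finSumFinEquiv (m := 2) (n := 2)).symm).congr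
      fun D y hy K => ?_
    change _ = riemann D.G y _
    congr 1
    funext x; fin_cases x <;> rfl
  let e : Fin 2 ⊕ β ≃ Option (Option β) :=
    { toFun := Sum.elim ![none, some none] fun b => some (some b)
      invFun := fun o => o.elim (Sum.inl 0) fun o => o.elim (Sum.inl 1) Sum.inr
      left_inv := by
        rintro (x | _)
        · fin_cases x <;> rfl
        · rfl
      right_inv := by rintro (_ | (_ | _)) <;> rfl }
  refine ((sum Finset.univ fun p _ => (hA.insert (hτ p) p).reindex e).const_mul (-1)).congr
    fun D y hy J => ?_
  obtain ⟨i, J, rfl⟩ := exists_optCons J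
  obtain ⟨j, J, rfl⟩ := exists_optCons J
  rw [neg_one_mul]
  exact NatTensor.covD_covD_sub D.metric hy (hs D) i j J

/-- Iterated covariant derivatives of functions are symmetric up to terms with fewer
derivatives. -/
theorem nablaFun_perm_sub (k : ℕ) : ∀ σ : Equiv.Perm (Fin (k + 1)),
    IsNatural n k fun D y (J : Fin (k + 1) → Fin n) =>
      NatTensor.nablaFun D.G D.w (k + 1) y (J ∘ σ) - NatTensor.nablaFun D.G D.w (k + 1) y J := by
  induction k with
  | zero =>
    intro σ
    rw [Subsingleton.elim (α := Equiv.Perm (Fin 1)) σ 1]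
    exact zero.congr fun D y hy J => by simp
  | succ k ih =>
    intro σ
    -- Adjacent transpositions generate the symmetric group, and the differences telescope along
    -- products.
    have hσ : σ ∈ Submonoid.closure
        (Set.range fun i : Fin (k + 1) => Equiv.swap i.castSucc i.succ) := by
      rw [Equiv.Perm.mclosure_swap_castSucc_succ]; trivial
    induction hσ using Submonoid.closure_induction with
    | one => exact zero.congr fun D y hy J => by simp
    | mul σ τ _ _ h1 h2 =>
      exact ((h2.reindex σ).add h1).congr fun D y hy J => by
        rw [Equiv.Perm.coe_mul, ← Function.comp_assoc]; ring
    | mem σ hσ =>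
      obtain ⟨i, rfl⟩ := hσ
      refine Fin.cases ?_ (fun j => ?_) i
      -- Exchanging the two outermost derivatives is the Ricci identity for ∇^k ω. A slot of ∇^k ω
      -- forces k ≥ 1, as the generator requires.
      · refine ((covD_covD_sub (n := n) (L := k + 1) (τ := fun D => NatTensor.nablaFun D.G D.w k)
          (fun p => nablaFun k (by have := p.pos; omega) (Nat.le_succ k))
          (fun D => smoothTensor_nablaFun D.metric D.smooth k)).reindex
          (((finSuccEquiv (k + 1)).trans
            (Equiv.optionCongr (finSuccEquiv k))).symm.trans
              (Equiv.swap 0 1))).congr fun D y hy J => ?_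
        have hn : ∀ K : Fin (k + 2) → Fin n, NatTensor.nablaFun D.G D.w (k + 2) y K =
            NatTensor.covD D.G (NatTensor.covD D.G (NatTensor.nablaFun D.G D.w k)) y
              (optCons (K 0) (optCons (K 1) (Fin.tail (Fin.tail K)))) := fun K =>
          covD_covDeriv (NatTensor.nablaFun D.G D.w k) y (K 0) (Fin.tail K)
        rw [hn, hn]
        congr 2
        funext o
        rcases o with _ | (_ | x)
        · rfl
        · rfl
        · simp only [optCons_some, Fin.tail, Function.comp_apply]
          rfl
      -- A transposition that fixes the outermost derivative is the ∇ of the induction hypothesis,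
      -- whose order rises from k to k + 1.
      · refine ((ih (Equiv.swap j.castSucc j.succ)).covD.reindex
          (finSuccEquiv (k + 1)).symm).congr fun D y hy J => ?_
        rw [finSuccEquiv_symm_comp]
        have h0 : Equiv.swap j.succ.castSucc j.succ.succ 0 = 0 :=
          Equiv.swap_apply_of_ne_of_ne (by simp [Fin.ext_iff]) (by simp [Fin.ext_iff])
        have h1 : ∀ x : Fin (k + 1), Equiv.swap j.succ.castSucc j.succ.succ x.succ =
            (Equiv.swap j.castSucc j.succ x).succ := by
          intro x
          rw [Fin.castSucc_succ, (Fin.succ_injective _).map_swap]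
        have hs := smoothTensor_nablaFun D.metric D.smooth (k + 1)
        have hJ : optCons (J 0) (Fin.tail J) ∘ Option.map (Equiv.swap j.castSucc j.succ) =
            optCons ((J ∘ Equiv.swap j.succ.castSucc j.succ.succ) 0)
              (Fin.tail (J ∘ Equiv.swap j.succ.castSucc j.succ.succ)) := by
          funext o
          rcases o with _ | x
          · change J 0 = J (Equiv.swap j.succ.castSucc j.succ.succ 0)
            rw [h0]
          · change J (Equiv.swap j.castSucc j.succ x).succ =
              J (Equiv.swap j.succ.castSucc j.succ.succ x.succ)
            rw [h1]
        rw [covD_sub D.metric.isOpen hy (fun K => hs _) hs, covD_reindex, hJ]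
        rfl

/-- An iterated covariant derivative of a function minus its symmetrization involves fewer
derivatives. -/
theorem nablaFun_sub_symmetrization (k : ℕ) :
    IsNatural n k fun D y (J : Fin (k + 1) → Fin n) =>
      NatTensor.nablaFun D.G D.w (k + 1) y J - ((k + 1).factorial : ℝ)⁻¹ *
        ∑ σ : Equiv.Perm (Fin (k + 1)), NatTensor.nablaFun D.G D.w (k + 1) y (J ∘ σ) := by
  refine ((sum Finset.univ fun σ _ => nablaFun_perm_sub (n := n) k σ).const_mul
    (-((k + 1).factorial : ℝ)⁻¹)).congr fun D y hy J => ?_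
  have h : ((k + 1).factorial : ℝ) ≠ 0 := by positivity
  rw [Finset.sum_sub_distrib, Finset.sum_const, Finset.card_univ, Fintype.card_perm,
    Fintype.card_fin, nsmul_eq_mul]
  field_simp
  ring

end IsNatural

/-! ### Normal form of natural tensor fields -/

/-- The tensor product of factors `∇ʳR`, `∇ˡω`, `g` and `g⁻¹`; the components are indexed by the
functions `P` on the set of all lower indices and `Q` on the set of all upper indices. -/
def tensorFactors {n : ℕ} (R O M I : Type) [Fintype R] [Fintype O] [Fintype M] [Fintype I]
    (ordR : R → ℕ) (ordO : O → ℕ) (G : Coord n → Matrix (Fin n) (Fin n) ℝ) (w : Coord n → ℝ)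
    (y : Coord n) (P : (Σ i, Fin (4 + ordR i)) ⊕ (Σ j, Fin (ordO j)) ⊕ (M × Fin 2) → Fin n)
    (Q : I × Fin 2 → Fin n) : ℝ :=
  (∏ i, nablaRiemann G (ordR i) y (fun s => P (Sum.inl ⟨i, s⟩))) *
  (∏ j, nablaFun G w (ordO j) y (fun s => P (Sum.inr (Sum.inl ⟨j, s⟩)))) *
  (∏ p, G y (P (Sum.inr (Sum.inr (p, 0)))) (P (Sum.inr (Sum.inr (p, 1))))) *
  (∏ q, (G y)⁻¹ (Q (q, 0)) (Q (q, 1)))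

theorem tensorFactors_sum {n : ℕ} {R O M I R' O' M' I' : Type} [Fintype R] [Fintype O] [Fintype M]
    [Fintype I] [Fintype R'] [Fintype O'] [Fintype M'] [Fintype I'] (ordR : R → ℕ) (ordO : O → ℕ)
    (ordR' : R' → ℕ) (ordO' : O' → ℕ) (G : Coord n → Matrix (Fin n) (Fin n) ℝ) (w : Coord n → ℝ)
    (y : Coord n) (P : (Σ i, Fin (4 + Sum.elim ordR ordR' i)) ⊕ (Σ j, Fin (Sum.elim ordO ordO' j)) ⊕
      ((M ⊕ M') × Fin 2) → Fin n) (Q : (I ⊕ I') × Fin 2 → Fin n) :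
    tensorFactors (R ⊕ R') (O ⊕ O') (M ⊕ M') (I ⊕ I') (Sum.elim ordR ordR') (Sum.elim ordO ordO')
      G w y P Q =
    tensorFactors R O M I ordR ordO G w y (P ∘ Sum.map (fun x => ⟨Sum.inl x.1, x.2⟩)
        (Sum.map (fun x => ⟨Sum.inl x.1, x.2⟩) fun x => (Sum.inl x.1, x.2)))
        (Q ∘ fun x => (Sum.inl x.1, x.2)) *
      tensorFactors R' O' M' I' ordR' ordO' G w y (P ∘ Sum.map (fun x => ⟨Sum.inr x.1, x.2⟩)
        (Sum.map (fun x => ⟨Sum.inr x.1, x.2⟩) fun x => (Sum.inr x.1, x.2)))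
        (Q ∘ fun x => (Sum.inr x.1, x.2)) := by
  have key : ∀ a a' b b' c c' d d' : ℝ, (a * a') * (b * b') * (c * c') * (d * d') =
    (a * b * c * d) * (a' * b' * c' * d') := by intros; ring
  exact (congrArg₂ (· * ·) (congrArg₂ (· * ·) (congrArg₂ (· * ·) (Fintype.prod_sum_type _)
    (Fintype.prod_sum_type _)) (Fintype.prod_sum_type _)) (Fintype.prod_sum_type _)).trans
    (key _ _ _ _ _ _ _ _)

/-- A partial contraction with arbitrary finite index types. -/
structure Mono (α β : Type) where
  /-- indexes the factors `∇ʳR` -/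
  R : Type
  /-- indexes the factors `∇ˡω` -/
  O : Type
  /-- indexes the factors `g` -/
  M : Type
  /-- indexes the factors `g⁻¹` -/
  I : Type
  /-- indexes the contractions -/
  K : Type
  [fR : Fintype R]
  [fO : Fintype O]
  [fM : Fintype M]
  [fI : Fintype I]
  [fK : Fintype K]
  [dK : DecidableEq K]
  /-- orders of the factors `∇ʳR` -/
  ordR : R → ℕ
  /-- orders of the factors `∇ˡω` -/
  ordO : O → ℕ
  ordO_pos : ∀ j, 1 ≤ ordO j
  /-- labels of the lower indices -/
  lower : ((Σ i, Fin (4 + ordR i)) ⊕ (Σ j, Fin (ordO j)) ⊕ (M × Fin 2)) ≃ β ⊕ K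
  /-- labels of the upper indices -/
  upper : I × Fin 2 ≃ α ⊕ K

namespace Mono

attribute [instance] Mono.fR Mono.fO Mono.fM Mono.fI Mono.fK Mono.dK

/-- The evaluation of a partial contraction. -/
def eval {n : ℕ} {α β : Type} (c : Mono α β) (G : Coord n → Matrix (Fin n) (Fin n) ℝ)
    (w : Coord n → ℝ) (y : Coord n) (A : α → Fin n) (B : β → Fin n) : ℝ :=
  ∑ d : c.K → Fin n, tensorFactors c.R c.O c.M c.I c.ordR c.ordO G w y
    (Sum.elim B d ∘ c.lower) (Sum.elim A d ∘ c.upper)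

/-- Renaming of the free indices. -/
def reindex {α β α' β' : Type} (c : Mono α β) (e : α ≃ α') (e' : β ≃ β') : Mono α' β' where
  R := c.R
  O := c.O
  M := c.M
  I := c.I
  K := c.K
  ordR := c.ordR
  ordO := c.ordO
  ordO_pos := c.ordO_pos
  lower := c.lower.trans (Equiv.sumCongr e' (Equiv.refl _))
  upper := c.upper.trans (Equiv.sumCongr e (Equiv.refl _))

theorem eval_reindex {n : ℕ} {α β α' β' : Type} (c : Mono α β) (e : α ≃ α') (e' : β ≃ β')
    (G : Coord n → Matrix (Fin n) (Fin n) ℝ) (w : Coord n → ℝ) (y : Coord n) (A : α' → Fin n)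
    (B : β' → Fin n) : (c.reindex e e').eval G w y A B = c.eval G w y (A ∘ e) (B ∘ e') := by
  have h : ∀ {γ γ' κ : Type} (f : γ ≃ γ') (C : γ' → Fin n) (d : κ → Fin n),
      Sum.elim C d ∘ (Equiv.sumCongr f (Equiv.refl _)) = Sum.elim (C ∘ f) d := by
    intro γ γ' κ f C d; funext x; rcases x with x | x <;> rfl
  refine Finset.sum_congr rfl fun d _ => ?_
  refine congrArg₂ (tensorFactors c.R c.O c.M c.I c.ordR c.ordO G w y) ?_ ?_
  · exact congrArg (· ∘ c.lower) (h e' B d)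
  · exact congrArg (· ∘ c.upper) (h e A d)

/-- Contraction of several pairs of free indices. -/
def contract {α β κ : Type} [Fintype κ] [DecidableEq κ] (c : Mono (α ⊕ κ) (β ⊕ κ)) :
    Mono α β where
  R := c.R
  O := c.O
  M := c.M
  I := c.I
  K := κ ⊕ c.K
  ordR := c.ordR
  ordO := c.ordO
  ordO_pos := c.ordO_pos
  lower := c.lower.trans (Equiv.sumAssoc β κ c.K)
  upper := c.upper.trans (Equiv.sumAssoc α κ c.K)

/-- Functions on κ ⊕ K are pairs of functions, so the new and the old contractions form a single
sum. -/
theorem eval_contract {n : ℕ} {α β κ : Type} [Fintype κ] [DecidableEq κ]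
    (c : Mono (α ⊕ κ) (β ⊕ κ)) (G : Coord n → Matrix (Fin n) (Fin n) ℝ) (w : Coord n → ℝ)
    (y : Coord n) (A : α → Fin n) (B : β → Fin n) : c.contract.eval G w y A B =
      ∑ d : κ → Fin n, c.eval G w y (Sum.elim A d) (Sum.elim B d) := by
  have h : ∀ {γ κ' : Type} (C : γ → Fin n) (d : κ → Fin n) (d' : κ' → Fin n),
      Sum.elim C (Sum.elim d d') ∘ (Equiv.sumAssoc γ κ κ') = Sum.elim (Sum.elim C d) d' := by
    intro γ κ' C d d'; funext x; rcases x with (x | x) | x <;> rfl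
  refine Eq.trans ?_ (Fintype.sum_prod_type' fun (d : κ → Fin n) (d' : c.K → Fin n) =>
    tensorFactors c.R c.O c.M c.I c.ordR c.ordO G w y
      (Sum.elim (Sum.elim B d) d' ∘ c.lower) (Sum.elim (Sum.elim A d) d' ∘ c.upper))
  refine (Fintype.sum_equiv (Equiv.sumArrowEquivProdArrow κ c.K (Fin n)).symm _ _ ?_).symm
  rintro ⟨d, d'⟩
  dsimp only
  rw [← h A d d', ← h B d d']
  rfl

/-- The interchange of the inner summands in a sum of three sums of two types. -/
def sumSumSumComm (a b c a' b' c' : Type) :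
    (a ⊕ a') ⊕ (b ⊕ b') ⊕ (c ⊕ c') ≃ (a ⊕ b ⊕ c) ⊕ (a' ⊕ b' ⊕ c') :=
  (Equiv.sumCongr (Equiv.refl _) (Equiv.sumSumSumComm b b' c c')).trans
    (Equiv.sumSumSumComm a a' (b ⊕ c) (b' ⊕ c'))

/-- The tensor product. -/
def prod {α β α' β' : Type} (c : Mono α β) (c' : Mono α' β') : Mono (α ⊕ α') (β ⊕ β') where
  R := c.R ⊕ c'.R
  O := c.O ⊕ c'.O
  M := c.M ⊕ c'.M
  I := c.I ⊕ c'.I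
  K := c.K ⊕ c'.K
  ordR := Sum.elim c.ordR c'.ordR
  ordO := Sum.elim c.ordO c'.ordO
  ordO_pos := by
    rintro (j | j)
    · exact c.ordO_pos j
    · exact c'.ordO_pos j
  lower := ((Equiv.sumCongr (Equiv.sumSigmaDistrib _) (Equiv.sumCongr (Equiv.sumSigmaDistrib _)
    (Equiv.sumProdDistrib _ _ _))).trans (sumSumSumComm _ _ _ _ _ _)).trans
    ((Equiv.sumCongr c.lower c'.lower).trans (Equiv.sumSumSumComm _ _ _ _))
  upper := (Equiv.sumProdDistrib _ _ _).trans
    ((Equiv.sumCongr c.upper c'.upper).trans (Equiv.sumSumSumComm _ _ _ _))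

theorem eval_prod {n : ℕ} {α β α' β' : Type} (c : Mono α β) (c' : Mono α' β')
    (G : Coord n → Matrix (Fin n) (Fin n) ℝ) (w : Coord n → ℝ) (y : Coord n) (A : α ⊕ α' → Fin n)
    (B : β ⊕ β' → Fin n) : (c.prod c').eval G w y A B =
      c.eval G w y (A ∘ Sum.inl) (B ∘ Sum.inl) * c'.eval G w y (A ∘ Sum.inr) (B ∘ Sum.inr) := by
  have hl : ∀ {γ γ' : Type} (C : γ ⊕ γ' → Fin n) (d : c.K → Fin n) (d' : c'.K → Fin n)
      (x : γ ⊕ c.K), Sum.elim C (Sum.elim d d') (Equiv.sumSumSumComm γ _ γ' _ (Sum.inl x)) =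
        Sum.elim (C ∘ Sum.inl) d x := by
    rintro γ γ' C d d' (x | x) <;> rfl
  have hr : ∀ {γ γ' : Type} (C : γ ⊕ γ' → Fin n) (d : c.K → Fin n) (d' : c'.K → Fin n)
      (x : γ' ⊕ c'.K), Sum.elim C (Sum.elim d d') (Equiv.sumSumSumComm γ _ γ' _ (Sum.inr x)) =
        Sum.elim (C ∘ Sum.inr) d' x := by
    rintro γ γ' C d d' (x | x) <;> rfl
  have e1 := Fintype.sum_mul_sum
    (fun d => tensorFactors c.R c.O c.M c.I c.ordR c.ordO G w y
      (Sum.elim (B ∘ Sum.inl) d ∘ c.lower) (Sum.elim (A ∘ Sum.inl) d ∘ c.upper))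
    (fun d => tensorFactors c'.R c'.O c'.M c'.I c'.ordR c'.ordO G w y
      (Sum.elim (B ∘ Sum.inr) d ∘ c'.lower) (Sum.elim (A ∘ Sum.inr) d ∘ c'.upper))
  refine Eq.trans ?_ e1.symm
  refine Eq.trans ?_ (Fintype.sum_prod_type' _)
  refine (Fintype.sum_equiv (Equiv.sumArrowEquivProdArrow c.K c'.K (Fin n)).symm _ _ ?_).symm
  rintro ⟨d, d'⟩
  change _ = tensorFactors (c.R ⊕ c'.R) (c.O ⊕ c'.O) (c.M ⊕ c'.M) (c.I ⊕ c'.I)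
    (Sum.elim c.ordR c'.ordR) (Sum.elim c.ordO c'.ordO) G w y
    (Sum.elim B (Sum.elim d d') ∘ (c.prod c').lower)
    (Sum.elim A (Sum.elim d d') ∘ (c.prod c').upper)
  rw [tensorFactors_sum]
  refine congrArg₂ (· * ·)
    (congrArg₂ (tensorFactors c.R c.O c.M c.I c.ordR c.ordO G w y) ?_ ?_)
    (congrArg₂ (tensorFactors c'.R c'.O c'.M c'.I c'.ordR c'.ordO G w y) ?_ ?_)
  · funext x
    rcases x with x | x | x <;> exact (hl _ _ _ _).symm
  · funext x
    exact (hl _ _ _ _).symm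
  · funext x
    rcases x with x | x | x <;> exact (hr _ _ _ _).symm
  · funext x
    exact (hr _ _ _ _).symm

/-- A tensor product without contractions. -/
def pure (R O M I : Type) [Fintype R] [Fintype O] [Fintype M] [Fintype I] (ordR : R → ℕ)
    (ordO : O → ℕ) (h : ∀ j, 1 ≤ ordO j) :
    Mono (I × Fin 2) ((Σ i, Fin (4 + ordR i)) ⊕ (Σ j, Fin (ordO j)) ⊕ (M × Fin 2)) where
  R := R
  O := O
  M := M
  I := I
  K := Fin 0
  ordR := ordR
  ordO := ordO
  ordO_pos := h
  lower := (Equiv.sumEmpty _ _).symm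
  upper := (Equiv.sumEmpty _ _).symm

theorem eval_pure {n : ℕ} (R O M I : Type) [Fintype R] [Fintype O] [Fintype M] [Fintype I]
    (ordR : R → ℕ) (ordO : O → ℕ) (h : ∀ j, 1 ≤ ordO j)
    (G : Coord n → Matrix (Fin n) (Fin n) ℝ) (w : Coord n → ℝ) (y : Coord n) (A : I × Fin 2 → Fin n)
    (B : ((Σ i, Fin (4 + ordR i)) ⊕ (Σ j, Fin (ordO j)) ⊕ (M × Fin 2)) → Fin n) :
    (pure R O M I ordR ordO h).eval G w y A B = tensorFactors R O M I ordR ordO G w y B A :=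
  Fintype.sum_unique (ι := Fin 0 → Fin n) _

/-- The partial contraction with index types `Fin _`. -/
def toPartialContraction {a b : ℕ} (c : Mono (Fin a) (Fin b)) : PartialContraction a b where
  numR := Fintype.card c.R
  ordR i := c.ordR ((Fintype.equivFin c.R).symm i)
  numOm := Fintype.card c.O
  ordOm j := c.ordO ((Fintype.equivFin c.O).symm j)
  ordOm_pos _ := c.ordO_pos _
  numG := Fintype.card c.M
  numGInv := Fintype.card c.I
  numContr := Fintype.card c.K
  lower := ((Equiv.sumCongr
    (Equiv.sigmaCongrLeft (β := fun i => Fin (4 + c.ordR i)) (Fintype.equivFin c.R).symm)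
    (Equiv.sumCongr
      (Equiv.sigmaCongrLeft (β := fun j => Fin (c.ordO j)) (Fintype.equivFin c.O).symm)
      (Equiv.prodCongr (Fintype.equivFin c.M).symm (Equiv.refl _)))).trans c.lower).trans
    (Equiv.sumCongr (Equiv.refl _) (Fintype.equivFin c.K))
  upper := ((Equiv.prodCongr (Fintype.equivFin c.I).symm (Equiv.refl _)).trans c.upper).trans
    (Equiv.sumCongr (Equiv.refl _) (Fintype.equivFin c.K))

/-- Arbitrary index types make products and contractions mere disjoint unions; numbering them is
postponed to this point, where it only renames summation and product indices. -/
theorem eval_toPartialContraction {n a b : ℕ} (c : Mono (Fin a) (Fin b))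
    (G : Coord n → Matrix (Fin n) (Fin n) ℝ) (w : Coord n → ℝ) (y : Coord n) (A : Fin a → Fin n)
    (B : Fin b → Fin n) : c.toPartialContraction.eval G w y A B = c.eval G w y A B := by
  have h : ∀ {γ : Type} (C : γ → Fin n) (d : c.K → Fin n) (x : γ ⊕ c.K),
      Sum.elim C (d ∘ (Fintype.equivFin c.K).symm)
        (Equiv.sumCongr (Equiv.refl _) (Fintype.equivFin c.K) x) = Sum.elim C d x := by
    rintro γ C d (x | x)
    · rfl
    · simp
  refine (Fintype.sum_equiv (Equiv.arrowCongr (Fintype.equivFin c.K) (Equiv.refl (Fin n)))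
    _ _ fun d => ?_).symm
  have e : (Equiv.arrowCongr (Fintype.equivFin c.K) (Equiv.refl (Fin n))) d =
    d ∘ (Fintype.equivFin c.K).symm := rfl
  rw [e]
  refine congrArg₂ (· * ·) (congrArg₂ (· * ·) (congrArg₂ (· * ·) ?_ ?_) ?_) ?_
  · refine (Fintype.prod_equiv (Fintype.equivFin c.R).symm _ _ fun i => ?_).symm
    exact congrArg (nablaRiemann G _ y) (funext fun s => h _ _ _)
  · refine (Fintype.prod_equiv (Fintype.equivFin c.O).symm _ _ fun i => ?_).symm
    exact congrArg (nablaFun G w _ y) (funext fun s => h _ _ _)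
  · refine (Fintype.prod_equiv (Fintype.equivFin c.M).symm _ _ fun i => ?_).symm
    exact congrArg₂ (G y) (h _ _ _) (h _ _ _)
  · refine (Fintype.prod_equiv (Fintype.equivFin c.I).symm _ _ fun i => ?_).symm
    exact congrArg₂ (fun i j => (G y)⁻¹ i j) (h _ _ _) (h _ _ _)

end Mono

/-! ### The span of the partial contractions -/

/-- Functions of the data (metric, function, point) with `α` upper and `β` lower indices. -/
abbrev TensorFun (n : ℕ) (α β : Type) : Type :=
  (Coord n → Matrix (Fin n) (Fin n) ℝ) → (Coord n → ℝ) → Coord n → (α → Fin n) → (β → Fin n) → ℝ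

/-- The linear combinations of partial contractions with factors `∇ˡω`, `l ≤ L`. -/
def monoSpan (n L : ℕ) (α β : Type) : Submodule ℝ (TensorFun n α β) :=
  Submodule.span ℝ {f | ∃ c : Mono α β, (∀ j, c.ordO j ≤ L) ∧ f = c.eval}

namespace monoSpan

variable {n L : ℕ} {α β α' β' : Type}

theorem eval_mem (c : Mono α β) (h : ∀ j, c.ordO j ≤ L) : c.eval ∈ monoSpan n L α β :=
  Submodule.subset_span ⟨c, h, rfl⟩

theorem reindex (e : α ≃ α') (e' : β ≃ β') {f : TensorFun n α β} (hf : f ∈ monoSpan n L α β) :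
    (fun G w y A B => f G w y (A ∘ e) (B ∘ e')) ∈ monoSpan n L α' β' := by
  induction hf using Submodule.span_induction with
  | mem f hf =>
    obtain ⟨c, hc, rfl⟩ := hf
    convert eval_mem (n := n) (c.reindex e e') hc using 1
    funext G w y A B
    rw [c.eval_reindex]
  | zero => exact zero_mem _
  | add f g _ _ hf hg => exact add_mem hf hg
  | smul r f _ hf => exact Submodule.smul_mem _ r hf

theorem contract {κ : Type} [Fintype κ] [DecidableEq κ] {f : TensorFun n (α ⊕ κ) (β ⊕ κ)}
    (hf : f ∈ monoSpan n L (α ⊕ κ) (β ⊕ κ)) :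
    (fun G w y A B => ∑ d : κ → Fin n, f G w y (Sum.elim A d) (Sum.elim B d)) ∈
      monoSpan n L α β := by
  induction hf using Submodule.span_induction with
  | mem f hf =>
    obtain ⟨c, hc, rfl⟩ := hf
    convert eval_mem (n := n) c.contract hc using 1
    funext G w y A B
    rw [c.eval_contract]
  | zero =>
    convert zero_mem (monoSpan n L α β) using 1
    funext G w y A B
    simp
  | add f g _ _ hf hg =>
    convert add_mem hf hg using 1
    funext G w y A B
    simp [Finset.sum_add_distrib]
  | smul r f _ hf =>
    convert Submodule.smul_mem _ r hf using 1
    funext G w y A B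
    simp [Finset.mul_sum]

theorem prod {f : TensorFun n α β} (hf : f ∈ monoSpan n L α β) {g : TensorFun n α' β'}
    (hg : g ∈ monoSpan n L α' β') :
    (fun G w y A B => f G w y (A ∘ Sum.inl) (B ∘ Sum.inl) * g G w y (A ∘ Sum.inr) (B ∘ Sum.inr)) ∈
      monoSpan n L (α ⊕ α') (β ⊕ β') := by
  induction hf using Submodule.span_induction with
  | mem f hf =>
    obtain ⟨c, hc, rfl⟩ := hf
    induction hg using Submodule.span_induction with
    | mem g hg =>
      obtain ⟨c', hc', rfl⟩ := hg
      convert eval_mem (n := n) (L := L) (c.prod c') ?_ using 1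
      · funext G w y A B
        rw [c.eval_prod]
      · rintro (j | j)
        · exact hc j
        · exact hc' j
    | zero =>
      convert zero_mem (monoSpan n L (α ⊕ α') (β ⊕ β')) using 1
      funext G w y A B
      simp
    | add f g _ _ hf hg =>
      convert add_mem hf hg using 1
      funext G w y A B
      simp [mul_add]
    | smul r f _ hf =>
      convert Submodule.smul_mem _ r hf using 1
      funext G w y A B
      simp only [Pi.smul_apply, smul_eq_mul]
      ring
  | zero =>
    convert zero_mem (monoSpan n L (α ⊕ α') (β ⊕ β')) using 1
    funext G w y A B
    simp
  | add f g _ _ hf hg =>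
    convert add_mem hf hg using 1
    funext G w y A B
    simp [add_mul]
  | smul r f _ hf =>
    convert Submodule.smul_mem _ r hf using 1
    funext G w y A B
    simp only [Pi.smul_apply, smul_eq_mul]
    ring

theorem metric_mem : (fun G _ y _ B => G y (B 0) (B 1)) ∈ monoSpan n L Empty (Fin 2) := by
  let c := Mono.pure (Fin 0) (Fin 0) (Fin 1) (Fin 0) (fun _ => 0) (fun _ => 1) (fun _ => le_rfl)
  let e : ((Σ i : Fin 0, Fin (4 + (fun _ : Fin 0 => 0) i)) ⊕
      (Σ j : Fin 0, Fin ((fun _ : Fin 0 => 1) j)) ⊕ (Fin 1 × Fin 2)) ≃ Fin 2 :=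
    (Equiv.emptySum _ _).trans ((Equiv.emptySum _ _).trans (Equiv.uniqueProd _ _))
  convert reindex (Equiv.equivOfIsEmpty _ Empty) e (eval_mem (n := n) (L := L) c fun j => j.elim0)
    using 1
  funext G w y A B
  rw [Mono.eval_pure]
  simp [tensorFactors, e]

/-- All metric factors at once: the case 0, 0 gives the constant 1, the case 0, 1 the factor g⁻¹ of
a trace, and the general case the metric part of a partial contraction. -/
theorem metricInv_pow_mem (M N : ℕ) : (fun G _ y A B =>
    (∏ p : Fin M, G y (B (p, 0)) (B (p, 1))) * ∏ q : Fin N, (G y)⁻¹ (A (q, 0)) (A (q, 1))) ∈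
      monoSpan n L (Fin N × Fin 2) (Fin M × Fin 2) := by
  let c := Mono.pure (Fin 0) (Fin 0) (Fin M) (Fin N) (fun _ => 0) (fun _ => 1) (fun _ => le_rfl)
  let e : ((Σ i : Fin 0, Fin (4 + (fun _ : Fin 0 => 0) i)) ⊕
      (Σ j : Fin 0, Fin ((fun _ : Fin 0 => 1) j)) ⊕ (Fin M × Fin 2)) ≃ Fin M × Fin 2 :=
    (Equiv.emptySum _ _).trans (Equiv.emptySum _ _)
  convert reindex (Equiv.refl _) e (eval_mem (n := n) (L := L) c fun j => j.elim0) using 1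
  funext G w y A B
  rw [Mono.eval_pure]
  simp [tensorFactors, e]

theorem nablaRiemann_mem (r : ℕ) :
    (fun G _ y _ B => nablaRiemann G r y B) ∈ monoSpan n L Empty (Fin (4 + r)) := by
  let c := Mono.pure (Fin 1) (Fin 0) (Fin 0) (Fin 0) (fun _ => r) (fun _ => 1) (fun _ => le_rfl)
  let e : ((Σ i : Fin 1, Fin (4 + (fun _ : Fin 1 => r) i)) ⊕
      (Σ j : Fin 0, Fin ((fun _ : Fin 0 => 1) j)) ⊕ (Fin 0 × Fin 2)) ≃ Fin (4 + r) :=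
    (Equiv.sumEmpty _ _).trans (Equiv.uniqueSigma _)
  convert reindex (Equiv.equivOfIsEmpty _ Empty) e (eval_mem (n := n) (L := L) c fun j => j.elim0)
    using 1
  funext G w y A B
  rw [Mono.eval_pure]
  simp [tensorFactors, e]
  rfl

theorem nablaFun_mem (l : ℕ) (h1 : 1 ≤ l) (h2 : l ≤ L) :
    (fun G w y _ B => nablaFun G w l y B) ∈ monoSpan n L Empty (Fin l) := by
  let c := Mono.pure (Fin 0) (Fin 1) (Fin 0) (Fin 0) (fun _ => 0) (fun _ => l) (fun _ => h1)
  let e : ((Σ i : Fin 0, Fin (4 + (fun _ : Fin 0 => 0) i)) ⊕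
      (Σ j : Fin 1, Fin ((fun _ : Fin 1 => l) j)) ⊕ (Fin 0 × Fin 2)) ≃ Fin l :=
    (Equiv.emptySum _ _).trans ((Equiv.sumEmpty _ _).trans (Equiv.uniqueSigma _))
  convert reindex (Equiv.equivOfIsEmpty _ Empty) e (eval_mem (n := n) (L := L) c fun j => h2)
    using 1
  funext G w y A B
  rw [Mono.eval_pure]
  simp [tensorFactors, e]
  rfl

theorem one_mem [IsEmpty α] [IsEmpty β] : (fun _ _ _ _ _ => 1) ∈ monoSpan n L α β := by
  convert reindex (Equiv.equivOfIsEmpty _ α) (Equiv.equivOfIsEmpty _ β)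
    (metricInv_pow_mem (n := n) (L := L) 0 0) using 1
  funext G w y A B
  simp

theorem finProd (N : ℕ) : ∀ {β : Fin N → Type} {f : ∀ i, TensorFun n Empty (β i)},
    (∀ i, f i ∈ monoSpan n L Empty (β i)) →
    (fun G w y A B => ∏ i, f i G w y A fun s => B ⟨i, s⟩) ∈ monoSpan n L Empty (Σ i, β i) := by
  induction N with
  | zero =>
    intro β f _
    simpa using one_mem (n := n) (L := L) (α := Empty) (β := Σ i, β i)
  | succ N ih =>
    intro β f hf
    let e : β 0 ⊕ (Σ i : Fin N, β i.succ) ≃ Σ i, β i := Equiv.ofBijective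
      (Sum.elim (fun b => ⟨0, b⟩) fun p => ⟨p.1.succ, p.2⟩) (by
        constructor
        · rintro (b | ⟨i, b⟩) (b' | ⟨i', b'⟩) h
          · simpa using h
          · exact absurd (congrArg Sigma.fst h) (Fin.succ_ne_zero i').symm
          · exact absurd (congrArg Sigma.fst h) (Fin.succ_ne_zero i)
          · simp only [Sum.elim_inr, Sigma.mk.injEq, Fin.succ_inj] at h
            obtain ⟨rfl, h⟩ := h
            rw [eq_of_heq h]
        · rintro ⟨i, b⟩
          induction i using Fin.cases with
          | zero => exact ⟨Sum.inl b, rfl⟩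
          | succ i => exact ⟨Sum.inr ⟨i, b⟩, rfl⟩)
    convert reindex (Equiv.equivOfIsEmpty (Empty ⊕ Empty) Empty) e
      (prod (hf 0) (ih fun i => hf i.succ)) using 1
    funext G w y A B
    rw [Fin.prod_univ_succ]
    congr 1
    · congr 1; exact Subsingleton.elim _ _
    · refine Finset.prod_congr rfl fun i _ => ?_
      congr 1; exact Subsingleton.elim _ _

/-- Replacing the factors `∇ʳR` and `∇ˡω` of a partial contraction. -/
theorem subst {a b : ℕ} (c : PartialContraction a b)
    {f : ∀ i, TensorFun n Empty (Fin (4 + c.ordR i))} {g : ∀ j, TensorFun n Empty (Fin (c.ordOm j))}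
    (hf : ∀ i, f i ∈ monoSpan n L Empty _) (hg : ∀ j, g j ∈ monoSpan n L Empty _) :
    (fun G w y A B => ∑ d : Fin c.numContr → Fin n,
      (∏ i, f i G w y Empty.elim (fun s => Sum.elim B d (c.lower (Sum.inl ⟨i, s⟩)))) *
      (∏ j, g j G w y Empty.elim (fun s => Sum.elim B d (c.lower (Sum.inr (Sum.inl ⟨j, s⟩))))) *
      (∏ p, G y (Sum.elim B d (c.lower (Sum.inr (Sum.inr (p, 0)))))
        (Sum.elim B d (c.lower (Sum.inr (Sum.inr (p, 1)))))) *
      (∏ q, (G y)⁻¹ (Sum.elim A d (c.upper (q, 0))) (Sum.elim A d (c.upper (q, 1))))) ∈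
      monoSpan n L (Fin a) (Fin b) := by
  have h := prod (finProd _ hf) (prod (finProd _ hg)
    (metricInv_pow_mem (n := n) (L := L) c.numG c.numGInv))
  have h' := contract (reindex (((Equiv.emptySum _ _).trans (Equiv.emptySum _ _)).trans c.upper)
    c.lower h)
  convert h' using 1
  funext G w y A B
  refine Finset.sum_congr rfl fun d _ => ?_
  rw [mul_assoc, mul_assoc]
  refine congrArg₂ (· * ·) (Finset.prod_congr rfl fun i _ => ?_)
    (congrArg₂ (· * ·) (Finset.prod_congr rfl fun i _ => ?_) rfl)
  · exact congrArg (fun A => f i G w y A _) (Subsingleton.elim _ _)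
  · exact congrArg (fun A => g i G w y A _) (Subsingleton.elim _ _)

theorem exists_evalComb {a b : ℕ} {f : TensorFun n (Fin a) (Fin b)}
    (hf : f ∈ monoSpan n L (Fin a) (Fin b)) : ∃ u : PartialContraction a b →₀ ℝ,
      (∀ c ∈ u.support, ∀ j, c.ordOm j ≤ L) ∧ f = evalComb u := by
  induction hf using Submodule.span_induction with
  | mem f hf =>
    obtain ⟨c, hc, rfl⟩ := hf
    refine ⟨Finsupp.single c.toPartialContraction 1, fun c' hc' j => ?_, ?_⟩
    · obtain rfl : c' = c.toPartialContraction := by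
        simpa using Finsupp.support_single_subset hc'
      exact hc _
    · funext G w y A B
      rw [evalComb, Finsupp.sum_single_index (by simp), one_mul, c.eval_toPartialContraction]
  | zero => exact ⟨0, by simp, by funext G w y A B; simp [evalComb]⟩
  | add f g _ _ hf hg =>
    classical
    obtain ⟨u, hu, rfl⟩ := hf
    obtain ⟨v, hv, rfl⟩ := hg
    refine ⟨u + v, fun c hc => ?_, ?_⟩
    · rcases Finset.mem_union.1 (Finsupp.support_add hc) with h | h
      · exact hu c h
      · exact hv c h
    · funext G w y A B
      exact (Finsupp.sum_add_index' (by simp) fun _ _ _ => by ring).symm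
  | smul r f _ hf =>
    obtain ⟨u, hu, rfl⟩ := hf
    refine ⟨r • u, fun c hc => hu c (Finsupp.support_smul hc), ?_⟩
    funext G w y A B
    simp only [evalComb, Pi.smul_apply, smul_eq_mul]
    rw [Finsupp.sum_smul_index (by simp), Finsupp.mul_sum]
    exact Finsupp.sum_congr fun c _ => by ring

end monoSpan

/-- Induction on the generation of τ, since the span is closed under each operation. One f serves
all local data, which is what makes the coefficients universal. -/
theorem IsNatural.exists_mem_monoSpan {n L : ℕ} {β : Type} [Fintype β] [DecidableEq β]
    {τ : Field n β} (h : IsNatural n L τ) : ∃ f ∈ monoSpan n L Empty β,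
      ∀ (D : LocalData n), ∀ y ∈ D.Ω, ∀ J, τ D y J = f D.G D.w y Empty.elim J := by
  induction h with
  | congr _ hc ih =>
    obtain ⟨f, hf, h⟩ := ih
    exact ⟨f, hf, fun D y hy J => (hc D y hy J).trans (h D y hy J)⟩
  | reindex e _ ih =>
    obtain ⟨f, hf, h⟩ := ih
    exact ⟨_, monoSpan.reindex (Equiv.refl _) e hf, fun D y hy J => h D y hy _⟩
  | zero => exact ⟨0, zero_mem _, fun _ _ _ _ => rfl⟩
  | add _ _ ih1 ih2 =>
    obtain ⟨f, hf, h1⟩ := ih1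
    obtain ⟨g, hg, h2⟩ := ih2
    exact ⟨f + g, add_mem hf hg, fun D y hy J =>
      congrArg₂ (· + ·) (h1 D y hy J) (h2 D y hy J)⟩
  | const_mul c _ ih =>
    obtain ⟨f, hf, h⟩ := ih
    exact ⟨c • f, Submodule.smul_mem _ c hf, fun D y hy J =>
      congrArg (c * ·) (h D y hy J)⟩
  | prod _ _ ih1 ih2 =>
    obtain ⟨f, hf, h1⟩ := ih1
    obtain ⟨g, hg, h2⟩ := ih2
    refine ⟨_, monoSpan.reindex (Equiv.equivOfIsEmpty (Empty ⊕ Empty) Empty) (Equiv.refl _)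
      (monoSpan.prod hf hg), fun D y hy J => ?_⟩
    refine (congrArg₂ (· * ·) (h1 D y hy _) (h2 D y hy _)).trans ?_
    refine congrArg₂ (· * ·) (congrArg (fun A => f D.G D.w y A _) (Subsingleton.elim _ _))
      (congrArg (fun A => g D.G D.w y A _) (Subsingleton.elim _ _))
  | @trace β _ _ τ _ ih =>
    obtain ⟨f, hf, h⟩ := ih
    -- A trace is a product with one factor g⁻¹ followed by the contraction of both its upper
    -- indices.
    have h1 := monoSpan.prod hf (monoSpan.metricInv_pow_mem (n := n) (L := L) 0 1)
    have h2 := monoSpan.contract (monoSpan.reindex (α' := Empty ⊕ Fin 2) (β' := β ⊕ Fin 2)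
      (Equiv.sumCongr (Equiv.refl _) (Equiv.uniqueProd _ _)) (Equiv.sumEmpty _ _) h1)
    refine ⟨_, h2, fun D y hy J => ?_⟩
    change NatTensor.trace D.G (τ D) y J = _
    unfold NatTensor.trace
    rw [← Fintype.sum_prod_type' fun a b => (D.G y)⁻¹ a b * τ D y (Sum.elim J ![a, b])]
    refine Fintype.sum_equiv (finTwoArrowEquiv (Fin n)).symm _ _ ?_
    rintro ⟨a, b⟩
    simp only [h D y hy]
    rw [mul_comm]
    refine congrArg₂ (· * ·) (congrArg (fun A => f D.G D.w y A _) (Subsingleton.elim _ _)) ?_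
    simp
  | metric => exact ⟨_, monoSpan.metric_mem, fun _ _ _ _ => rfl⟩
  | nablaRiemann r => exact ⟨_, monoSpan.nablaRiemann_mem r, fun _ _ _ _ => rfl⟩
  | nablaFun l h1 h2 => exact ⟨_, monoSpan.nablaFun_mem l h1 h2, fun _ _ _ _ => rfl⟩

/-! ### Jets of functions at a point -/

section Jets

variable {n : ℕ} {Ω : Set (Coord n)} {y : Coord n} {f g : Coord n → ℝ}

/-- `f` is smooth on `Ω` and its partial derivatives of order less than `k` vanish at `y`. -/
def VanishesToOrder (Ω : Set (Coord n)) (y : Coord n) : ℕ → (Coord n → ℝ) → Prop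
  | 0, f => ContDiffOn ℝ ∞ f Ω
  | k + 1, f => f y = 0 ∧ ContDiffOn ℝ ∞ f Ω ∧ ∀ i, VanishesToOrder Ω y k (pd i f)

namespace VanishesToOrder

variable {k : ℕ}

theorem smooth (h : VanishesToOrder Ω y k f) : ContDiffOn ℝ ∞ f Ω := by
  cases k with
  | zero => exact h
  | succ k => exact h.2.1

theorem congr_of_eventuallyEq (h : VanishesToOrder Ω y k f) (hg : ContDiffOn ℝ ∞ g Ω)
    (hΩ : IsOpen Ω) (hfg : f =ᶠ[nhds y] g) : VanishesToOrder Ω y k g := by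
  induction k generalizing f g with
  | zero => exact hg
  | succ k ih =>
    refine ⟨hfg.eq_of_nhds ▸ h.1, hg, fun i => ih (h.2.2 i) (contDiffOn_pd hΩ hg i) ?_⟩
    exact hfg.eventuallyEq_nhds.mono fun z hz => pd_congr i hz

theorem congr_of_eqOn (h : VanishesToOrder Ω y k f) (hΩ : IsOpen Ω) (hy : y ∈ Ω)
    (hfg : ∀ z ∈ Ω, g z = f z) : VanishesToOrder Ω y k g :=
  h.congr_of_eventuallyEq (h.smooth.congr hfg) hΩ
    (Filter.eventuallyEq_of_mem (hΩ.mem_nhds hy) fun z hz => (hfg z hz).symm)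

theorem of_succ (h : VanishesToOrder Ω y (k + 1) f) : VanishesToOrder Ω y k f := by
  induction k generalizing f with
  | zero => exact h.smooth
  | succ k ih => exact ⟨h.1, h.2.1, fun i => ih (h.2.2 i)⟩

theorem mono {l : ℕ} (hl : l ≤ k) (h : VanishesToOrder Ω y k f) : VanishesToOrder Ω y l f := by
  induction hl with
  | refl => exact h
  | step _ ih => exact ih h.of_succ

theorem zero : VanishesToOrder Ω y k fun _ => 0 := by
  induction k with
  | zero => exact contDiffOn_const
  | succ k ih =>
    refine ⟨rfl, contDiffOn_const, fun i => ?_⟩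
    have : pd i (fun _ : Coord n => (0 : ℝ)) = fun _ => 0 := by funext z; exact pd_const i 0
    rwa [this]

theorem add (hΩ : IsOpen Ω) (hy : y ∈ Ω) (hf : VanishesToOrder Ω y k f)
    (hg : VanishesToOrder Ω y k g) : VanishesToOrder Ω y k fun z => f z + g z := by
  induction k generalizing f g with
  | zero => exact ContDiffOn.add hf hg
  | succ k ih =>
    refine ⟨by simp [hf.1, hg.1], hf.smooth.add hg.smooth, fun i => ?_⟩
    exact (ih (hf.2.2 i) (hg.2.2 i)).congr_of_eqOn hΩ hy fun z hz =>
      pd_add i (differentiableAt_of_contDiffOn hΩ hf.smooth hz)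
        (differentiableAt_of_contDiffOn hΩ hg.smooth hz)

theorem mul_left (hΩ : IsOpen Ω) (hy : y ∈ Ω) (hg : ContDiffOn ℝ ∞ g Ω)
    (hf : VanishesToOrder Ω y k f) : VanishesToOrder Ω y k fun z => g z * f z := by
  induction k generalizing f g with
  | zero => exact ContDiffOn.mul hg hf
  | succ k ih =>
    refine ⟨by simp [hf.1], hg.mul hf.smooth, fun i => ?_⟩
    exact ((ih (contDiffOn_pd hΩ hg i) hf.of_succ).add hΩ hy (ih hg (hf.2.2 i))).congr_of_eqOn
      hΩ hy fun z hz => pd_mul i (differentiableAt_of_contDiffOn hΩ hg hz)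
        (differentiableAt_of_contDiffOn hΩ hf.smooth hz)

theorem sub (hΩ : IsOpen Ω) (hy : y ∈ Ω) (hf : VanishesToOrder Ω y k f)
    (hg : VanishesToOrder Ω y k g) : VanishesToOrder Ω y k fun z => f z - g z :=
  (hf.add hΩ hy (hg.mul_left hΩ hy (contDiffOn_const (c := -1)))).congr_of_eqOn hΩ hy
    fun z _ => by ring

theorem sum {ι : Type*} (hΩ : IsOpen Ω) (hy : y ∈ Ω) (s : Finset ι) {F : ι → Coord n → ℝ}
    (hF : ∀ i ∈ s, VanishesToOrder Ω y k (F i)) :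
    VanishesToOrder Ω y k fun z => ∑ i ∈ s, F i z := by
  classical
  induction s using Finset.induction_on with
  | empty => simpa using zero
  | insert a s ha ih =>
    simp only [Finset.sum_insert ha]
    exact (hF a (by simp)).add hΩ hy (ih fun i hi => hF i (by simp [hi]))

/-- In the product rule one term keeps f, which vanishes to order k, and the other has the
coordinate times ∂f, to which the induction applies. -/
theorem coord_mul (hΩ : IsOpen Ω) (hy : y ∈ Ω) (i : Fin n) (hf : VanishesToOrder Ω y k f) :
    VanishesToOrder Ω y (k + 1) fun z => (z i - y i) * f z := by
  have hc : ContDiff ℝ ∞ fun z : Coord n => z i - y i := by fun_prop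
  induction k generalizing f with
  | zero =>
    refine ⟨by simp, hc.contDiffOn.mul hf, fun j => ?_⟩
    exact contDiffOn_pd hΩ (hc.contDiffOn.mul hf) j
  | succ k ih =>
    refine ⟨by simp, hc.contDiffOn.mul hf.smooth, fun j => ?_⟩
    refine ((hf.mul_left hΩ hy (contDiffOn_pd hΩ hc.contDiffOn j)).add hΩ hy
      (ih (hf.2.2 j))).congr_of_eqOn hΩ hy fun z hz => ?_
    exact pd_mul j (differentiableAt_of_contDiffOn hΩ hc.contDiffOn hz)
      (differentiableAt_of_contDiffOn hΩ hf.smooth hz)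

theorem prod_coord (hΩ : IsOpen Ω) (hy : y ∈ Ω) (N : ℕ) (J : Fin N → Fin n) :
    VanishesToOrder Ω y N fun z => ∏ p, (z (J p) - y (J p)) := by
  induction N with
  | zero => exact (contDiffOn_const (c := 1)).congr fun z _ => by simp
  | succ N ih =>
    simp only [Fin.prod_univ_succ]
    exact (ih fun p => J p.succ).coord_mul hΩ hy (J 0)

end VanishesToOrder

/-! ### Iterated partial derivatives compared with covariant ones -/

/-- The iterated partial derivative. -/
def iterPd : (l : ℕ) → (Coord n → ℝ) → (Fin l → Fin n) → Coord n → ℝ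
  | 0, f, _ => f
  | l + 1, f, J => pd (J 0) (iterPd l f (Fin.tail J))

theorem iterPd_eq_iteratedFDeriv (hf : ContDiff ℝ ∞ f) (l : ℕ) (J : Fin l → Fin n) (z : Coord n) :
    iterPd l f J z = iteratedFDeriv ℝ l f z fun p => EuclideanSpace.single (J p) 1 := by
  induction l generalizing z with
  | zero => rfl
  | succ l ih =>
    rw [iteratedFDeriv_succ_apply_left]
    have h : iterPd l f (Fin.tail J) = fun z => iteratedFDeriv ℝ l f z
        fun p => EuclideanSpace.single (Fin.tail J p) 1 := funext fun z => ih _ _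
    have hd : DifferentiableAt ℝ (iteratedFDeriv ℝ l f) z :=
      (hf.differentiable_iteratedFDeriv (by exact_mod_cast WithTop.coe_lt_top l)) z
    unfold iterPd pd
    rw [h]
    exact fderiv_continuousMultilinear_apply_const_apply hd _ _

/-- Symmetric jets of pure order `L` can be prescribed. -/
theorem exists_vanishesToOrder_iterPd (hΩ : IsOpen Ω) (hy : y ∈ Ω) (L : ℕ)
    (c : (Fin L → Fin n) → ℝ) : ∃ ψ : Coord n → ℝ, ContDiff ℝ ∞ ψ ∧ VanishesToOrder Ω y L ψ ∧
      ∀ K, iterPd L ψ K y = ∑ σ : Equiv.Perm (Fin L), c (K ∘ σ) := by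
  -- The function ψ is the homogeneous polynomial Σ c_J ∏ (z - y)_{J p}, this form on the diagonal.
  -- Its L-th derivative is the sum of the form over all permutations of its arguments, without a
  -- factor 1/L!.
  let m : ContinuousMultilinearMap ℝ (fun _ : Fin L => Coord n) ℝ :=
    ∑ J : Fin L → Fin n, c J • (ContinuousMultilinearMap.mkPiAlgebra ℝ (Fin L) ℝ).compContinuousLinearMap
      fun p => EuclideanSpace.proj (J p)
  have hm : ∀ v, m v = ∑ J : Fin L → Fin n, c J * ∏ p, v p (J p) := by
    intro v; simp [m]
  have hψ : ContDiff ℝ ∞ fun z : Coord n =>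
      ∑ J : Fin L → Fin n, c J * ∏ p, (z (J p) - y (J p)) := by fun_prop
  refine ⟨_, hψ, ?_, fun K => ?_⟩
  · exact VanishesToOrder.sum hΩ hy _ fun J _ =>
      (VanishesToOrder.prod_coord hΩ hy L J).mul_left hΩ hy contDiffOn_const
  · rw [iterPd_eq_iteratedFDeriv hψ]
    let F : Coord n → ℝ := fun x => m fun _ => x
    have h1 : (fun z : Coord n => ∑ J : Fin L → Fin n, c J * ∏ p, (z (J p) - y (J p))) =
        fun z => F (z - y) := by
      funext z; simp [F, hm]
    rw [h1, iteratedFDeriv_comp_sub, m.iteratedFDeriv_comp_diagonal]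
    refine Finset.sum_congr rfl fun σ _ => ?_
    -- On basis vectors the monomial of J is nonzero only if J agrees with the permuted index K ∘ σ.
    rw [hm, Finset.sum_eq_single (K ∘ σ)]
    · simp
    · intro J _ hJ
      obtain ⟨p, hp⟩ := Function.ne_iff.1 hJ
      rw [Finset.prod_eq_zero (Finset.mem_univ p), mul_zero]
      simpa using hp
    · simp

theorem nablaFun_add {G : Coord n → Matrix (Fin n) (Fin n) ℝ} (hG : IsLocalMetric Ω G)
    (hf : ContDiffOn ℝ ∞ f Ω) (hg : ContDiffOn ℝ ∞ g Ω) (l : ℕ) : ∀ z ∈ Ω, ∀ J,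
    nablaFun G (fun z => f z + g z) l z J = nablaFun G f l z J + nablaFun G g l z J := by
  induction l with
  | zero => exact fun _ _ _ => rfl
  | succ l ih =>
    intro z hz J
    change covD G (nablaFun G _ l) z (optCons (J 0) (Fin.tail J)) = _
    rw [covD_congr hG.isOpen hz ih, covD_add hG.isOpen hz (smoothTensor_nablaFun hG hf l)
      (smoothTensor_nablaFun hG hg l)]
    rfl

theorem nablaFun_const_mul {G : Coord n → Matrix (Fin n) (Fin n) ℝ} (hG : IsLocalMetric Ω G)
    (hf : ContDiffOn ℝ ∞ f Ω) (c : ℝ) (l : ℕ) : ∀ z ∈ Ω, ∀ J,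
    nablaFun G (fun z => c * f z) l z J = c * nablaFun G f l z J := by
  induction l with
  | zero => exact fun _ _ _ => rfl
  | succ l ih =>
    intro z hz J
    change covD G (nablaFun G _ l) z (optCons (J 0) (Fin.tail J)) = _
    rw [covD_congr hG.isOpen hz ih, covD_const_mul hG.isOpen hz c (smoothTensor_nablaFun hG hf l)]
    rfl

/-- Each covariant derivative costs at most one order of vanishing: ∂ lowers the order by one, and
the Christoffel terms do not lower it. -/
theorem VanishesToOrder.nablaFun {G : Coord n → Matrix (Fin n) (Fin n) ℝ} (hG : IsLocalMetric Ω G)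
    (hy : y ∈ Ω) (l : ℕ) {k : ℕ} (h : VanishesToOrder Ω y (k + l) f) (J : Fin l → Fin n) :
    VanishesToOrder Ω y k fun z => nablaFun G f l z J := by
  have hΩ := hG.isOpen
  induction l generalizing k with
  | zero => exact h
  | succ l ih =>
    have ih' := ih (k := k + 1) (by rwa [add_right_comm, add_assoc])
    exact ((ih' (Fin.tail J)).2.2 (J 0)).sub hΩ hy (.sum hΩ hy _ fun p _ => .sum hΩ hy _ fun q _ =>
      (ih' _).of_succ.mul_left hΩ hy (hG.christoffel_smooth _ _ _))

theorem VanishesToOrder.nablaFun_eq_zero {G : Coord n → Matrix (Fin n) (Fin n) ℝ}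
    (hG : IsLocalMetric Ω G) (hy : y ∈ Ω) {l k : ℕ} (hl : l < k) (h : VanishesToOrder Ω y k f)
    (J : Fin l → Fin n) : NatTensor.nablaFun G f l y J = 0 :=
  (VanishesToOrder.nablaFun hG hy l (k := 1) (h.mono (by omega)) J).1

/-- Christoffel terms carry one derivative less and so vanish to one order more. For k = 0, the
leading covariant and partial derivatives therefore agree at the point. -/
theorem VanishesToOrder.nablaFun_sub_iterPd {G : Coord n → Matrix (Fin n) (Fin n) ℝ}
    (hG : IsLocalMetric Ω G) (hy : y ∈ Ω) (l : ℕ) {k : ℕ} (h : VanishesToOrder Ω y (k + l) f)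
    (J : Fin l → Fin n) :
    VanishesToOrder Ω y (k + 1) fun z => NatTensor.nablaFun G f l z J - iterPd l f J z := by
  have hΩ := hG.isOpen
  have sI : ∀ l, ∀ J : Fin l → Fin n, ContDiffOn ℝ ∞ (iterPd l f J) Ω := by
    intro l
    induction l with
    | zero => exact fun _ => h.smooth
    | succ l ih => exact fun J => contDiffOn_pd hΩ (ih _) _
  induction l generalizing k with
  | zero => exact VanishesToOrder.zero.congr_of_eqOn hΩ hy fun z _ => sub_self _
  | succ l ih =>
    have h' : VanishesToOrder Ω y (k + 1 + l) f := by rwa [add_right_comm, add_assoc]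
    have ih' := (ih h' (Fin.tail J)).2.2 (J 0)
    have h2 : VanishesToOrder Ω y (k + 1) fun z => ∑ p : Fin l, ∑ q : Fin n,
        christoffel G q (J 0) (Fin.tail J p) z *
          NatTensor.nablaFun G f l z (Function.update (Fin.tail J) p q) :=
      .sum hΩ hy _ fun p _ => .sum hΩ hy _ fun q _ =>
        (VanishesToOrder.nablaFun hG hy l h' _).mul_left hΩ hy (hG.christoffel_smooth _ _ _)
    refine (ih'.sub hΩ hy h2).congr_of_eqOn hΩ hy fun z hz => ?_
    rw [pd_sub _ (differentiableAt_of_contDiffOn hΩ (smoothTensor_nablaFun hG h.smooth l _) hz)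
      (differentiableAt_of_contDiffOn hΩ (sI l _) hz)]
    change (pd _ _ _ - _) - pd _ _ _ = _
    ring

theorem VanishesToOrder.nablaFun_eq_iterPd {G : Coord n → Matrix (Fin n) (Fin n) ℝ}
    (hG : IsLocalMetric Ω G) (hy : y ∈ Ω) {l : ℕ} (h : VanishesToOrder Ω y l f)
    (J : Fin l → Fin n) : NatTensor.nablaFun G f l y J = iterPd l f J y :=
  sub_eq_zero.1 (VanishesToOrder.nablaFun_sub_iterPd hG hy l (k := 0) (by rwa [zero_add]) J).1

theorem iterPd_congr (l : ℕ) (J : Fin l → Fin n) (h : f =ᶠ[nhds y] g) :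
    iterPd l f J =ᶠ[nhds y] iterPd l g J := by
  induction l with
  | zero => exact h
  | succ l ih => exact (ih (Fin.tail J)).eventuallyEq_nhds.mono fun z hz => pd_congr _ hz

end Jets

/-! ### Conformal change in linear combinations of partial contractions -/

section Weights

variable {n L : ℕ} {a b : ℕ}

/-- The homogeneity of a partial contraction under constant rescalings of the metric. -/
def PartialContraction.weight (c : PartialContraction a b) : ℝ :=
  2 * (c.numR + c.numG - c.numGInv)

/-- Each factor ∇ʳR or g contributes e^{2s} and each g⁻¹ contributes e^{-2s}. With f left free, this
serves both constant rescalings and, at a single point, arbitrary conformal ones. -/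
theorem PartialContraction.eval_of_scaled (c : PartialContraction a b) (hc : c.numOm = 0)
    {G G' : Coord n → Matrix (Fin n) (Fin n) ℝ} {w : Coord n → ℝ} {y : Coord n} (s : ℝ)
    (f : ∀ i, (Fin (4 + c.ordR i) → Fin n) → ℝ)
    (hR : ∀ i J, nablaRiemann G' (c.ordR i) y J = Real.exp (2 * s) * f i J)
    (hG : ∀ i j, G' y i j = Real.exp (2 * s) * G y i j)
    (hI : ∀ i j, (G' y)⁻¹ i j = Real.exp (-2 * s) * (G y)⁻¹ i j)
    (A : Fin a → Fin n) (B : Fin b → Fin n) : c.eval G' w y A B = Real.exp (c.weight * s) *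
      ∑ d : Fin c.numContr → Fin n,
      (∏ i, f i (fun s => Sum.elim B d (c.lower (Sum.inl ⟨i, s⟩)))) *
      (∏ p, G y (Sum.elim B d (c.lower (Sum.inr (Sum.inr (p, 0)))))
        (Sum.elim B d (c.lower (Sum.inr (Sum.inr (p, 1)))))) *
      (∏ q, (G y)⁻¹ (Sum.elim A d (c.upper (q, 0))) (Sum.elim A d (c.upper (q, 1)))) := by
  have : IsEmpty (Fin c.numOm) := by rw [hc]; infer_instance
  unfold PartialContraction.eval
  rw [Finset.mul_sum]
  refine Finset.sum_congr rfl fun d _ => ?_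
  simp only [hR, hG, hI, Finset.prod_mul_distrib, Finset.prod_const, Finset.card_univ,
    Fintype.card_fin, Finset.univ_eq_empty, Finset.prod_empty, mul_one]
  have he : Real.exp (c.weight * s) = Real.exp (2 * s) ^ c.numR * Real.exp (2 * s) ^ c.numG *
      Real.exp (-2 * s) ^ c.numGInv := by
    rw [← Real.exp_nat_mul, ← Real.exp_nat_mul, ← Real.exp_nat_mul, ← Real.exp_add, ← Real.exp_add,
      PartialContraction.weight]
    congr 1
    ring
  rw [he]
  ring

theorem PartialContraction.eval_confMatrix_const (c : PartialContraction a b) (hc : c.numOm = 0)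
    {Ω : Set (Coord n)} {G : Coord n → Matrix (Fin n) (Fin n) ℝ} (hG : IsLocalMetric Ω G)
    {w : Coord n → ℝ} {y : Coord n} (hy : y ∈ Ω) (s : ℝ) (A : Fin a → Fin n) (B : Fin b → Fin n) :
    c.eval (confMatrix (fun _ => s) G) w y A B = Real.exp (c.weight * s) * c.eval G w y A B := by
  have h0 : ∀ (s : ℝ), IsEmpty (Fin c.numOm) := fun _ => by rw [hc]; infer_instance
  have : IsEmpty (Fin c.numOm) := h0 0
  rw [c.eval_of_scaled hc (G := G) s (fun i J => nablaRiemann G (c.ordR i) y J)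
    (fun i J => nablaRiemann_confMatrix_const hG s _ y hy J) (fun i j => rfl)
    (fun i j => by rw [confMatrix_inv hG hy]; rfl)]
  unfold PartialContraction.eval
  simp

theorem monoSpan.mono {L' : ℕ} (hL : L ≤ L') {α β : Type} : monoSpan n L α β ≤ monoSpan n L' α β :=
  Submodule.span_mono fun _ ⟨c, hc, h⟩ => ⟨c, fun j => (hc j).trans hL, h⟩

/-- The conformal change of a partial contraction of `g`, `g⁻¹` and the `∇ʳR`. -/
theorem PartialContraction.exists_eval_confMatrix (c : PartialContraction a b) (hc : c.numOm = 0) :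
    ∃ L, ∃ f ∈ monoSpan n L (Fin a) (Fin b), ∀ (D : LocalData n), ∀ y ∈ D.Ω, ∀ w' A B,
      Real.exp (-c.weight * D.w y) * c.eval (confMatrix D.w D.G) w' y A B = f D.G D.w y A B := by
  -- Any common bound for the orders r + 2 will do.
  let L := ∑ i, (c.ordR i + 2)
  have hL : ∀ i, c.ordR i + 2 ≤ L := fun i =>
    Finset.single_le_sum (f := fun i => c.ordR i + 2) (fun _ _ => Nat.zero_le _) (Finset.mem_univ i)
  have : IsEmpty (Fin c.numOm) := by rw [hc]; infer_instance
  choose f hf hfe using fun i =>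
    ((IsNatural.confNablaRiemann (n := n) (c.ordR i)).mono (hL i)).exists_mem_monoSpan
  refine ⟨L, _, monoSpan.subst c (g := fun j => isEmptyElim j) hf (fun j => isEmptyElim j),
    fun D y hy w' A B => ?_⟩
  rw [c.eval_of_scaled hc (G := D.G) (D.w y) (fun i J => confNablaRiemann D.G D.w (c.ordR i) y J)
    (fun i J => nablaRiemann_confMatrix D.metric D.smooth _ y hy J) (fun i j => rfl)
    (fun i j => by rw [confMatrix_inv D.metric hy]; rfl), ← mul_assoc, ← Real.exp_add, neg_mul,
    neg_add_cancel, Real.exp_zero, one_mul]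
  refine Finset.sum_congr rfl fun d _ => ?_
  simp [hfe _ D y hy]

/-- The conformal change of a homogeneous linear combination of partial contractions of `g`, `g⁻¹`
and the `∇ʳR`. -/
theorem exists_evalComb_confMatrix (u : PartialContraction a b →₀ ℝ)
    (hu : ∀ c ∈ u.support, c.numOm = 0) (h : ℝ) (hw : ∀ c ∈ u.support, c.weight = h) :
    ∃ L, ∃ v : PartialContraction a b →₀ ℝ, (∀ c ∈ v.support, ∀ j, c.ordOm j ≤ L) ∧
      ∀ (D : LocalData n), ∀ y ∈ D.Ω, ∀ w' A B,
        Real.exp (-h * D.w y) * evalComb u (confMatrix D.w D.G) w' y A B =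
          evalComb v D.G D.w y A B := by
  classical
  -- The order bound varies with the contraction, so a common one is built up term by term.
  have key : ∀ s ⊆ u.support, ∃ L, ∃ f ∈ monoSpan n L (Fin a) (Fin b),
      ∀ (D : LocalData n), ∀ y ∈ D.Ω, ∀ w' A B, ∑ c ∈ s, u c * (Real.exp (-h * D.w y) *
        c.eval (confMatrix D.w D.G) w' y A B) = f D.G D.w y A B := by
    intro s hs
    induction s using Finset.induction_on with
    | empty => exact ⟨0, 0, zero_mem _, fun _ _ _ _ _ _ => by simp⟩
    | insert c s hcs ih =>
      obtain ⟨L1, f, hf, h1⟩ := ih ((Finset.subset_insert _ _).trans hs)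
      have hc := hs (Finset.mem_insert_self c s)
      obtain ⟨L2, g, hg, h2⟩ := c.exists_eval_confMatrix (n := n) (hu c hc)
      refine ⟨max L1 L2, u c • g + f, add_mem (Submodule.smul_mem _ _
        (monoSpan.mono (le_max_right _ _) hg)) (monoSpan.mono (le_max_left _ _) hf),
        fun D y hy w' A B => ?_⟩
      rw [Finset.sum_insert hcs, h1 D y hy, ← hw c hc, h2 D y hy]
      rfl
  obtain ⟨L, f, hf, h1⟩ := key u.support subset_rfl
  obtain ⟨v, hv, rfl⟩ := monoSpan.exists_evalComb hf
  refine ⟨L, v, hv, fun D y hy w' A B => ?_⟩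
  rw [← h1 D y hy w' A B, evalComb, Finsupp.sum, Finset.mul_sum]
  exact Finset.sum_congr rfl fun c _ => by ring

/-- Distinct exponentials are distinct characters of the additive group ℝ, so Dedekind's
independence of characters applies. -/
theorem linearIndependent_exp_mul :
    LinearIndependent ℝ fun (μ : ℝ) (t : ℝ) => Real.exp (μ * t) := by
  let χ : ℝ → (Multiplicative ℝ →* ℝ) := fun μ =>
    { toFun := fun t => Real.exp (μ * t.toAdd)
      map_one' := by simp
      map_mul' := fun s t => by simp [mul_add, Real.exp_add] }
  have hχ : Function.Injective χ := by
    intro μ ν h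
    have := DFunLike.congr_fun h (Multiplicative.ofAdd 1)
    simpa [χ] using this
  exact (linearIndependent_monoidHom (Multiplicative ℝ) ℝ).comp χ hχ

/-- Only terms of the right weight contribute to a homogeneous sum. -/
theorem sum_filter_eq_of_homogeneous {ι : Type*} (s : Finset ι) (x μ : ι → ℝ) (h : ℝ)
    [DecidablePred fun c => μ c = h]
    (hx : ∀ t : ℝ, ∑ c ∈ s, x c * Real.exp (μ c * t) = Real.exp (h * t) * ∑ c ∈ s, x c) :
    ∑ c ∈ s with μ c = h, x c = ∑ c ∈ s, x c := by
  classical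
  -- The coefficients of the hypothesis as a vanishing combination of exponentials, grouped by
  -- weight; its coefficient at h is the claim.
  let l : ℝ →₀ ℝ := ∑ c ∈ s, Finsupp.single (μ c) (x c) - Finsupp.single h (∑ c ∈ s, x c)
  have hl : Finsupp.linearCombination ℝ (fun (μ : ℝ) (t : ℝ) => Real.exp (μ * t)) l = 0 := by
    funext t
    simp only [l, map_sub, map_sum, Finsupp.linearCombination_single, Pi.sub_apply,
      Finset.sum_apply, Pi.smul_apply, smul_eq_mul, Pi.zero_apply]
    rw [hx t]
    ring
  have h0 := DFunLike.congr_fun (linearIndependent_iff.1 linearIndependent_exp_mul l hl) h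
  simp only [l, Finsupp.sub_apply, Finsupp.finsetSum_apply, Finsupp.single_apply, if_true,
    Finsupp.zero_apply] at h0
  rw [Finset.sum_filter]
  linarith

theorem evalComb_congr_fun (u : PartialContraction a b →₀ ℝ)
    {G : Coord n → Matrix (Fin n) (Fin n) ℝ} {w w' : Coord n → ℝ} {y : Coord n}
    (h : ∀ c ∈ u.support, ∀ j J, nablaFun G w (c.ordOm j) y J = nablaFun G w' (c.ordOm j) y J)
    (A : Fin a → Fin n) (B : Fin b → Fin n) : evalComb u G w y A B = evalComb u G w' y A B := by
  refine Finset.sum_congr rfl fun c hc => ?_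
  simp only [PartialContraction.eval, h c hc]

/-- The result of removing the symmetric part of the highest derivatives of the function. -/
theorem exists_evalComb_sub_symmetrization (k : ℕ) (u : PartialContraction a b →₀ ℝ)
    (hu : ∀ c ∈ u.support, ∀ j, c.ordOm j ≤ k + 1) :
    ∃ v : PartialContraction a b →₀ ℝ, (∀ c ∈ v.support, ∀ j, c.ordOm j ≤ k) ∧
      ∀ (D : LocalData n), ∀ y ∈ D.Ω, ∀ w' : Coord n → ℝ,
        (∀ l, 1 ≤ l → l ≤ k → ∀ J, nablaFun D.G w' l y J = nablaFun D.G D.w l y J) →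
        (∀ J, nablaFun D.G w' (k + 1) y J = nablaFun D.G D.w (k + 1) y J -
          ((k + 1).factorial : ℝ)⁻¹ *
            ∑ σ : Equiv.Perm (Fin (k + 1)), nablaFun D.G D.w (k + 1) y (J ∘ σ)) →
        ∀ A B, evalComb u D.G w' y A B = evalComb v D.G D.w y A B := by
  have hl : ∀ l, 1 ≤ l → l ≤ k + 1 → ∃ f ∈ monoSpan n k Empty (Fin l),
      ∀ (D : LocalData n), ∀ y ∈ D.Ω, ∀ w' : Coord n → ℝ,
        (∀ l, 1 ≤ l → l ≤ k → ∀ J, nablaFun D.G w' l y J = nablaFun D.G D.w l y J) →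
        (∀ J, nablaFun D.G w' (k + 1) y J = nablaFun D.G D.w (k + 1) y J -
          ((k + 1).factorial : ℝ)⁻¹ *
            ∑ σ : Equiv.Perm (Fin (k + 1)), nablaFun D.G D.w (k + 1) y (J ∘ σ)) →
        ∀ J, nablaFun D.G w' l y J = f D.G D.w y Empty.elim J := by
    intro l h1 h2
    -- At top order the hypothesis leaves ∇^{k+1}ω minus its symmetrization, which is natural of
    -- order k; lower orders are unchanged.
    rcases Nat.lt_or_ge k l with h3 | h3
    · obtain rfl : l = k + 1 := by omega
      obtain ⟨f, hf, h⟩ := (IsNatural.nablaFun_sub_symmetrization (n := n) k).exists_mem_monoSpan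
      exact ⟨f, hf, fun D y hy w' _ h5 J => (h5 J).trans (h D y hy J)⟩
    · exact ⟨_, monoSpan.nablaFun_mem l h1 h3, fun D y hy w' h4 _ J => h4 l h1 h3 J⟩
  have hc : ∀ c ∈ u.support, ∃ f ∈ monoSpan n k (Fin a) (Fin b),
      ∀ (D : LocalData n), ∀ y ∈ D.Ω, ∀ w' : Coord n → ℝ,
        (∀ l, 1 ≤ l → l ≤ k → ∀ J, nablaFun D.G w' l y J = nablaFun D.G D.w l y J) →
        (∀ J, nablaFun D.G w' (k + 1) y J = nablaFun D.G D.w (k + 1) y J -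
          ((k + 1).factorial : ℝ)⁻¹ *
            ∑ σ : Equiv.Perm (Fin (k + 1)), nablaFun D.G D.w (k + 1) y (J ∘ σ)) →
        ∀ A B, c.eval D.G w' y A B = f D.G D.w y A B := by
    intro c hc
    choose g hg hge using fun j => hl (c.ordOm j) (c.ordOm_pos j) (hu c hc j)
    refine ⟨_, monoSpan.subst c (fun i => monoSpan.nablaRiemann_mem (c.ordR i)) hg,
      fun D y hy w' h4 h5 A B => ?_⟩
    simp only [PartialContraction.eval, hge _ D y hy w' h4 h5]
  choose! F hF hFe using hc
  obtain ⟨v, hv, hve⟩ := monoSpan.exists_evalComb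
    (Submodule.sum_mem _ fun c hc => Submodule.smul_mem _ (u c) (hF c hc))
  refine ⟨v, hv, fun D y hy w' h4 h5 A B => ?_⟩
  rw [← hve]
  simp only [evalComb, Finsupp.sum, Finset.sum_apply, Pi.smul_apply, smul_eq_mul]
  exact Finset.sum_congr rfl fun c hc => by rw [hFe c hc D y hy w' h4 h5]

/-- The derivatives ∇ˡ are linear in the function, so the value is a polynomial in t. -/
theorem differentiable_evalComb_line (u : PartialContraction a b →₀ ℝ) {Ω : Set (Coord n)}
    {G : Coord n → Matrix (Fin n) (Fin n) ℝ} (hG : IsLocalMetric Ω G) {w ψ : Coord n → ℝ}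
    (hw : ContDiffOn ℝ ∞ w Ω) (hψ : ContDiffOn ℝ ∞ ψ Ω) {y : Coord n} (hy : y ∈ Ω)
    (A : Fin a → Fin n) (B : Fin b → Fin n) :
    Differentiable ℝ fun t : ℝ => evalComb u G (fun z => w z + t * ψ z) y A B := by
  have h : ∀ (t : ℝ) l J, nablaFun G (fun z => w z + t * ψ z) l y J =
      nablaFun G w l y J + t * nablaFun G ψ l y J := fun t l J => by
    rw [nablaFun_add hG hw (contDiffOn_const.mul hψ) l y hy,
      nablaFun_const_mul hG hψ t l y hy]
  simp only [evalComb, PartialContraction.eval, Finsupp.sum, h]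
  fun_prop

end Weights

/-! ### Charts of Riemannian manifolds -/

section ManifoldCharts

variable {n : ℕ} {M : Type} [TopologicalSpace M] [ChartedSpace (Coord n) M]
  [IsManifold (𝓡 n) ∞ M]

/-- Coordinate vector fields are the tangent map of the inverse chart applied to constant fields. -/
theorem contMDiffOn_coordVector {φ : OpenPartialHomeomorph M (Coord n)}
    (hφ : φ ∈ IsManifold.maximalAtlas (𝓡 n) ∞ M) (v : Coord n) :
    ContMDiffOn 𝓘(ℝ, Coord n) (𝓡 n).tangent ∞ (fun y => Bundle.TotalSpace.mk' (Coord n)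
      (E := fun x : M => TangentSpace (𝓡 n) x) (φ.symm y)
      (mfderiv 𝓘(ℝ, Coord n) (𝓡 n) φ.symm y v)) φ.target := by
  have h1 := (contMDiffOn_symm_of_mem_maximalAtlas hφ).contMDiffOn_tangentMapWithin (m := ∞)
    (by simp) φ.open_target.uniqueMDiffOn
  have h2 := (contMDiff_vectorSpace_iff_contDiff (𝕜 := ℝ) (n := ∞)
    (V := fun _ : Coord n => (v : Coord n))).2
    (contDiff_const : ContDiff ℝ ∞ fun _ : Coord n => v)
  refine (h1.comp h2.contMDiffOn fun y hy => hy).congr fun y hy => ?_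
  simp only [Function.comp_apply, tangentMapWithin,
    mfderivWithin_of_isOpen φ.open_target hy]

theorem contDiffOn_comp_symm {φ : OpenPartialHomeomorph M (Coord n)}
    (hφ : φ ∈ IsManifold.maximalAtlas (𝓡 n) ∞ M) (om : C^∞⟮𝓡 n, M; ℝ⟯) :
    ContDiffOn ℝ ∞ (fun z => om (φ.symm z)) φ.target :=
  (om.contMDiff.comp_contMDiffOn (contMDiffOn_symm_of_mem_maximalAtlas hφ)).contDiffOn

theorem metricMatrix_conformal (g : Metric n M) (om : C^∞⟮𝓡 n, M; ℝ⟯)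
    (φ : OpenPartialHomeomorph M (Coord n)) :
    metricMatrix (conformal om g) φ = confMatrix (fun z => om (φ.symm z)) (metricMatrix g φ) :=
  rfl

theorem isLocalMetric_metricMatrix (g : Metric n M) {φ : OpenPartialHomeomorph M (Coord n)}
    (hφ : φ ∈ IsManifold.maximalAtlas (𝓡 n) ∞ M) :
    IsLocalMetric φ.target (metricMatrix g φ) where
  isOpen := φ.open_target
  smooth i j := by
    have hg : ContMDiffOn 𝓘(ℝ, Coord n) _ ∞ _ φ.target :=
      g.contMDiff.comp_contMDiffOn (contMDiffOn_symm_of_mem_maximalAtlas hφ)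
    have h := ContMDiffOn.clm_bundle_apply₂ (F₁ := Coord n) (F₂ := Coord n) (F₃ := ℝ)
      (E₃ := fun _ : M => ℝ) hg
      (contMDiffOn_coordVector hφ (EuclideanSpace.single i (1 : ℝ)))
      (contMDiffOn_coordVector hφ (EuclideanSpace.single j (1 : ℝ)))
    intro y hy
    exact ((Bundle.contMDiffWithinAt_totalSpace.1 (h y hy)).2).contDiffWithinAt
  symm z _ i j := g.symm _ _ _
  -- A kernel vector of the matrix would be the coordinates of a nonzero tangent vector of length
  -- zero; the differential of the chart is what keeps it nonzero.
  det_ne z hz := by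
    intro hdet
    obtain ⟨v, hv, hv0⟩ := Matrix.exists_mulVec_eq_zero_iff.2 hdet
    have hd : φ.MDifferentiable (𝓡 n) 𝓘(ℝ, Coord n) :=
      ⟨(contMDiffOn_of_mem_maximalAtlas hφ).mdifferentiableOn (by simp),
        (contMDiffOn_symm_of_mem_maximalAtlas hφ).mdifferentiableOn (by simp)⟩
    let A : Coord n →L[ℝ] TangentSpace (𝓡 n) (φ.symm z) :=
      mfderiv 𝓘(ℝ, Coord n) (𝓡 n) φ.symm z
    have hA : Function.Injective A := by
      have h := hd.comp_symm_deriv hz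
      intro a b hab
      have ha := DFunLike.congr_fun h a
      have hb := DFunLike.congr_fun h b
      have : mfderiv (𝓡 n) 𝓘(ℝ, Coord n) φ (φ.symm z) (A a) =
        mfderiv (𝓡 n) 𝓘(ℝ, Coord n) φ (φ.symm z) (A b) := by rw [hab]
      exact ha.symm.trans (this.trans hb)
    let V : Coord n := ∑ i, v i • EuclideanSpace.single i (1 : ℝ)
    have hV : V ≠ 0 := by
      intro h
      apply hv
      funext i
      have := congrArg (fun x : Coord n => x i) h
      simpa [V, Pi.single_apply] using this
    have hpos := g.pos _ (A V) fun h => hV (hA (h.trans (map_zero A).symm))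
    have hq : g.inner (φ.symm z) (A V) (A V) = ∑ i, v i * ∑ j, metricMatrix g φ z i j * v j := by
      simp only [V, map_sum, map_smul, sum_apply,
        smul_apply, smul_eq_mul, Finset.mul_sum]
      rw [Finset.sum_comm]
      refine Finset.sum_congr rfl fun i _ => Finset.sum_congr rfl fun j _ => ?_
      change _ = v i * (g.inner (φ.symm z) (A _) (A _) * v j)
      ring
    have h0 : ∀ i, ∑ j, metricMatrix g φ z i j * v j = 0 := fun i => congrFun hv0 i
    simp only [h0, mul_zero, Finset.sum_const_zero] at hq
    exact hpos.ne' hq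

/-- The local data of a metric and a function in a chart. -/
def chartData (g : Metric n M) (om : C^∞⟮𝓡 n, M; ℝ⟯) {φ : OpenPartialHomeomorph M (Coord n)}
    (hφ : φ ∈ IsManifold.maximalAtlas (𝓡 n) ∞ M) : LocalData n where
  Ω := φ.target
  G := metricMatrix g φ
  w z := om (φ.symm z)
  metric := isLocalMetric_metricMatrix g hφ
  smooth := contDiffOn_comp_symm hφ om

/-- Germs of smooth functions at a point of a chart extend to the manifold. -/
theorem exists_contMDiffMap_eventuallyEq [T2Space M] {φ : OpenPartialHomeomorph M (Coord n)}
    (hφ : φ ∈ IsManifold.maximalAtlas (𝓡 n) ∞ M) {y : Coord n} (hy : y ∈ φ.target)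
    {ψ : Coord n → ℝ} (hψ : ContDiff ℝ ∞ ψ) :
    ∃ Ψ : C^∞⟮𝓡 n, M; ℝ⟯, ψ =ᶠ[nhds y] fun z => Ψ (φ.symm z) := by
  classical
  obtain ⟨r, hr, hball⟩ := Metric.nhds_basis_closedBall.mem_iff.1 (φ.open_target.mem_nhds hy)
  let b : ContDiffBump y := ⟨r / 2, r, by positivity, by linarith⟩
  have hb : ContDiff ℝ ∞ fun z => b z * ψ z := b.contDiff.mul hψ
  have hb0 : ∀ z, z ∉ Metric.closedBall y r → b z * ψ z = 0 := fun z hz => by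
    rw [b.zero_of_le_dist (le_of_lt (by simpa using hz)), zero_mul]
  let F : M → ℝ := fun x => if x ∈ φ.source then b (φ x) * ψ (φ x) else 0
  have hF : ContMDiff (𝓡 n) 𝓘(ℝ, ℝ) ∞ F := by
    intro x
    by_cases hx : x ∈ φ.source
    · have h1 : ContMDiffAt (𝓡 n) 𝓘(ℝ, ℝ) ∞ (fun x => b (φ x) * ψ (φ x)) x :=
        hb.contMDiff.contMDiffAt.comp x
          ((contMDiffOn_of_mem_maximalAtlas hφ).contMDiffAt (φ.open_source.mem_nhds hx))
      exact h1.congr_of_eventuallyEq (Filter.eventuallyEq_of_mem (φ.open_source.mem_nhds hx)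
        fun x' hx' => if_pos hx')
    -- Outside the chart domain, extension by zero is smooth because the image of the closed ball,
    -- which contains the support, is compact and hence closed in the Hausdorff space M.
    · have hK : IsClosed (φ.symm '' Metric.closedBall y r) :=
        ((isCompact_closedBall y r).image_of_continuousOn
          (φ.continuousOn_symm.mono hball)).isClosed
      have hxK : x ∈ (φ.symm '' Metric.closedBall y r)ᶜ := by
        rintro ⟨z, hz, rfl⟩
        exact hx (φ.map_target (hball hz))
      refine (contMDiffAt_const (c := (0 : ℝ))).congr_of_eventuallyEq
        (Filter.eventuallyEq_of_mem (hK.isOpen_compl.mem_nhds hxK) fun x' hx' => ?_)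
      by_cases hs : x' ∈ φ.source
      · exact (if_pos hs).trans (hb0 _ fun h => hx' ⟨φ x', h, φ.left_inv hs⟩)
      · exact if_neg hs
  refine ⟨⟨F, hF⟩, ?_⟩
  have h1 : ∀ᶠ z in nhds y, z ∈ Metric.closedBall y (r / 2) :=
    Metric.closedBall_mem_nhds y (by positivity)
  filter_upwards [h1, φ.open_target.mem_nhds hy] with z hz hzt
  change ψ z = if φ.symm z ∈ φ.source then _ else _
  rw [if_pos (φ.map_target hzt), φ.right_inv hzt, b.one_of_mem_closedBall hz, one_mul]

end ManifoldCharts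

/-! ### Conformal variations of natural tensors -/

section ConformalVariation

variable {n a b : ℕ} {T : MetricTensor n a b} {h : ℝ}

/-- The rescaled value `e^{-hω} T(e^{2ω} g)`. -/
def MetricTensor.rescaled (T : MetricTensor n a b) (h : ℝ) : MetricFunTensor n a b :=
  fun M _ _ _ _ _ g om φ y A B =>
    Real.exp (-h * om (φ.symm y)) * T M (conformal om g) φ y A B

/-- Equality of matrices suffices: a polynomial natural tensor sees a metric only through its matrix
in the chart. -/
theorem metricMatrix_conformal_conformal {M : Type} [TopologicalSpace M]
    [ChartedSpace (Coord n) M] [IsManifold (𝓡 n) ∞ M] (g : Metric n M)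
    (om om' : C^∞⟮𝓡 n, M; ℝ⟯) (φ : OpenPartialHomeomorph M (Coord n)) :
    metricMatrix (conformal om' (conformal om g)) φ = metricMatrix (conformal (om + om') g) φ := by
  funext y i j
  change Real.exp (2 * om' _) * (Real.exp (2 * om _) * metricMatrix g φ y i j) =
    Real.exp (2 * (om _ + om' _)) * metricMatrix g φ y i j
  rw [← mul_assoc, ← Real.exp_add]
  ring_nf

/-- A homogeneous polynomial natural tensor is a combination of contractions of its weight. -/
theorem MetricTensor.IsPolynomialNatural.exists_weight_eq (hT : T.IsPolynomialNatural)
    (hh : T.HasHomogeneity h) :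
    ∃ u : PartialContraction a b →₀ ℝ, (∀ c ∈ u.support, c.numOm = 0) ∧
      (∀ c ∈ u.support, c.weight = h) ∧
      ∀ (M : Type) [TopologicalSpace M] [T2Space M] [SecondCountableTopology M]
        [ChartedSpace (Coord n) M] [IsManifold (𝓡 n) ∞ M] (g : Metric n M),
        ∀ φ ∈ IsManifold.maximalAtlas (𝓡 n) ∞ M, ∀ y ∈ φ.target,
          ∀ (A : Fin a → Fin n) (B : Fin b → Fin n),
            T M g φ y A B = evalComb u (metricMatrix g φ) 0 y A B := by
  classical
  obtain ⟨u, hu0, hu⟩ := hT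
  refine ⟨u.filter fun c => c.weight = h, fun c hc => ?_, fun c hc => ?_, ?_⟩
  · rw [Finsupp.support_filter, Finset.mem_filter] at hc
    exact hu0 c hc.1
  · rw [Finsupp.support_filter, Finset.mem_filter] at hc
    exact hc.2
  intro M _ _ _ _ _ g φ hφ y hy A B
  -- Partial contractions can satisfy linear relations, so terms of other weights need not vanish
  -- individually. At a fixed metric, point and component, homogeneity under all constant factors
  -- shows that together they contribute nothing.
  have key := sum_filter_eq_of_homogeneous u.support
    (fun c => u c * c.eval (metricMatrix g φ) 0 y A B) PartialContraction.weight h fun t => by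
      have h1 := hh M g t φ hφ y hy A B
      rw [hu M _ φ hφ y hy A B, hu M _ φ hφ y hy A B, metricMatrix_conformal] at h1
      refine Eq.trans ?_ h1
      refine Finset.sum_congr rfl fun c hc => ?_
      have h2 := c.eval_confMatrix_const (hu0 c hc) (isLocalMetric_metricMatrix g hφ) (w := 0)
        hy t A B
      refine Eq.trans ?_ (congrArg (u c * ·) h2).symm
      ring
  rw [hu M g φ hφ y hy A B, evalComb, evalComb, Finsupp.sum_filter_index, Finsupp.support_filter]
  exact key.symm

theorem MetricTensor.exists_involvesAtMost_rescaled (hT : T.IsPolynomialNatural)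
    (hh : T.HasHomogeneity h) : ∃ L, (T.rescaled h).InvolvesAtMost L := by
  obtain ⟨u, hu0, huw, hu⟩ := hT.exists_weight_eq hh
  obtain ⟨L, v, hv, hev⟩ := exists_evalComb_confMatrix u hu0 h huw
  refine ⟨L, v, hv, fun M _ _ _ _ _ g om φ hφ y hy A B => ?_⟩
  rw [MetricTensor.rescaled, hu M _ φ hφ y hy A B]
  exact hev (chartData g om hφ) y hy 0 A B

/-- If the infinitesimal variation involves at most `m` derivatives of `ω`, the rescaled value
depends, at a point, only on the derivatives of `ω` of order at most `m`. -/
theorem MetricTensor.rescaled_add (hT : T.IsPolynomialNatural) {m L : ℕ}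
    (hm : (T.infVariation h).InvolvesAtMost m) (hL : (T.rescaled h).InvolvesAtMost L)
    {M : Type} [TopologicalSpace M] [T2Space M] [SecondCountableTopology M]
    [ChartedSpace (Coord n) M] [IsManifold (𝓡 n) ∞ M] (g : Metric n M) (om Ψ : C^∞⟮𝓡 n, M; ℝ⟯)
    {φ : OpenPartialHomeomorph M (Coord n)} (hφ : φ ∈ IsManifold.maximalAtlas (𝓡 n) ∞ M)
    {y : Coord n} (hy : y ∈ φ.target)
    (hΨ : VanishesToOrder φ.target y (m + 1) fun z => Ψ (φ.symm z))
    (A : Fin a → Fin n) (B : Fin b → Fin n) :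
    T.rescaled h M g (om + Ψ) φ y A B = T.rescaled h M g om φ y A B := by
  obtain ⟨u, hu0, hu⟩ := hT
  obtain ⟨v, hv, hev⟩ := hm
  obtain ⟨w, -, hw⟩ := hL
  let f : ℝ → ℝ := fun t => T.rescaled h M g (om + t • Ψ) φ y A B
  -- The finite-order formula makes f differentiable; without this, a vanishing `deriv` would not
  -- imply that f is constant.
  have hf : Differentiable ℝ f := by
    have hline := differentiable_evalComb_line w (isLocalMetric_metricMatrix g hφ)
      (contDiffOn_comp_symm hφ om) hΨ.smooth hy A B
    have hfe : f = _ := funext fun t => hw M g (om + t • Ψ) φ hφ y hy A B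
    rw [hfe]
    exact hline
  have hinf : ∀ ĝ : Metric n M, T.infVariation h M ĝ Ψ φ y A B = 0 := fun ĝ => by
    -- The directions Ψ and 0 have equal derivatives up to order m at the point, so the formula
    -- gives them equal variations; in the direction 0 the variation is that of a constant.
    have h0 : T.infVariation h M ĝ 0 φ y A B = 0 := by
      have : (fun t : ℝ => Real.exp (-h * t * (0 : C^∞⟮𝓡 n, M; ℝ⟯) (φ.symm y)) *
          T M (conformal (t • (0 : C^∞⟮𝓡 n, M; ℝ⟯)) ĝ) φ y A B) =
          fun _ => T M (conformal 0 ĝ) φ y A B := by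
        funext t
        simp
      rw [MetricTensor.infVariation, this, deriv_const]
    rw [hev M ĝ Ψ φ hφ y hy A B, ← h0, hev M ĝ 0 φ hφ y hy A B]
    refine evalComb_congr_fun v (fun c hc j J => ?_) A B
    have hG := isLocalMetric_metricMatrix ĝ hφ
    have hj := Nat.lt_succ_of_le (hv c hc j)
    rw [hΨ.nablaFun_eq_zero hG hy hj]
    exact (VanishesToOrder.zero.nablaFun_eq_zero hG hy hj J).symm
  have hderiv : ∀ s, deriv f s = 0 := fun s => by
    -- The cocycle property: moving on from s is a rescaling of the metric e^{2(ω + sΨ)} g, up to a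
    -- factor independent of t.
    have hfs : (fun t => f (s + t)) = fun t => Real.exp (-h * (om + s • Ψ) (φ.symm y)) *
        (Real.exp (-h * t * Ψ (φ.symm y)) *
          T M (conformal (t • Ψ) (conformal (om + s • Ψ) g)) φ y A B) := by
      funext t
      have hadd : om + (s + t) • Ψ = om + s • Ψ + t • Ψ := by
        rw [add_smul, add_assoc]
      simp only [f, MetricTensor.rescaled]
      rw [hu M _ φ hφ y hy A B, hu M _ φ hφ y hy A B, metricMatrix_conformal_conformal, hadd,
        ← mul_assoc, ← Real.exp_add]
      congr 2
      change -h * ((om _ + s * Ψ _) + t * Ψ _) = -h * (om _ + s * Ψ _) + -h * t * Ψ _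
      ring
    have h1 := deriv_comp_const_add f s 0
    rw [add_zero, hfs, deriv_const_mul_field] at h1
    rw [← h1]
    exact mul_eq_zero_of_right _ (hinf _)
  have h01 := is_const_of_deriv_eq_zero hf hderiv 1 0
  simpa [f] using h01

/-- Above the order of the infinitesimal variation, the top order derivatives of `ω` can be
removed from the rescaled value: by prescribing the germ of `ω` one may assume that the
symmetrization of `∇^{k+1} ω` vanishes at a given point. -/
theorem MetricFunTensor.InvolvesAtMost.rescaled_of_succ (hT : T.IsPolynomialNatural) {m k : ℕ}
    (hm : (T.infVariation h).InvolvesAtMost m) (hmk : m ≤ k)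
    (hk : (T.rescaled h).InvolvesAtMost (k + 1)) : (T.rescaled h).InvolvesAtMost k := by
  have hk' := hk
  obtain ⟨u, hu, hev⟩ := hk'
  obtain ⟨v, hv, hsub⟩ := exists_evalComb_sub_symmetrization (n := n) k u hu
  refine ⟨v, hv, fun M _ _ _ _ _ g om φ hφ y hy A B => ?_⟩
  have hG := isLocalMetric_metricMatrix g hφ
  have hw := contDiffOn_comp_symm hφ om
  -- The sum over permutations of this prescribed jet is minus the symmetrization of ∇^{k+1}ω at the
  -- point.
  obtain ⟨ψ, hψ, hψ0, hψd⟩ := exists_vanishesToOrder_iterPd φ.open_target hy (k + 1) fun J =>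
    -((k + 1).factorial : ℝ)⁻¹ * nablaFun (metricMatrix g φ) (fun z => om (φ.symm z)) (k + 1) y J
  obtain ⟨Ψ, hΨ⟩ := exists_contMDiffMap_eventuallyEq hφ hy hψ
  have hΨs := contDiffOn_comp_symm hφ Ψ
  have hΨ0 := hψ0.congr_of_eventuallyEq hΨs φ.open_target hΨ
  -- Here k ≥ m enters: vanishing to order k + 1 gives the order m + 1 needed to leave the rescaled
  -- value unchanged.
  rw [← T.rescaled_add hT hm hk g om Ψ hφ hy (hΨ0.mono (Nat.succ_le_succ hmk)) A B,
    hev M g (om + Ψ) φ hφ y hy A B]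
  refine hsub (chartData g om hφ) y hy _ (fun l _ hl J => ?_) (fun J => ?_) A B
  · refine (nablaFun_add hG hw hΨs l y hy J).trans ?_
    rw [hΨ0.nablaFun_eq_zero hG hy (Nat.lt_succ_of_le hl) J, add_zero]
    rfl
  -- At order k + 1 the covariant derivative of Ψ is its partial derivative at the point, hence the
  -- prescribed jet.
  · refine (nablaFun_add hG hw hΨs (k + 1) y hy J).trans ?_
    rw [hΨ0.nablaFun_eq_iterPd hG hy J, ← (iterPd_congr (k + 1) J hΨ).eq_of_nhds, hψd,
      ← Finset.mul_sum, neg_mul, ← sub_eq_add_neg]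
    rfl

theorem MetricFunTensor.InvolvesAtMost.mono {U : MetricFunTensor n a b} {k l : ℕ}
    (hU : U.InvolvesAtMost k) (hkl : k ≤ l) : U.InvolvesAtMost l := by
  obtain ⟨u, hu, hev⟩ := hU
  exact ⟨u, fun c hc j => (hu c hc j).trans hkl, hev⟩

theorem MetricTensor.rescaled_involvesAtMost (hT : T.IsPolynomialNatural)
    (hh : T.HasHomogeneity h) {m : ℕ} (hm : (T.infVariation h).InvolvesAtMost m) :
    (T.rescaled h).InvolvesAtMost m := by
  obtain ⟨L, hL⟩ := T.exists_involvesAtMost_rescaled hT hh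
  have key : ∀ d, (T.rescaled h).InvolvesAtMost (m + d) → (T.rescaled h).InvolvesAtMost m := by
    intro d
    induction d with
    | zero => exact id
    | succ d ih => exact fun hd => ih (hm.rescaled_of_succ hT (Nat.le_add_right m d) hd)
  -- Starting from m + L covers both L ≤ m and L > m.
  exact key L (hL.mono (Nat.le_add_left L m))

theorem evalComb_sub (u v : PartialContraction a b →₀ ℝ)
    (G : Coord n → Matrix (Fin n) (Fin n) ℝ) (w : Coord n → ℝ) (y : Coord n)
    (A : Fin a → Fin n) (B : Fin b → Fin n) :
    evalComb (u - v) G w y A B = evalComb u G w y A B - evalComb v G w y A B :=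
  Finsupp.sum_sub_index fun _ _ _ => sub_mul _ _ _

/-- The full variation is the rescaled value minus T(g), and the latter contains no derivatives of ω
at all. -/
theorem MetricTensor.fullVariation_involvesAtMost (hT : T.IsPolynomialNatural)
    (hh : T.HasHomogeneity h) {m : ℕ} (hm : (T.infVariation h).InvolvesAtMost m) :
    (T.fullVariation h).InvolvesAtMost m := by
  classical
  obtain ⟨v, hv, hev⟩ := T.rescaled_involvesAtMost hT hh hm
  obtain ⟨u, hu0, hu⟩ := hT
  have hu1 : ∀ c ∈ u.support, IsEmpty (Fin c.numOm) := fun c hc => by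
    rw [hu0 c hc]
    infer_instance
  refine ⟨v - u, fun c hc j => ?_, fun M _ _ _ _ _ g om φ hφ y hy A B => ?_⟩
  · rcases Finset.mem_union.1 (Finsupp.support_sub hc) with hc | hc
    · exact hv c hc j
    · exact ((hu1 c hc).false j).elim
  · rw [evalComb_sub, ← hev M g om φ hφ y hy A B, MetricTensor.fullVariation,
      hu M g φ hφ y hy A B, evalComb_congr_fun u (w' := fun z => om (φ.symm z))
        fun c hc j => ((hu1 c hc).false j).elim]
    rfl

end ConformalVariation

end NatTensor

end

theorem proposition3p5 {n : ℕ} (hn : 2 ≤ n) {a b : ℕ} (T : NatTensor.MetricTensor n a b)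
    (hT : T.IsPolynomialNatural) (h : ℝ) (hh : T.HasHomogeneity h) (m : ℕ)
    (hm : (T.infVariation h).InvolvesAtMost m) :
    (T.fullVariation h).InvolvesAtMost m :=
  T.fullVariation_involvesAtMost hT hh hm
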